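/- Let $G$ be a finite simple graph that is 2-connected (at least three vertices, and deleting any at most one vertex leaves a connected graph) and outerplanar, with a fixed planar embedding in which one face, the outer face, is incident to all vertices. The zero forcing number $Z(G)$ is the minimum size of a set $S$ of vertices such that, starting with exactly the vertices of $S$ colored and repeatedly applying the rule "a colored vertex with exactly one uncolored neighbor colors that neighbor", all vertices become colored. Let $G^*$ be the weak dual of $G$: its vertices are the faces of $G$ other than the outer face, two distinct ones being adjacent when they share an edge; it is a tree. A vertex of $G^*$ is - a *leaf* if its degree is at most one (degree zero occurs only when $G^*$ has a single vertex, i.e. $G$ is a cycle); - a *branch vertex* if it has degree two and is adjacent to a leaf or to another branch vertex (understood recursively, starting from the leaves); - a *limb vertex* if it has degree at least three and is adjacent to a leaf or a branch vertex; - a *trunk vertex* if it has degree at least two and is adjacent to no leaf and no branch vertex. Let $n_\ell$ be the number of leaves of $G^*$, let $n_T$ be the number of vertices of $G$ that lie on a face corresponding to a trunk vertex of $G^*$, and let $n_B$ be the number of those among these $n_T$ vertices that also lie on a face corresponding to a leaf, branch vertex or limb vertex of $G^*$ (the boundary vertices). Then $$Z(G)\;\le\; 2\left\lceil \frac{n_\ell}{2}\right\rceil+\frac{n_T-\frac{n_B}{2}}{2}.$$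 -/

import Mathlib

namespace ZeroForcing

/-! ### Zero forcing -/

/-- `Forced G S v`: starting from the set `S` of colored vertices, `v` is colored at some point by
the color change rule: a colored vertex `u` whose neighbors other than `v` are all colored
colors its neighbor `v`. -/
inductive Forced {V : Type*} (G : SimpleGraph V) (S : Set V) : V → Prop
  | initial (v : V) (hv : v ∈ S) : Forced G S v
  | force (u v : V) (hu : Forced G S u) (huv : G.Adj u v)
      (hw : ∀ w : V, G.Adj u w → w ≠ v → Forced G S w) : Forced G S v

/-- A zero forcing set: every vertex eventually becomes colored. -/
def IsZeroForcingSet {V : Type*} (G : SimpleGraph V) (S : Set V) : Prop :=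
  ∀ v : V, Forced G S v

/-- The zero forcing number `Z(G)` of a finite graph: the least size of a zero forcing set. -/
noncomputable def zeroForcingNumber {V : Type*} (G : SimpleGraph V) : ℕ :=
  sInf {k : ℕ | ∃ S : Finset V, IsZeroForcingSet G (S : Set V) ∧ S.card = k}

/-! ### Connectivity -/

/-- `k`-connectedness: more than `k` vertices, and deleting fewer than `k` vertices leaves a
connected graph. -/
def IsKConnected {V : Type*} (G : SimpleGraph V) (k : ℕ) : Prop :=
  k < Nat.card V ∧ ∀ S : Set V, S.encard < k → (G.induce Sᶜ).Connected

/-! ### Combinatorial embeddings, their faces, and the weak dual -/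

/-- A combinatorial embedding (rotation system) of a graph in an oriented closed surface: for
every vertex `v`, a cyclic ordering of the darts (oriented edges) with origin `v`. -/
structure RotationSystem {V : Type*} (G : SimpleGraph V) where
  /-- the next dart around the same origin -/
  rot : Equiv.Perm G.Dart
  rot_fst : ∀ d : G.Dart, (rot d).fst = d.fst
  rot_sameCycle : ∀ d e : G.Dart, d.fst = e.fst → rot.SameCycle d e

namespace RotationSystem

variable {V : Type*} {G : SimpleGraph V}

/-- The face tracing permutation: from the dart `u → v` go on to the dart that follows `v → u`
in the rotation at `v`. -/
def facePerm (R : RotationSystem G) : Equiv.Perm G.Dart :=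
  (SimpleGraph.Dart.symm_involutive (G := G)).toPerm.trans R.rot

/-- The faces of the embedding: the orbits of the face tracing permutation. -/
def Face (R : RotationSystem G) : Type _ :=
  Quotient (Equiv.Perm.SameCycle.setoid R.facePerm)

/-- The face on a fixed side of the dart `d`. The two sides of the edge of `d` belong to
`R.faceOf d` and `R.faceOf d.symm`. -/
def faceOf (R : RotationSystem G) (d : G.Dart) : R.Face :=
  Quotient.mk (Equiv.Perm.SameCycle.setoid R.facePerm) d

/-- The vertices on the boundary of a face. -/
def faceVertices (R : RotationSystem G) (f : R.Face) : Set V :=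
  {v : V | ∃ d : G.Dart, R.faceOf d = f ∧ d.fst = v}

/-- An embedding of a finite connected graph with at least one edge is planar, i.e. its surface is
the sphere, if Euler's formula `|V| - |E| + |F| = 2` holds. -/
def IsPlanar (R : RotationSystem G) : Prop :=
  (Nat.card V : ℤ) - (Nat.card G.edgeSet : ℤ) + (Nat.card R.Face : ℤ) = 2

end RotationSystem

/-- An outerplanar embedding of a finite connected graph with at least one edge: a planar embedding
together with a face (the outer face) that is incident to all vertices. -/
structure OuterplanarEmbedding {V : Type*} (G : SimpleGraph V) extends RotationSystem G where
  isPlanar : toRotationSystem.IsPlanar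
  outer : toRotationSystem.Face
  outer_vertices : toRotationSystem.faceVertices outer = Set.univ

/-! ### Leaves, branches, limbs and trunk of a (finite) tree -/

section Tree

variable {W : Type*} (T : SimpleGraph W)

/-- The degree of a vertex of a finite graph. -/
noncomputable def deg (f : W) : ℕ := (T.neighborSet f).ncard

/-- A leaf: a vertex of degree at most one. In a connected graph, degree zero occurs only for the
one-vertex tree, whose vertex counts as a leaf. -/
def IsLeaf (f : W) : Prop := deg T f ≤ 1

/-- A branch vertex: a vertex of degree two adjacent to a leaf or to another branch vertex
(understood recursively, starting at the leaves). -/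
inductive IsBranch : W → Prop
  | of_leaf (f g : W) (hf : deg T f = 2) (hfg : T.Adj f g) (hg : IsLeaf T g) : IsBranch f
  | of_branch (f g : W) (hf : deg T f = 2) (hfg : T.Adj f g) (hg : IsBranch g) : IsBranch f

/-- A limb vertex: a vertex of degree at least three adjacent to a leaf or a branch vertex. -/
def IsLimb (f : W) : Prop :=
  3 ≤ deg T f ∧ ∃ g : W, T.Adj f g ∧ (IsLeaf T g ∨ IsBranch T g)

/-- A trunk vertex: a vertex of degree at least two adjacent to no leaf and no branch vertex. -/
def IsTrunk (f : W) : Prop :=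
  2 ≤ deg T f ∧ ∀ g : W, T.Adj f g → ¬ IsLeaf T g ∧ ¬ IsBranch T g

end Tree

namespace OuterplanarEmbedding

variable {V : Type*} {G : SimpleGraph V}

/-- The bounded faces: all faces except the outer one. -/
abbrev InnerFace (Γ : OuterplanarEmbedding G) : Type _ :=
  {f : Γ.toRotationSystem.Face // f ≠ Γ.outer}

/-- The weak dual: its vertices are the bounded faces, and two distinct ones are adjacent if they
share an edge. -/
def weakDual (Γ : OuterplanarEmbedding G) : SimpleGraph Γ.InnerFace where
  Adj f g := f ≠ g ∧ ∃ d : G.Dart,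
    Γ.toRotationSystem.faceOf d = f.1 ∧ Γ.toRotationSystem.faceOf d.symm = g.1
  symm := ⟨fun _ _ h => ⟨h.1.symm, by
    obtain ⟨d, h1, h2⟩ := h.2
    exact ⟨d.symm, h2, by rw [SimpleGraph.Dart.symm_symm]; exact h1⟩⟩⟩
  loopless := ⟨fun _ h => h.1 rfl⟩

/-- The vertices of the trunk of `G`: those on a face that is a trunk vertex of the weak dual. -/
def trunkVertices (Γ : OuterplanarEmbedding G) : Set V :=
  {v : V | ∃ f : Γ.InnerFace, IsTrunk Γ.weakDual f ∧ v ∈ Γ.toRotationSystem.faceVertices f.1}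

/-- The vertices of the foliage of `G`: those on a face that is a leaf, a branch vertex or a limb
vertex of the weak dual. -/
def foliageVertices (Γ : OuterplanarEmbedding G) : Set V :=
  {v : V | ∃ f : Γ.InnerFace,
    (IsLeaf Γ.weakDual f ∨ IsBranch Γ.weakDual f ∨ IsLimb Γ.weakDual f) ∧
      v ∈ Γ.toRotationSystem.faceVertices f.1}

/-- The boundary vertices: those in both the foliage and the trunk. -/
def boundaryVertices (Γ : OuterplanarEmbedding G) : Set V :=
  Γ.foliageVertices ∩ Γ.trunkVertices

/-- `n_ℓ`: the number of leaves of the weak dual. -/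
noncomputable def numLeaves (Γ : OuterplanarEmbedding G) : ℕ :=
  {f : Γ.InnerFace | IsLeaf Γ.weakDual f}.ncard

/-- `n_T`: the number of vertices in the trunk. -/
noncomputable def numTrunk (Γ : OuterplanarEmbedding G) : ℕ := Γ.trunkVertices.ncard

/-- `n_B`: the number of boundary vertices. -/
noncomputable def numBoundary (Γ : OuterplanarEmbedding G) : ℕ := Γ.boundaryVertices.ncard

end OuterplanarEmbedding

end ZeroForcing

/-! The outer face is a Hamilton cycle (`RotationSystem.exists_tour`). Number the vertices along it
and fix the edge between the first and the last as root. The chords become noncrossing pairs, and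
each bounded face is the face just below exactly one inner edge, that is, a chord or the root edge.
Adjacency in the weak dual becomes "is a side of" (`exists_innerFace`, `exists_dart_iff`). All this
comes from homology modulo two: Euler's formula forces every closed chain to be the set of edges at
which some two-coloring of the faces changes (`exists_jump_eq`), a combinatorial Jordan curve
theorem.

The bound is an average of two costs. For the region under an inner edge, sets for two complementary
tasks are built together. If the region contains an odd number of ears (faces with no other inner
edge), one set colors it unaided (`Fills`) and the other colors it once both ends are served from
outside (`Absorbs`). If the number is even, the two sets sweep the region from either end
(`Sweeps`). Around a face, the corners get directions that turn exactly at the odd sides. Reversing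
all directions exchanges the two tasks on every side, so the costs of the sides just add up
(`exists_directed`). An ear costs two and zero, on average one per leaf. Everything is measured in
quarters of the bound: the cost of a pair is twice its sum, four times its average.

If some side is odd, nothing else has to be paid. If all sides are even, the flow runs one way
around the face and may need the far end of the top edge colored in advance, in both directions.
Here the trunk enters. Such a face, if not all ears lie below it, is a trunk face
(`isTrunk_of_even`): a leaf or branch next to it would have exactly one ear or all ears below it. So
the corners off the top edge can pay, with two quarters each, or one if the corner also lies on the
foliage.

Small faces have few corners, and boundary corners pay only half. This forces the finer invariant
`EvenRegion`. Generic regions put aside a quarter for each end that lies on the foliage inside them.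
Strong regions put nothing aside but color a whole end neighborhood unaided. Hooked regions, a
triangle over an edge and a strong region, are the remaining exception. `MonoFace.evenRegion` is the
case analysis, and `innerRegion` is the induction over inner edges.

The root edge is chosen so that its face is a leaf (`exists_unique_root`). Then the ears below it
number at least one fewer than the leaves. Filling everything, or coloring both root ends and
absorbing, gives the bound (`four_mul_zeroForcingNumber_le`). Rounding up to an even number comes
from the even case, where only the second option is used. -/

set_option linter.unusedSectionVars false

namespace ZeroForcing

/-! ### Closed sets and the forcing behaviour of regions -/

section Regions

variable {V : Type*} {G : SimpleGraph V}

/-- A set of vertices to which the color change rule adds nothing. -/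
def ForceClosed (G : SimpleGraph V) (C : Set V) : Prop :=
  ∀ u ∈ C, ∀ v, G.Adj u v → (∀ w, G.Adj u w → w ≠ v → w ∈ C) → v ∈ C

/-- `S` colors all of `K` as soon as `a` is colored together with its neighbors outside `K`. -/
def Sweeps (G : SimpleGraph V) (K : Set V) (a : V) (S : Finset V) : Prop :=
  ∀ C, ForceClosed G C → (S : Set V) ⊆ C → a ∈ C → (∀ w, G.Adj a w → w ∉ K → w ∈ C) → K ⊆ C

/-- `S` colors `b` without help. -/
def Emits (G : SimpleGraph V) (b : V) (S : Finset V) : Prop :=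
  ∀ C, ForceClosed G C → (S : Set V) ⊆ C → b ∈ C

/-- `S` sweeps `K` from `a` and colors `b` without help. -/
def SweepsTo (G : SimpleGraph V) (K : Set V) (a b : V) (S : Finset V) : Prop :=
  Sweeps G K a S ∧ Emits G b S

/-- `S` sweeps `K` from `a` and colors without help `b` and all its neighbors in `K`, except
possibly `a`. -/
def StronglySweepsTo (G : SimpleGraph V) (K : Set V) (a b : V) (S : Finset V) : Prop :=
  Sweeps G K a S ∧ ∀ C, ForceClosed G C → (S : Set V) ⊆ C →
    b ∈ C ∧ ∀ w ∈ K, G.Adj b w → w ≠ a → w ∈ C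

/-- `S` colors `K` without help. -/
def Fills (G : SimpleGraph V) (K : Set V) (S : Finset V) : Prop :=
  ∀ C, ForceClosed G C → (S : Set V) ⊆ C → K ⊆ C

/-- `S` colors `K` as soon as `a` and `b` are colored together with their neighbors outside `K`. -/
def Absorbs (G : SimpleGraph V) (K : Set V) (a b : V) (S : Finset V) : Prop :=
  ∀ C, ForceClosed G C → (S : Set V) ⊆ C → a ∈ C → b ∈ C →
    (∀ w, G.Adj a w → w ∉ K → w ∈ C) → (∀ w, G.Adj b w → w ∉ K → w ∈ C) → K ⊆ C

variable {K R : Set V} {a b : V} {S T : Finset V}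

theorem coe_subset_of_subset {C : Set V} (h : S ⊆ T) (hT : (T : Set V) ⊆ C) : (S : Set V) ⊆ C :=
  (Finset.coe_subset.2 h).trans hT

theorem Sweeps.mono (h : Sweeps G K a S) (hST : S ⊆ T) : Sweeps G K a T :=
  fun C hC hT => h C hC (coe_subset_of_subset hST hT)

theorem Emits.mono (h : Emits G b S) (hST : S ⊆ T) : Emits G b T :=
  fun C hC hT => h C hC (coe_subset_of_subset hST hT)

theorem SweepsTo.mono (h : SweepsTo G K a b S) (hST : S ⊆ T) : SweepsTo G K a b T :=
  ⟨h.1.mono hST, h.2.mono hST⟩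

theorem StronglySweepsTo.mono (h : StronglySweepsTo G K a b S) (hST : S ⊆ T) :
    StronglySweepsTo G K a b T :=
  ⟨h.1.mono hST, fun C hC hT => h.2 C hC (coe_subset_of_subset hST hT)⟩

theorem Fills.mono (h : Fills G K S) (hST : S ⊆ T) : Fills G K T :=
  fun C hC hT => h C hC (coe_subset_of_subset hST hT)

theorem Absorbs.mono (h : Absorbs G K a b S) (hST : S ⊆ T) : Absorbs G K a b T :=
  fun C hC hT => h C hC (coe_subset_of_subset hST hT)

theorem StronglySweepsTo.sweepsTo (h : StronglySweepsTo G K a b S) : SweepsTo G K a b S :=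
  ⟨h.1, fun C hC hS => (h.2 C hC hS).1⟩

theorem Sweeps.absorbs (h : Sweeps G K a S) : Absorbs G K a b S :=
  fun C hC hS ha _ hna _ => h C hC hS ha hna

theorem Absorbs.symm (h : Absorbs G K a b S) : Absorbs G K b a S :=
  fun C hC hS ha hb hna hnb => h C hC hS hb ha hnb hna

theorem emits_of_mem (h : b ∈ S) : Emits G b S := fun _ _ hS => hS (by simpa using h)

theorem sweeps_pair (h : G.Adj a b) : Sweeps G {a, b} a S := by
  intro C hC _ ha hna
  have hb : b ∈ C := hC a ha b h fun w hw hwb => hna w hw (by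
    rintro (rfl | rfl)
    · exact G.loopless.irrefl _ hw
    · exact hwb rfl)
  rintro w (rfl | rfl) <;> assumption

/-! ### Polygons: a face of the disk together with what lies behind its sides -/

/-- The region `R` consists of a bounded face with the edge `x 0, x (m + 1)` and the path
`x 0, …, x (m + 1)` as boundary, and of the regions `K i` behind the edges `x i, x (i + 1)`. -/
structure Polygon (G : SimpleGraph V) (m : ℕ) (x : ℕ → V) (K : ℕ → Set V) (R : Set V) : Prop where
  one_le : 1 ≤ m
  left_mem : ∀ i ≤ m, x i ∈ K i
  right_mem : ∀ i ≤ m, x (i + 1) ∈ K i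
  mem_iff : ∀ v, v ∈ R ↔ ∃ i ≤ m, v ∈ K i
  adj : G.Adj (x 0) (x (m + 1))
  nbr : ∀ i < m, ∀ w, G.Adj (x (i + 1)) w → w ∈ K i ∨ w ∈ K (i + 1)
  nbr_first : ∀ w ∈ R, G.Adj (x 0) w → w ∈ K 0 ∨ w = x (m + 1)
  nbr_last : ∀ w ∈ R, G.Adj (x (m + 1)) w → w ∈ K m ∨ w = x 0

namespace Polygon

variable {m : ℕ} {x : ℕ → V} {K : ℕ → Set V}

/-- Halves the work: every statement about flow towards higher indices is transported to the
opposite flow. -/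
theorem reverse (h : Polygon G m x K R) :
    Polygon G m (fun i => x (m + 1 - i)) (fun i => K (m - i)) R where
  one_le := h.one_le
  left_mem i hi := by
    have := h.right_mem (m - i) (by omega)
    rwa [show m - i + 1 = m + 1 - i by omega] at this
  right_mem i hi := by
    simpa only [show m + 1 - (i + 1) = m - i by omega] using h.left_mem (m - i) (by omega)
  mem_iff v := by
    rw [h.mem_iff]
    constructor
    · rintro ⟨i, hi, hv⟩
      exact ⟨m - i, by omega, by rwa [show m - (m - i) = i by omega]⟩
    · rintro ⟨i, hi, hv⟩
      exact ⟨m - i, by omega, hv⟩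
  adj := by simpa using h.adj.symm
  nbr i hi w hw := by
    have := h.nbr (m - (i + 1)) (by omega) w
      (by rwa [show m - (i + 1) + 1 = m + 1 - (i + 1) by omega])
    rw [show m - (i + 1) + 1 = m - i by omega] at this
    exact this.symm
  nbr_first w hw h' := by simpa using h.nbr_last w hw (by simpa using h')
  nbr_last w hw h' := by simpa using h.nbr_first w hw (by simpa using h')

theorem subset_of_sides (h : Polygon G m x K R) {C : Set V} (hC : ∀ i ≤ m, K i ⊆ C) : R ⊆ C := by
  intro v hv
  obtain ⟨i, hi, hv⟩ := (h.mem_iff v).1 hv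
  exact hC i hi hv

/-- The vertex `a` is colored together with its neighbors outside `K`. -/
def Ready (G : SimpleGraph V) (C : Set V) (K : Set V) (a : V) : Prop :=
  a ∈ C ∧ ∀ w, G.Adj a w → w ∉ K → w ∈ C

/-- An inner corner has neighbors only in its two adjacent sides, so coloring one side is all that
the next needs. -/
theorem ready_succ (h : Polygon G m x K R) {C : Set V} {i : ℕ} (hi : i < m) (hK : K i ⊆ C) :
    Ready G C (K (i + 1)) (x (i + 1)) :=
  ⟨hK (h.right_mem i hi.le), fun w hw hw' => hK ((h.nbr i hi w hw).resolve_right hw')⟩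

/-- Inside `R`, the only neighbor of `x 0` beyond the first side is the other end of the top edge.
Hence the far end must be colored before the first side can be swept. -/
theorem ready_first (h : Polygon G m x K R) {C : Set V} (ha : x 0 ∈ C)
    (hna : ∀ w, G.Adj (x 0) w → w ∉ R → w ∈ C) (hb : x (m + 1) ∈ C) : Ready G C (K 0) (x 0) := by
  refine ⟨ha, fun w hw hw' => ?_⟩
  by_cases hR : w ∈ R
  · rcases h.nbr_first w hR hw with h1 | rfl
    exacts [absurd h1 hw', hb]
  · exact hna w hw hR

theorem ready_last (h : Polygon G m x K R) {C : Set V} (ha : x (m + 1) ∈ C)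
    (hna : ∀ w, G.Adj (x (m + 1)) w → w ∉ R → w ∈ C) (hb : x 0 ∈ C) :
    Ready G C (K m) (x (m + 1)) := by
  refine ⟨ha, fun w hw hw' => ?_⟩
  by_cases hR : w ∈ R
  · rcases h.nbr_last w hR hw with h1 | rfl
    exacts [absurd h1 hw', hb]
  · exact hna w hw hR

/-- The forcing behaviour of the sides agrees with a labelling of the corners, `true` standing for
a flow towards higher indices. -/
def Labelled (G : SimpleGraph V) (m : ℕ) (x : ℕ → V) (K : ℕ → Set V) (l : ℕ → Bool)
    (S : Finset V) : Prop :=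
  ∀ i ≤ m, (l i = true → l (i + 1) = true → Sweeps G (K i) (x i) S) ∧
    (l i = false → l (i + 1) = false → Sweeps G (K i) (x (i + 1)) S) ∧
    (l i = false → l (i + 1) = true → Fills G (K i) S) ∧
    (l i = true → l (i + 1) = false → Absorbs G (K i) (x i) (x (i + 1)) S)

/-- A corner labelled `true` is fed from the left: the side before it is either swept forwards from
a ready corner or filled unaided. -/
theorem ready_right (h : Polygon G m x K R) {l : ℕ → Bool} (hl : Labelled G m x K l S)
    {C : Set V} (hC : ForceClosed G C) (hS : (S : Set V) ⊆ C) {j : ℕ}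
    (hj : l j = true → Ready G C (K j) (x j)) :
    ∀ i, j ≤ i → i ≤ m → l i = true → Ready G C (K i) (x i) := by
  intro i hji
  induction i, hji using Nat.le_induction with
  | base => exact fun _ => hj
  | succ i hji ih =>
    intro him hli
    refine h.ready_succ him ?_
    obtain ⟨h1, -, h3, -⟩ := hl i (by omega)
    cases hl' : l i with
    | true =>
      obtain ⟨r1, r2⟩ := ih (by omega) hl'
      exact h1 hl' hli C hC hS r1 r2
    | false => exact h3 hl' hli C hC hS

theorem Labelled.reverse {l : ℕ → Bool} (hl : Labelled G m x K l S) :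
    Labelled G m (fun i => x (m + 1 - i)) (fun i => K (m - i)) (fun i => !l (m + 1 - i)) S := by
  intro i hi
  obtain ⟨h1, h2, h3, h4⟩ := hl (m - i) (by omega)
  rw [show m - i + 1 = m + 1 - i by omega] at h1 h2 h3 h4
  have e : m + 1 - (i + 1) = m - i := by omega
  simp only [e, Bool.not_eq_true', Bool.not_eq_false']
  exact ⟨fun a b => h2 b a, fun a b => h1 b a, fun a b => h3 b a, fun a b => (h4 b a).symm⟩

theorem ready_left (h : Polygon G m x K R) {l : ℕ → Bool} (hl : Labelled G m x K l S)
    {C : Set V} (hC : ForceClosed G C) (hS : (S : Set V) ⊆ C) {j : ℕ} (hjm : j ≤ m)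
    (hj : l (j + 1) = false → Ready G C (K j) (x (j + 1))) :
    ∀ i ≤ j, l (i + 1) = false → Ready G C (K i) (x (i + 1)) := by
  intro i hij hli
  have := h.reverse.ready_right hl.reverse hC hS (j := m - j)
    (by
      intro h'
      rw [show m + 1 - (m - j) = j + 1 by omega] at h' ⊢
      rw [show m - (m - j) = j by omega]
      exact hj (by simpa using h')) (m - i) (by omega) (by omega)
  rw [show m + 1 - (m - i) = i + 1 by omega, show m - (m - i) = i by omega] at this
  exact this (by simpa using hli)

theorem side_subset_of_ready {l : ℕ → Bool} (hl : Labelled G m x K l S)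
    {C : Set V} (hC : ForceClosed G C) (hS : (S : Set V) ⊆ C) {i : ℕ} (hi : i ≤ m)
    (h1 : l i = true → Ready G C (K i) (x i))
    (h2 : l (i + 1) = false → Ready G C (K i) (x (i + 1))) : K i ⊆ C := by
  obtain ⟨a1, a2, a3, a4⟩ := hl i hi
  cases e1 : l i <;> cases e2 : l (i + 1)
  · exact a2 e1 e2 C hC hS (h2 e2).1 (h2 e2).2
  · exact a3 e1 e2 C hC hS
  · exact a4 e1 e2 C hC hS (h1 e1).1 (h2 e2).1 (h1 e1).2 (h2 e2).2
  · exact a1 e1 e2 C hC hS (h1 e1).1 (h1 e1).2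

theorem subset_of_labelled (h : Polygon G m x K R) {l : ℕ → Bool} (hl : Labelled G m x K l S)
    {C : Set V} (hC : ForceClosed G C) (hS : (S : Set V) ⊆ C)
    (h0 : l 0 = true → Ready G C (K 0) (x 0))
    (h1 : l (m + 1) = false → Ready G C (K m) (x (m + 1))) : R ⊆ C :=
  h.subset_of_sides fun i hi => side_subset_of_ready hl hC hS hi
    (h.ready_right hl hC hS h0 i (Nat.zero_le _) hi) (h.ready_left hl hC hS le_rfl h1 i hi)

/-- The flow leaves at both ends, so no help from outside is ever called for. -/
theorem fills_of_labelled (h : Polygon G m x K R) {l : ℕ → Bool} (hl : Labelled G m x K l S)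
    (h0 : l 0 = false) (h1 : l (m + 1) = true) : Fills G R S :=
  fun _ hC hS => h.subset_of_labelled hl hC hS (by simp [h0]) (by simp [h1])

theorem absorbs_of_labelled (h : Polygon G m x K R) {l : ℕ → Bool} (hl : Labelled G m x K l S) :
    Absorbs G R (x 0) (x (m + 1)) S :=
  fun _ hC hS ha hb hna hnb => h.subset_of_labelled hl hC hS
    (fun _ => h.ready_first ha hna hb) (fun _ => h.ready_last hb hnb ha)

theorem last_subset_of_ready (h : Polygon G m x K R) {l : ℕ → Bool} (hl : Labelled G m x K l S)
    {C : Set V} (hC : ForceClosed G C) (hS : (S : Set V) ⊆ C) {j : ℕ} (hjm : j ≤ m)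
    (hj : l j = true → Ready G C (K j) (x j)) (h1 : l (m + 1) = true) : K m ⊆ C :=
  side_subset_of_ready hl hC hS le_rfl (h.ready_right hl hC hS hj m hjm le_rfl) (by simp [h1])

/-- When the flow leaves at the last corner, the only obstacle is the color of that corner, which
blocks `x 0`; `hb` removes it. -/
theorem sweeps_of_labelled (h : Polygon G m x K R) {l : ℕ → Bool} (hl : Labelled G m x K l S)
    (h1 : l (m + 1) = true)
    (hb : ∀ C, ForceClosed G C → (S : Set V) ⊆ C → x 0 ∈ C →
      (∀ w, G.Adj (x 0) w → w ∉ R → w ∈ C) → x (m + 1) ∈ C) : Sweeps G R (x 0) S :=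
  fun C hC hS ha hna => h.subset_of_labelled hl hC hS
    (fun _ => h.ready_first ha hna (hb C hC hS ha hna)) (by simp [h1])

/-- Between a corner labelled `false` and the last corner, labelled `true`, some side is filled
unaided. From there the flow reaches the whole last side, which contains all neighbors of the last
corner in `R` but `x 0`. -/
theorem stronglySweepsTo_of_labelled (h : Polygon G m x K R) {l : ℕ → Bool}
    (hl : Labelled G m x K l S) (h1 : l (m + 1) = true) {j : ℕ} (hjm : j ≤ m) (hj : l j = false) :
    StronglySweepsTo G R (x 0) (x (m + 1)) S := by
  have key : ∀ C, ForceClosed G C → (S : Set V) ⊆ C → K m ⊆ C := fun C hC hS =>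
    h.last_subset_of_ready hl hC hS hjm (by simp [hj]) h1
  refine ⟨h.sweeps_of_labelled hl h1 fun C hC hS _ _ => key C hC hS (h.right_mem m le_rfl),
    fun C hC hS => ⟨key C hC hS (h.right_mem m le_rfl), fun w hw hbw hwa => ?_⟩⟩
  exact key C hC hS ((h.nbr_last w hw hbw).resolve_right hwa)

theorem labelled_true (hS : ∀ i ≤ m, Sweeps G (K i) (x i) S) :
    Labelled G m x K (fun _ => true) S := by
  intro i hi
  simp [hS i hi]

/-- All sides being swept forwards, the region is swept once its last corner is colored. -/
theorem sweepsTo_of_emits (h : Polygon G m x K R) (hS : ∀ i ≤ m, Sweeps G (K i) (x i) S)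
    (hb : Emits G (x (m + 1)) S) : SweepsTo G R (x 0) (x (m + 1)) S :=
  ⟨h.sweeps_of_labelled (labelled_true hS) rfl fun C hC hSC _ _ => hb C hC hSC, hb⟩

/-- The strong first side makes `x 1` ready before it is swept itself, its one missing neighbor `x
0` being given. The flow goes on to the far end, which then releases `x 0`. -/
theorem sweeps_of_first_strong (h : Polygon G m x K R) (hS : ∀ i ≤ m, Sweeps G (K i) (x i) S)
    (h0 : StronglySweepsTo G (K 0) (x 0) (x 1) S) : Sweeps G R (x 0) S := by
  refine h.sweeps_of_labelled (labelled_true hS) rfl fun C hC hSC ha _ => ?_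
  have hm := h.one_le
  obtain ⟨e1, e2⟩ := h0.2 C hC hSC
  have r1 : Ready G C (K 1) (x 1) := ⟨e1, fun w hw hw' => by
    have := (h.nbr 0 (by omega) w hw).resolve_right hw'
    by_cases hwa : w = x 0
    · exact hwa ▸ ha
    · exact e2 w this hw hwa⟩
  exact h.last_subset_of_ready (labelled_true hS) hC hSC hm (fun _ => r1) rfl
    (h.right_mem m le_rfl)

/-- The strong side colors everything around `x (j + 2)` in it except its own first end, and the
preceding side supplies that. The flow from there to the last corner needs no help. -/
theorem sweepsTo_of_consecutive (h : Polygon G m x K R) (hS : ∀ i ≤ m, Sweeps G (K i) (x i) S)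
    {j : ℕ} (hj : j < m) (h0 : Emits G (x (j + 1)) S)
    (h1 : StronglySweepsTo G (K (j + 1)) (x (j + 1)) (x (j + 2)) S) :
    SweepsTo G R (x 0) (x (m + 1)) S := by
  refine h.sweepsTo_of_emits hS fun C hC hSC => ?_
  obtain ⟨e1, e2⟩ := h1.2 C hC hSC
  rcases Nat.lt_or_ge (j + 1) m with hjm | hjm
  · have r1 : Ready G C (K (j + 2)) (x (j + 2)) := ⟨e1, fun w hw hw' => by
      have := (h.nbr (j + 1) hjm w hw).resolve_right hw'
      by_cases hwa : w = x (j + 1)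
      · exact hwa ▸ h0 C hC hSC
      · exact e2 w this hw hwa⟩
    exact h.last_subset_of_ready (labelled_true hS) hC hSC (j := j + 2) hjm (fun _ => r1) rfl
      (h.right_mem m le_rfl)
  · obtain rfl : m = j + 1 := by omega
    exact e1

/-- The neighbor `x 1` exempted by the strong second side is colored by the first side, which leaves
only `x 0` exempt. -/
theorem stronglySweepsTo_of_two (h : Polygon G 1 x K R)
    (h0 : SweepsTo G (K 0) (x 0) (x 1) S) (h1 : StronglySweepsTo G (K 1) (x 1) (x 2) S) :
    StronglySweepsTo G R (x 0) (x 2) S := by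
  have hS : ∀ i ≤ 1, Sweeps G (K i) (x i) S := by
    intro i hi
    interval_cases i
    exacts [h0.1, h1.1]
  have := h.sweepsTo_of_emits hS h1.sweepsTo.2
  refine ⟨this.1, fun C hC hSC => ⟨(h1.2 C hC hSC).1, fun w hw hbw hwa => ?_⟩⟩
  have hw1 := (h.nbr_last w hw hbw).resolve_right hwa
  by_cases e : w = x 1
  · exact e ▸ h0.2 C hC hSC
  · exact (h1.2 C hC hSC).2 w hw1 hbw e

/-- A face with the three sides edge, region, edge: the middle region may be swept backwards. -/
theorem sweeps_edge_side_edge (h : Polygon G 2 x K R) (h0 : K 0 = {x 0, x 1})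
    (h2 : K 2 = {x 2, x 3}) (h1 : StronglySweepsTo G (K 1) (x 2) (x 1) S)
    (a12 : G.Adj (x 1) (x 2)) : Sweeps G R (x 0) S := by
  intro C hC hSC ha hna
  obtain ⟨e1, e2⟩ := h1.2 C hC hSC
  have hb : x 3 ∈ C := by
    refine hC _ ha _ h.adj fun w hw hwb => ?_
    by_cases hR : w ∈ R
    · rcases h.nbr_first w hR hw with h' | rfl
      · rw [h0] at h'
        rcases h' with rfl | rfl
        exacts [ha, e1]
      · exact absurd rfl hwb
    · exact hna w hw hR
  have hx2 : x 2 ∈ C := by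
    refine hC _ e1 _ a12 fun w hw hwb => ?_
    rcases h.nbr 0 (by norm_num) w hw with h' | h'
    · rw [h0] at h'
      rcases h' with rfl | rfl
      exacts [ha, e1]
    · exact e2 w h' hw hwb
  have hK1 : K 1 ⊆ C := h1.1 C hC hSC hx2 fun w hw hw' => by
    have := (h.nbr 1 (by norm_num) w hw).resolve_left hw'
    rw [h2] at this
    rcases this with rfl | rfl
    exacts [hx2, hb]
  refine h.subset_of_sides fun i hi => ?_
  interval_cases i
  · rw [h0]; rintro w (rfl | rfl) <;> assumption
  · exact hK1
  · rw [h2]; rintro w (rfl | rfl) <;> assumption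

end Polygon

/-- Two triangles: the triangle on `a, x, b` with outer edge `x b` on top of the triangle on
`a, y, x` with outer edge `a y`, seen from `a`. -/
theorem sweeps_zigzag_left {x y : ℕ → V} {K L : ℕ → Set V} (h : Polygon G 1 x K R)
    (h' : Polygon G 1 y L (K 0)) (e0 : y 0 = x 0) (e2 : y 2 = x 1) (hK1 : K 1 = {x 1, x 2})
    (hL0 : L 0 = {y 0, y 1}) (hL1 : StronglySweepsTo G (L 1) (y 2) (y 1) S)
    (a12 : G.Adj (y 1) (y 2)) : Sweeps G R (x 0) S := by
  intro C hC hSC ha hna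
  obtain ⟨e1, f1⟩ := hL1.2 C hC hSC
  have hx1 : y 2 ∈ C := by
    refine hC _ e1 _ a12 fun w hw hwb => ?_
    rcases h'.nbr 0 (by norm_num) w hw with g | g
    · rw [hL0] at g
      rcases g with rfl | rfl
      exacts [e0 ▸ ha, e1]
    · exact f1 w g hw hwb
  have hb : x 2 ∈ C := by
    refine hC _ ha _ h.adj fun w hw hwb => ?_
    by_cases hR : w ∈ R
    · rcases h.nbr_first w hR hw with g | rfl
      · rw [← e0] at hw
        rcases h'.nbr_first w g hw with g | rfl
        · rw [hL0] at g
          rcases g with rfl | rfl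
          exacts [e0 ▸ ha, e1]
        · exact hx1
      · exact absurd rfl hwb
    · exact hna w hw hR
  have hL : L 1 ⊆ C := hL1.1 C hC hSC hx1 fun w hw hw' => by
    rcases h.nbr 0 (by norm_num) w (e2 ▸ hw) with g | g
    · rcases h'.nbr_last w g hw with g | rfl
      exacts [absurd g hw', e0 ▸ ha]
    · rw [hK1] at g
      rcases g with rfl | rfl
      exacts [e2 ▸ hx1, hb]
  have hK0 : K 0 ⊆ C := h'.subset_of_sides fun i hi => by
    interval_cases i
    · rw [hL0]; rintro w (rfl | rfl)
      exacts [e0 ▸ ha, e1]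
    · exact hL
  refine h.subset_of_sides fun i hi => ?_
  interval_cases i
  · exact hK0
  · rw [hK1]; rintro w (rfl | rfl)
    exacts [e2 ▸ hx1, hb]

/-- The configuration of `sweeps_zigzag_left`, seen from `b`. -/
theorem sweeps_zigzag_right {x y : ℕ → V} {K L : ℕ → Set V} (h : Polygon G 1 x K R)
    (h' : Polygon G 1 y L (K 0)) (e0 : y 0 = x 0) (e2 : y 2 = x 1) (hK1 : K 1 = {x 1, x 2})
    (hL0 : L 0 = {y 0, y 1}) (hL1 : StronglySweepsTo G (L 1) (y 1) (y 2) S)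
    (a12 : G.Adj (y 1) (y 2)) : Sweeps G R (x 2) S := by
  intro C hC hSC hb hnb
  obtain ⟨e1, f1⟩ := hL1.2 C hC hSC
  have ha : x 0 ∈ C := by
    refine hC _ hb _ h.adj.symm fun w hw hwb => ?_
    by_cases hR : w ∈ R
    · rcases h.nbr_last w hR hw with g | rfl
      · rw [hK1] at g
        rcases g with rfl | rfl
        exacts [e2 ▸ e1, hb]
      · exact absurd rfl hwb
    · exact hnb w hw hR
  have hy : y 1 ∈ C := by
    refine hC _ e1 _ a12.symm fun w hw hwb => ?_
    rcases h.nbr 0 (by norm_num) w (e2 ▸ hw) with g | g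
    · rcases h'.nbr_last w g hw with g | rfl
      exacts [f1 w g hw hwb, e0 ▸ ha]
    · rw [hK1] at g
      rcases g with rfl | rfl
      exacts [e2 ▸ e1, hb]
  have hL : L 1 ⊆ C := hL1.1 C hC hSC hy fun w hw hw' => by
    have g := (h'.nbr 0 (by norm_num) w hw).resolve_right hw'
    rw [hL0] at g
    rcases g with rfl | rfl
    exacts [e0 ▸ ha, hy]
  have hK0 : K 0 ⊆ C := h'.subset_of_sides fun i hi => by
    interval_cases i
    · rw [hL0]; rintro w (rfl | rfl)
      exacts [e0 ▸ ha, hy]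
    · exact hL
  refine h.subset_of_sides fun i hi => ?_
  interval_cases i
  · exact hK0
  · rw [hK1]; rintro w (rfl | rfl)
    exacts [e2 ▸ e1, hb]

/-- If the first side of a face is a triangle with outer edge `a y` on top of a region, then `a` is
colored by a backward sweep of that region, once the second corner of the face is. -/
theorem emits_of_first_edge_side {y : ℕ → V} {L : ℕ → Set V} {K : Set V} (h' : Polygon G 1 y L K)
    (hL0 : L 0 = {y 0, y 1}) (a01 : G.Adj (y 0) (y 1))
    (hL1 : StronglySweepsTo G (L 1) (y 2) (y 1) S) (h2 : Emits G (y 2) S) : Emits G (y 0) S := by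
  intro C hC hSC
  obtain ⟨e1, f1⟩ := hL1.2 C hC hSC
  refine hC _ e1 _ a01.symm fun w hw hwb => ?_
  rcases h'.nbr 0 (by norm_num) w hw with g | g
  · rw [hL0] at g
    rcases g with rfl | rfl
    exacts [absurd rfl hwb, e1]
  · by_cases e : w = y 2
    · exact e ▸ h2 C hC hSC
    · exact f1 w g hw e

end Regions

/-! ### The number of vertices needed for a forcing behaviour -/

section Costs

variable {V : Type*} [Fintype V] {G : SimpleGraph V}

/-- A property of sets of vertices that is inherited by supersets, and holds for all vertices. -/
def Attainable (P : Finset V → Prop) : Prop :=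
  (∀ S T, S ⊆ T → P S → P T) ∧ P Finset.univ

/-- The least size of a set with the property `P`. -/
noncomputable def cost (P : Finset V → Prop) : ℕ := sInf {k | ∃ S, P S ∧ S.card = k}

theorem cost_le {P : Finset V → Prop} {S : Finset V} (h : P S) : cost P ≤ S.card :=
  Nat.sInf_le ⟨S, h, rfl⟩

theorem Attainable.exists_eq {P : Finset V → Prop} (h : Attainable P) :
    ∃ S, P S ∧ S.card = cost P :=
  Nat.sInf_mem (s := {k | ∃ S, P S ∧ S.card = k}) ⟨_, _, h.2, rfl⟩

theorem Attainable.cost_le_cost {P Q : Finset V → Prop} (h : Attainable P) (hPQ : ∀ S, P S → Q S) :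
    cost Q ≤ cost P := by
  obtain ⟨S, hS, e⟩ := h.exists_eq
  exact e ▸ cost_le (hPQ S hS)

/-- The union of optimal sets works because attainable properties pass to supersets. -/
theorem exists_attains_all {m : ℕ} {P : ℕ → Finset V → Prop} (h : ∀ i ≤ m, Attainable (P i)) :
    ∃ T, (∀ i ≤ m, P i T) ∧ T.card ≤ ∑ i ∈ Finset.range (m + 1), cost (P i) := by
  classical
  have := fun i (hi : i ≤ m) => (h i hi).exists_eq
  choose! S hS hc using this
  refine ⟨(Finset.range (m + 1)).biUnion S, fun i hi => ?_, ?_⟩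
  · exact (h i hi).1 _ _ (Finset.subset_biUnion_of_mem S (by simpa using Nat.lt_succ_of_le hi))
      (hS i hi)
  · exact Finset.card_biUnion_le.trans (Finset.sum_le_sum fun i hi =>
      (hc i (by simpa [Nat.lt_succ_iff] using hi)).le)

/-- A bound for a cost by a sum of costs. -/
theorem cost_le_sum {m : ℕ} {P : ℕ → Finset V → Prop} {Q : Finset V → Prop}
    (h : ∀ i ≤ m, Attainable (P i)) (hQ : ∀ T, (∀ i ≤ m, P i T) → Q T) :
    cost Q ≤ ∑ i ∈ Finset.range (m + 1), cost (P i) := by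
  obtain ⟨T, hT, hc⟩ := exists_attains_all h
  exact (cost_le (hQ T hT)).trans hc

variable (K : Set V) (a b : V)

theorem attainable_sweeps : Attainable (Sweeps G K a) :=
  ⟨fun _ _ h h' => h'.mono h, fun _ _ hS _ _ v _ => hS (by simp)⟩

theorem attainable_sweepsTo : Attainable (SweepsTo G K a b) :=
  ⟨fun _ _ h h' => h'.mono h, fun _ _ hS _ _ v _ => hS (by simp), fun _ _ hS => hS (by simp)⟩

theorem attainable_stronglySweepsTo : Attainable (StronglySweepsTo G K a b) :=
  ⟨fun _ _ h h' => h'.mono h, fun _ _ hS _ _ v _ => hS (by simp), fun _ _ hS =>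
    ⟨hS (by simp), fun _ _ _ _ => hS (by simp)⟩⟩

theorem attainable_fills : Attainable (Fills G K) :=
  ⟨fun _ _ h h' => h'.mono h, fun _ _ hS v _ => hS (by simp)⟩

theorem attainable_absorbs : Attainable (Absorbs G K a b) :=
  ⟨fun _ _ h h' => h'.mono h, fun _ _ hS _ _ _ _ v _ => hS (by simp)⟩

variable (G)

theorem cost_sweeps_le_sweepsTo : cost (Sweeps G K a) ≤ cost (SweepsTo G K a b) :=
  (attainable_sweepsTo K a b).cost_le_cost fun _ h => h.1

theorem cost_sweepsTo_le_strongly :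
    cost (SweepsTo G K a b) ≤ cost (StronglySweepsTo G K a b) :=
  (attainable_stronglySweepsTo K a b).cost_le_cost fun _ h => h.sweepsTo

theorem cost_sweeps_le_strongly : cost (Sweeps G K a) ≤ cost (StronglySweepsTo G K a b) :=
  (cost_sweeps_le_sweepsTo G K a b).trans (cost_sweepsTo_le_strongly G K a b)

theorem cost_sweepsTo_le_sweeps_add_one :
    cost (SweepsTo G K a b) ≤ cost (Sweeps G K a) + 1 := by
  classical
  obtain ⟨S, hS, e⟩ := (attainable_sweeps (G := G) K a).exists_eq
  refine (cost_le (S := insert b S) ⟨hS.mono (Finset.subset_insert _ _),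
    emits_of_mem (Finset.mem_insert_self _ _)⟩).trans ?_
  exact e ▸ Finset.card_insert_le _ _

theorem cost_absorbs_le_left : cost (Absorbs G K a b) ≤ cost (Sweeps G K a) :=
  (attainable_sweeps K a).cost_le_cost fun _ h => h.absorbs

theorem cost_absorbs_le_right : cost (Absorbs G K a b) ≤ cost (Sweeps G K b) :=
  (attainable_sweeps K b).cost_le_cost fun _ h => h.absorbs.symm

variable {G}

theorem cost_sweeps_edge (h : G.Adj a b) : cost (Sweeps G {a, b} a) = 0 :=
  Nat.le_zero.1 (cost_le (S := ∅) (sweeps_pair h))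

/-! ### The classes of regions -/

/-- Both ends are strongly swept to within the budget. -/
def Strong (G : SimpleGraph V) (K : Set V) (a b : V) (t : ℕ) : Prop :=
  2 * (cost (StronglySweepsTo G K a b) + cost (StronglySweepsTo G K b a)) ≤ t

/-- The sweeps in both directions, one of them coloring its end in advance, are within the budget
reduced by the flags at the ends. -/
def Generic (G : SimpleGraph V) (K : Set V) (a b : V) (t fa fb : ℕ) : Prop :=
  2 * (cost (Sweeps G K a) + cost (Sweeps G K b)) + fa + fb ≤ t ∧
  2 * (cost (SweepsTo G K a b) + cost (Sweeps G K b)) + fa + fb ≤ t ∧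
  2 * (cost (Sweeps G K a) + cost (SweepsTo G K b a)) + fa + fb ≤ t

/-- A triangle over an edge at `a` and a strong region. -/
def Hooked (G : SimpleGraph V) (K : Set V) (a b : V) (t fa : ℕ) : Prop :=
  fa = 0 ∧ ∃ (y : ℕ → V) (L : ℕ → Set V), Polygon G 1 y L K ∧ y 0 = a ∧ y 2 = b ∧
    L 0 = {y 0, y 1} ∧ G.Adj (y 0) (y 1) ∧ G.Adj (y 1) (y 2) ∧
    2 * (cost (StronglySweepsTo G (L 1) (y 1) (y 2)) +
      cost (StronglySweepsTo G (L 1) (y 2) (y 1))) + 1 ≤ t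

/-- The invariant for regions with an even number of leaves. -/
def EvenRegion (G : SimpleGraph V) (K : Set V) (a b : V) (t fa fb : ℕ) : Prop :=
  Strong G K a b t ∨ Generic G K a b t fa fb ∨ Hooked G K a b t fa ∨ Hooked G K b a t fb

/-- The region of an edge of the outer cycle. -/
def EdgeRegion (G : SimpleGraph V) (K : Set V) (a b : V) (t fa fb : ℕ) : Prop :=
  K = {a, b} ∧ G.Adj a b ∧ t = 0 ∧ fa = 0 ∧ fb = 0

variable {K a b} {t fa fb : ℕ}

theorem Strong.symm (h : Strong G K a b t) : Strong G K b a t := by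
  unfold Strong at *; omega

theorem Generic.symm (h : Generic G K a b t fa fb) : Generic G K b a t fb fa := by
  unfold Generic at *; omega

theorem EvenRegion.symm (h : EvenRegion G K a b t fa fb) : EvenRegion G K b a t fb fa := by
  rcases h with h | h | h | h
  exacts [.inl h.symm, .inr (.inl h.symm), .inr (.inr (.inr h)), .inr (.inr (.inl h))]

theorem EdgeRegion.symm (h : EdgeRegion G K a b t fa fb) : EdgeRegion G K b a t fb fa := by
  obtain ⟨rfl, h1, h2, h3, h4⟩ := h
  exact ⟨Set.pair_comm _ _, h1.symm, h2, h4, h3⟩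

/-- The costs of the sweeps of a polygon in terms of those of its sides. -/
theorem Polygon.cost_sweepsTo_le {m : ℕ} {x : ℕ → V} {K : ℕ → Set V} {R : Set V}
    (h : Polygon G m x K R) : cost (SweepsTo G R (x 0) (x (m + 1))) ≤
      ∑ i ∈ Finset.range (m + 1), if i = m then cost (SweepsTo G (K i) (x i) (x (i + 1)))
        else cost (Sweeps G (K i) (x i)) := by
  have := cost_le_sum (m := m) (P := fun i => if i = m then SweepsTo G (K i) (x i) (x (i + 1))
        else Sweeps G (K i) (x i)) (Q := SweepsTo G R (x 0) (x (m + 1)))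
    (fun i _ => by
      split_ifs
      exacts [attainable_sweepsTo _ _ _, attainable_sweeps _ _])
    fun T hT => by
      refine h.sweepsTo_of_emits (fun i hi => ?_) (by
        have := hT m le_rfl
        rw [if_pos rfl] at this
        exact this.2)
      have := hT i hi
      split_ifs at this
      exacts [this.1, this]
  simpa only [apply_ite cost] using this

theorem Polygon.cost_sweepsTo_le_of_consecutive {m : ℕ} {x : ℕ → V} {K : ℕ → Set V} {R : Set V}
    (h : Polygon G m x K R) {j : ℕ} (hj : j < m) : cost (SweepsTo G R (x 0) (x (m + 1))) ≤
      ∑ i ∈ Finset.range (m + 1), if i = j ∨ i = j + 1 then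
        cost (StronglySweepsTo G (K i) (x i) (x (i + 1))) else cost (Sweeps G (K i) (x i)) := by
  have := cost_le_sum (m := m) (P := fun i => if i = j ∨ i = j + 1 then
      StronglySweepsTo G (K i) (x i) (x (i + 1)) else Sweeps G (K i) (x i))
    (Q := SweepsTo G R (x 0) (x (m + 1)))
    (fun i _ => by
      split_ifs
      exacts [attainable_stronglySweepsTo _ _ _, attainable_sweeps _ _])
    fun T hT => by
      refine h.sweepsTo_of_consecutive (j := j) (fun i hi => ?_) hj ?_ ?_
      · have := hT i hi
        split_ifs at this
        exacts [this.1, this]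
      · have := hT j hj.le
        rw [if_pos (.inl rfl)] at this
        exact this.sweepsTo.2
      · have := hT (j + 1) hj
        rwa [if_pos (.inr rfl)] at this
  simpa only [apply_ite cost] using this

end Costs

/-! ### Faces all of whose sides are even: the accounting -/

section Mono

variable {V : Type*} [Fintype V] {G : SimpleGraph V} {K R : Set V} {a b : V} {t fa fb : ℕ}

theorem EdgeRegion.costs (h : EdgeRegion G K a b t fa fb) :
    cost (Sweeps G K a) = 0 ∧ cost (Sweeps G K b) = 0 ∧ cost (SweepsTo G K a b) ≤ 1 ∧
      cost (SweepsTo G K b a) ≤ 1 := by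
  obtain ⟨rfl, h1, -⟩ := h
  have e1 := cost_sweeps_edge a b h1
  have e2 := cost_sweeps_edge b a h1.symm
  rw [Set.pair_comm] at e2
  exact ⟨e1, e2, (cost_sweepsTo_le_sweeps_add_one G _ _ _).trans_eq (by rw [e1]),
    (cost_sweepsTo_le_sweeps_add_one G _ _ _).trans_eq (by rw [e2])⟩

section Hook

variable {y : ℕ → V} {L : ℕ → Set V}

/-- From the edge side the hook is free: the edge is swept at no cost, and the strong region already
colors the far end. -/
theorem hook_cost_sweepsTo (h : Polygon G 1 y L K) (h0 : L 0 = {y 0, y 1})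
    (h1 : G.Adj (y 0) (y 1)) : cost (SweepsTo G K (y 0) (y 2)) ≤
      cost (StronglySweepsTo G (L 1) (y 1) (y 2)) :=
  (attainable_stronglySweepsTo _ _ _).cost_le_cost fun S hS =>
    h.sweepsTo_of_emits (fun i hi => by
      interval_cases i
      exacts [h0 ▸ sweeps_pair h1, hS.1]) hS.sweepsTo.2

theorem hook_sweeps {S : Finset V} (h : Polygon G 1 y L K) (h0 : L 0 = {y 0, y 1})
    (h1 : G.Adj (y 0) (y 1)) (hS : StronglySweepsTo G (L 1) (y 2) (y 1) S) :
    Sweeps G K (y 2) S :=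
  h.reverse.sweeps_of_first_strong (fun i hi => by
    interval_cases i
    · exact hS.1
    · have := sweeps_pair (S := S) h1.symm
      rw [Set.pair_comm, ← h0] at this
      exact this) hS

theorem hook_cost_sweeps (h : Polygon G 1 y L K) (h0 : L 0 = {y 0, y 1})
    (h1 : G.Adj (y 0) (y 1)) : cost (Sweeps G K (y 2)) ≤
      cost (StronglySweepsTo G (L 1) (y 2) (y 1)) :=
  (attainable_stronglySweepsTo _ _ _).cost_le_cost fun _ hS => hook_sweeps h h0 h1 hS

end Hook

/-- Towards `b` nothing is lost and the spare point remains. Coloring `a` in advance takes an extra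
vertex, worth two points, of which the spare point covers one. -/
theorem Hooked.costs (h : Hooked G K a b t fa) :
    2 * (cost (SweepsTo G K a b) + cost (Sweeps G K b)) + 1 ≤ t ∧
      2 * (cost (Sweeps G K a) + cost (SweepsTo G K b a)) ≤ t + 1 := by
  obtain ⟨-, y, L, h, rfl, rfl, h0, h1, -, ht⟩ := h
  have c1 := hook_cost_sweepsTo h h0 h1
  have c2 := hook_cost_sweeps h h0 h1
  have c3 := cost_sweeps_le_sweepsTo G K (y 0) (y 2)
  have c4 := cost_sweepsTo_le_sweeps_add_one G K (y 2) (y 0)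
  omega

/-- The costs of an even side, the excess over its budget being charged to its ends; `n` counts
strong regions, which do not pay for their flags. -/
theorem exists_charges (h : EdgeRegion G K a b t fa fb ∨ EvenRegion G K a b t fa fb)
    (ha : fa ≤ 1) (hb : fb ≤ 1) : ∃ n eL eR ra rb : ℕ, n ≤ 1 ∧ fa ≤ ra + n ∧ fb ≤ rb + n ∧
      (n = 1 → Strong G K a b t) ∧
      (eL = 0 ∨ eL = 2 ∧ n = 0 ∧ (EdgeRegion G K a b t fa fb ∨ Hooked G K a b t fa)) ∧
      (eR = 0 ∨ eR = 2 ∧ n = 0 ∧ (EdgeRegion G K a b t fa fb ∨ Hooked G K b a t fb)) ∧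
      2 * (cost (Sweeps G K a) + cost (Sweeps G K b)) + ra + rb ≤ t ∧
      2 * (cost (SweepsTo G K a b) + cost (Sweeps G K b)) + ra + rb ≤ t + eR ∧
      2 * (cost (Sweeps G K a) + cost (SweepsTo G K b a)) + ra + rb ≤ t + eL ∧
      (n = 1 → ra = 0 ∧ rb = 0) := by
  have c1 := cost_sweeps_le_sweepsTo G K a b
  have c2 := cost_sweeps_le_sweepsTo G K b a
  rcases h with h | h | h | h | h
  · obtain ⟨h1, h2, h3, h4⟩ := h.costs
    have := h.2.2
    exact ⟨0, 2, 2, fa, fb, by omega, by omega, by omega, by omega, .inr ⟨rfl, rfl, .inl h⟩,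
      .inr ⟨rfl, rfl, .inl h⟩, by omega, by omega, by omega, by omega⟩
  · have d1 := cost_sweepsTo_le_strongly G K a b
    have d2 := cost_sweepsTo_le_strongly G K b a
    have := h
    unfold Strong at this
    exact ⟨1, 0, 0, 0, 0, by omega, by omega, by omega, fun _ => h, .inl rfl, .inl rfl,
      by omega, by omega, by omega, by omega⟩
  · obtain ⟨h1, h2, h3⟩ := h
    exact ⟨0, 0, 0, fa, fb, by omega, by omega, by omega, by omega, .inl rfl, .inl rfl,
      by omega, by omega, by omega, by omega⟩
  · obtain ⟨h1, h2⟩ := h.costs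
    have := h.1
    exact ⟨0, 2, 0, fa, fb, by omega, by omega, by omega, by omega, .inr ⟨rfl, rfl, .inr h⟩,
      .inl rfl, by omega, by omega, by omega, by omega⟩
  · obtain ⟨h1, h2⟩ := h.costs
    have := h.1
    exact ⟨0, 0, 2, fa, fb, by omega, by omega, by omega, by omega, .inl rfl,
      .inr ⟨rfl, rfl, .inr h⟩, by omega, by omega, by omega, by omega⟩

/-- Each corner collects its weight, the reserves of both adjacent sides and a deficit `N`, together
at least two points. Only the two outermost reserves survive, as reserves of the new region. -/
theorem sum_budget (m : ℕ) {P t ra rb e ω N : ℕ → ℕ}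
    (hP : ∀ i ≤ m, P i + ra i + rb i ≤ t i + e i)
    (hω : ∀ i < m, 2 ≤ ω i + rb i + ra (i + 1) + N i) :
    ∑ i ∈ Finset.range (m + 1), P i + ra 0 + rb m + 2 * m ≤
      ∑ i ∈ Finset.range (m + 1), t i + ∑ i ∈ Finset.range m, ω i +
        ∑ i ∈ Finset.range (m + 1), e i + ∑ i ∈ Finset.range m, N i := by
  induction m with
  | zero => simpa [add_comm] using hP 0 le_rfl
  | succ m ih =>
    have := ih (fun i hi => hP i (by omega)) (fun i hi => hω i (by omega))
    have h1 := hP (m + 1) le_rfl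
    have h2 := hω m (by omega)
    rw [Finset.sum_range_succ P, Finset.sum_range_succ t, Finset.sum_range_succ e,
      Finset.sum_range_succ ω, Finset.sum_range_succ N]
    omega

/-- A face all of whose sides are even, every corner off its top edge being worth two points, up to
one point for the flags of the adjacent sides. -/
structure MonoFace (G : SimpleGraph V) (m : ℕ) (x : ℕ → V) (K : ℕ → Set V) (R : Set V)
    (t fa fb ω : ℕ → ℕ) : Prop where
  poly : Polygon G m x K R
  side : ∀ i ≤ m, EdgeRegion G (K i) (x i) (x (i + 1)) (t i) (fa i) (fb i) ∨
    EvenRegion G (K i) (x i) (x (i + 1)) (t i) (fa i) (fb i)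
  adj : ∀ i ≤ m, G.Adj (x i) (x (i + 1))
  fa_le : ∀ i ≤ m, fa i ≤ 1
  fb_le : ∀ i ≤ m, fb i ≤ 1
  one_le : ∀ i < m, 1 ≤ ω i
  two_le : ∀ i < m, 2 ≤ ω i + fb i + fa (i + 1)

namespace MonoFace

variable {m : ℕ} {x : ℕ → V} {K : ℕ → Set V} {t fa fb ω : ℕ → ℕ}

theorem reverse (h : MonoFace G m x K R t fa fb ω) :
    MonoFace G m (fun i => x (m + 1 - i)) (fun i => K (m - i)) R (fun i => t (m - i))
      (fun i => fb (m - i)) (fun i => fa (m - i)) (fun i => ω (m - 1 - i)) where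
  poly := h.poly.reverse
  side i hi := by
    have := h.side (m - i) (by omega)
    rw [show m - i + 1 = m + 1 - i by omega] at this
    rw [show m + 1 - (i + 1) = m - i by omega]
    exact this.imp (·.symm) (·.symm)
  adj i hi := by
    have := h.adj (m - i) (by omega)
    rw [show m - i + 1 = m + 1 - i by omega] at this
    rw [show m + 1 - (i + 1) = m - i by omega]
    exact this.symm
  fa_le i hi := h.fb_le _ (by omega)
  fb_le i hi := h.fa_le _ (by omega)
  one_le i hi := h.one_le _ (by omega)
  two_le i hi := by
    have := h.two_le (m - 1 - i) (by omega)
    rw [show m - 1 - i + 1 = m - i by omega] at this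
    rw [show m - (i + 1) = m - 1 - i by omega]
    omega

/-- The budget of the region. -/
def total (m : ℕ) (t ω : ℕ → ℕ) : ℕ :=
  ∑ i ∈ Finset.range (m + 1), t i + ∑ i ∈ Finset.range m, ω i

theorem total_reverse : total m (fun i => t (m - i)) (fun i => ω (m - 1 - i)) = total m t ω := by
  unfold total
  rw [Finset.sum_range_reflect ω m]
  congr 1
  have := Finset.sum_range_reflect t (m + 1)
  simpa using this

theorem cost_back_le (h : MonoFace G m x K R t fa fb ω) :
    cost (SweepsTo G R (x (m + 1)) (x 0)) ≤
      ∑ i ∈ Finset.range (m + 1), if i = 0 then cost (SweepsTo G (K i) (x (i + 1)) (x i))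
        else cost (Sweeps G (K i) (x (i + 1))) := by
  have := h.poly.reverse.cost_sweepsTo_le
  simp only [Nat.sub_zero, Nat.sub_self] at this
  refine this.trans_eq ?_
  rw [← Finset.sum_range_reflect]
  refine Finset.sum_congr rfl fun i hi => ?_
  have := Finset.mem_range.1 hi
  rw [show m + 1 - (m + 1 - 1 - i) = i + 1 by omega, show m - (m + 1 - 1 - i) = i by omega,
    show m + 1 - (m + 1 - 1 - i + 1) = i by omega]
  simp only [show m + 1 - 1 - i = m ↔ i = 0 by omega]

theorem cost_back_le_of_consecutive (h : MonoFace G m x K R t fa fb ω) {j : ℕ} (hj : j < m) :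
    cost (SweepsTo G R (x (m + 1)) (x 0)) ≤
      ∑ i ∈ Finset.range (m + 1), if i = j ∨ i = j + 1 then
        cost (StronglySweepsTo G (K i) (x (i + 1)) (x i)) else cost (Sweeps G (K i) (x (i + 1))) := by
  have := h.poly.reverse.cost_sweepsTo_le_of_consecutive (j := m - (j + 1)) (by omega)
  simp only [Nat.sub_zero, Nat.sub_self] at this
  refine this.trans_eq ?_
  rw [← Finset.sum_range_reflect]
  refine Finset.sum_congr rfl fun i hi => ?_
  have := Finset.mem_range.1 hi
  rw [show m + 1 - (m + 1 - 1 - i) = i + 1 by omega, show m - (m + 1 - 1 - i) = i by omega,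
    show m + 1 - (m + 1 - 1 - i + 1) = i by omega]
  simp only [show m + 1 - 1 - i = m - (j + 1) ∨ m + 1 - 1 - i = m - (j + 1) + 1 ↔
    i = j ∨ i = j + 1 by omega]

/-- The `m` corners yield `2 * m` points. They must cover the excesses `e` of the sides, the
deficits at corners beside strong sides, and the flags that a strong first or last side fails to
reserve. -/
theorem generic_of_costs (h : MonoFace G m x K R t fa fb ω) {p q e ra rb n : ℕ → ℕ}
    (hp : cost (SweepsTo G R (x 0) (x (m + 1))) ≤ ∑ i ∈ Finset.range (m + 1), p i)
    (hq : cost (SweepsTo G R (x (m + 1)) (x 0)) ≤ ∑ i ∈ Finset.range (m + 1), q i)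
    (hpq : ∀ i ≤ m, 2 * (p i + q i) + ra i + rb i ≤ t i + e i)
    (hn : ∀ i ≤ m, n i ≤ 1 ∧ fa i ≤ ra i + n i ∧ fb i ≤ rb i + n i)
    (htot : ∑ i ∈ Finset.range (m + 1), e i + ∑ i ∈ Finset.range m, max (n i) (n (i + 1)) +
      n 0 + n m ≤ 2 * m) :
    Generic G R (x 0) (x (m + 1)) (total m t ω) (fa 0) (fb m) := by
  -- A corner beside strong sides lacks at most one point, even between two of them, because its
  -- weight is at least one.
  have key := sum_budget m (ω := ω) (N := fun i => max (n i) (n (i + 1))) hpq fun i hi => by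
    have h1 := h.one_le i hi
    have h2 := h.two_le i hi
    have h3 := hn i hi.le
    have h4 := hn (i + 1) hi
    omega
  rw [← Finset.mul_sum, Finset.sum_add_distrib] at key
  have c1 := cost_sweeps_le_sweepsTo G R (x 0) (x (m + 1))
  have c2 := cost_sweeps_le_sweepsTo G R (x (m + 1)) (x 0)
  have h3 := hn 0 (Nat.zero_le _)
  have h4 := hn m le_rfl
  unfold Generic total
  omega

end MonoFace

end Mono

/-! ### Faces all of whose sides are even: the cases -/

section MonoCases

variable {V : Type*} [Fintype V] {G : SimpleGraph V} {R : Set V}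

namespace MonoFace

variable {m : ℕ} {x : ℕ → V} {K : ℕ → Set V} {t fa fb ω : ℕ → ℕ}

/-- The hook emits `x 0` without an extra vertex provided that the next side emits `x 1`. The burden
of coloring a corner in advance moves from side `0` to side `1`. -/
theorem cost_back_le_of_hook (h : MonoFace G m x K R t fa fb ω) {y : ℕ → V} {L : ℕ → Set V}
    (hy : Polygon G 1 y L (K 0)) (e0 : y 0 = x 0) (e2 : y 2 = x 1) (hL0 : L 0 = {y 0, y 1})
    (h01 : G.Adj (y 0) (y 1)) : cost (SweepsTo G R (x (m + 1)) (x 0)) ≤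
      ∑ i ∈ Finset.range (m + 1), if i = 0 then cost (StronglySweepsTo G (L 1) (y 2) (y 1))
        else if i = 1 then cost (SweepsTo G (K i) (x (i + 1)) (x i))
        else cost (Sweeps G (K i) (x (i + 1))) := by
  have := cost_le_sum (m := m) (P := fun i => if i = 0 then StronglySweepsTo G (L 1) (y 2) (y 1)
      else if i = 1 then SweepsTo G (K i) (x (i + 1)) (x i) else Sweeps G (K i) (x (i + 1)))
    (Q := SweepsTo G R (x (m + 1)) (x 0))
    (fun i _ => by
      split_ifs
      exacts [attainable_stronglySweepsTo _ _ _, attainable_sweepsTo _ _ _, attainable_sweeps _ _])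
    fun T hT => by
      have hm := h.poly.one_le
      have t0 := hT 0 (by omega)
      have t1 := hT 1 hm
      simp only [if_true, one_ne_zero, if_false] at t0 t1
      have k1 : ∀ i ≤ m, Sweeps G (K (m - i)) (x (m + 1 - i)) T := fun i hi => by
        rw [show m + 1 - i = m - i + 1 by omega]
        have := hT (m - i) (by omega)
        split_ifs at this with h1 h2
        · rw [h1, zero_add, ← e2]
          exact hook_sweeps hy hL0 h01 t0
        · exact this.1
        · exact this
      have k2 : Emits G (x (m + 1 - (m + 1))) T := by
        rw [Nat.sub_self, ← e0]
        exact emits_of_first_edge_side hy hL0 h01 t0 (e2 ▸ t1.2)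
      simpa using h.poly.reverse.sweepsTo_of_emits k1 k2
  simpa only [apply_ite cost] using this

/-- A face whose first side is hooked and whose second side is strong. -/
theorem generic_of_hooked_strong (h : MonoFace G m x K R t fa fb ω) (hm : m ≤ 2)
    (h0 : Hooked G (K 0) (x 0) (x 1) (t 0) (fa 0)) (h1 : Strong G (K 1) (x 1) (x 2) (t 1)) :
    Generic G R (x 0) (x (m + 1)) (total m t ω) (fa 0) (fb m) := by
  have hm1 := h.poly.one_le
  obtain ⟨f0, y, L, hy, e0, e2, hL0, a01, a12, ht⟩ := h0
  have c1 := hook_cost_sweepsTo hy hL0 a01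
  rw [e0, e2] at c1
  have c2 := cost_sweeps_le_sweepsTo G (K 0) (x 0) (x 1)
  have g0 := h.fb_le 0 (by omega)
  have d1 := cost_sweepsTo_le_strongly G (K 1) (x 1) (x 2)
  have d2 := cost_sweepsTo_le_strongly G (K 1) (x 2) (x 1)
  have d3 := cost_sweeps_le_sweepsTo G (K 1) (x 1) (x 2)
  have h1' := h1
  unfold Strong at h1'
  have g1 := h.fa_le 1 hm1
  have g2 := h.fb_le 1 hm1
  have back := h.cost_back_le_of_hook hy e0 e2 hL0 a01
  rw [e2] at ht back
  obtain rfl | rfl : m = 1 ∨ m = 2 := by omega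
  · refine h.generic_of_costs (e := 0) (ra := 0) (rb := fun i => if i = 0 then fb 0 else 0)
      (n := fun i => if i = 0 then 0 else 1) h.poly.cost_sweepsTo_le back
      (fun i hi => ?_) (fun i hi => ?_) (by simp)
    · interval_cases i <;> simp <;> omega
    · interval_cases i <;> simp <;> omega
  · obtain ⟨n, eL, eR, ra, rb, q1, q2, q3, -, -, q4, -, q5, -, q6⟩ :=
      exists_charges (h.side 2 le_rfl) (h.fa_le _ le_rfl) (h.fb_le _ le_rfl)
    refine h.generic_of_costs (e := fun i => if i = 2 then eR else 0)
      (ra := fun i => if i = 2 then ra else 0)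
      (rb := fun i => if i = 0 then fb 0 else if i = 2 then rb else 0)
      (n := fun i => if i = 0 then 0 else if i = 1 then 1 else n) h.poly.cost_sweepsTo_le back
      (fun i hi => ?_) (fun i hi => ?_) ?_
    · interval_cases i <;> simp <;> omega
    · interval_cases i <;> simp <;> omega
    · simp [Finset.sum_range_succ]
      omega

/-- Each hook colors the middle corner cheaply from its own end, and this is what the other hook
needs to emit its end. -/
theorem generic_of_hooked_hooked (h : MonoFace G 1 x K R t fa fb ω)
    (h0 : Hooked G (K 0) (x 0) (x 1) (t 0) (fa 0)) (h1 : Hooked G (K 1) (x 2) (x 1) (t 1) (fb 1)) :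
    Generic G R (x 0) (x 2) (total 1 t ω) (fa 0) (fb 1) := by
  obtain ⟨f0, y, L, hy, e0, e2, hL0, a01, a12, ht⟩ := h0
  obtain ⟨f1, z, M, hz, k0, k2, hM0, b01, b12, ht'⟩ := h1
  have c1 := hook_cost_sweepsTo hy hL0 a01
  have c1' := hook_cost_sweepsTo hz hM0 b01
  rw [e0, e2] at c1
  rw [k0, k2] at c1'
  have b1 := h.cost_back_le_of_hook hy e0 e2 hL0 a01
  have b2 := h.reverse.cost_back_le_of_hook hz k0 k2 hM0 b01
  simp only [Finset.sum_range_succ, Finset.sum_range_zero, if_true, one_ne_zero, if_false,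
    zero_add, Nat.sub_self, Nat.sub_zero, Nat.reduceAdd, Nat.reduceSub] at b1 b2
  have g0 := h.fb_le 0 (by omega)
  have g1 := h.fa_le 1 (by omega)
  rw [e2] at ht b1
  rw [k2] at ht' b2
  have o := h.two_le 0 (by omega)
  have c2 := cost_sweeps_le_sweepsTo G R (x 0) (x 2)
  have c3 := cost_sweeps_le_sweepsTo G R (x 2) (x 0)
  simp only [Generic, total, Finset.sum_range_succ, Finset.sum_range_zero, Nat.reduceAdd] at *
  omega

/-- Two consecutive strong sides of a face with at least three sides. -/
theorem generic_of_consecutive (h : MonoFace G m x K R t fa fb ω) (hm : 2 ≤ m) {j : ℕ} (hj : j < m)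
    (h0 : Strong G (K j) (x j) (x (j + 1)) (t j))
    (h1 : Strong G (K (j + 1)) (x (j + 1)) (x (j + 2)) (t (j + 1))) :
    Generic G R (x 0) (x (m + 1)) (total m t ω) (fa 0) (fb m) := by
  have hc := fun i (hi : i ≤ m) => exists_charges (h.side i hi) (h.fa_le i hi) (h.fb_le i hi)
  choose! n eL eR ra rb q1 q2 q3 q4 q5 q6 q7 q8 q9 q10 using hc
  refine h.generic_of_costs (e := 0) (ra := fun i => if i = j ∨ i = j + 1 then 0 else ra i)
    (rb := fun i => if i = j ∨ i = j + 1 then 0 else rb i)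
    (n := fun i => if i = j ∨ i = j + 1 then 1 else n i)
    (h.poly.cost_sweepsTo_le_of_consecutive hj) (h.cost_back_le_of_consecutive hj)
    (fun i hi => ?_) (fun i hi => ?_) ?_
  · have h3 := q7 i hi
    by_cases e : i = j ∨ i = j + 1
    · simp only [if_pos e, Pi.zero_apply, add_zero]
      rcases e with rfl | rfl
      exacts [h0, h1]
    · simp only [if_neg e, Pi.zero_apply, add_zero]
      exact h3
  · have a1 := h.fa_le i hi
    have a2 := h.fb_le i hi
    by_cases e : i = j ∨ i = j + 1
    · simp only [if_pos e]; omega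
    · simp only [if_neg e]; exact ⟨q1 i hi, q2 i hi, q3 i hi⟩
  · have hn : ∀ i ≤ m, (if i = j ∨ i = j + 1 then 1 else n i) ≤ 1 := fun i hi => by
      have := q1 i hi
      split_ifs <;> omega
    -- With two consecutive strong sides the far corner is emitted for free, so at most `m + 2`
    -- points are due; `2 ≤ m` makes this affordable.
    have := Finset.sum_le_card_nsmul (Finset.range m) (fun i =>
      max (if i = j ∨ i = j + 1 then 1 else n i) (if i + 1 = j ∨ i + 1 = j + 1 then 1 else n (i + 1)))
      1 fun i hi => by
        have hi := Finset.mem_range.1 hi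
        exact max_le (hn i hi.le) (hn (i + 1) hi)
    have a1 := hn 0 (by omega)
    have a2 := hn m le_rfl
    simp only [Finset.card_range, smul_eq_mul, mul_one] at this
    simp only [Pi.zero_apply, Finset.sum_const_zero, zero_add]
    omega

/-- Three sides: edge, strong region, edge. -/
theorem generic_of_edge_strong_edge (h : MonoFace G 2 x K R t fa fb ω)
    (h0 : EdgeRegion G (K 0) (x 0) (x 1) (t 0) (fa 0) (fb 0))
    (h1 : Strong G (K 1) (x 1) (x 2) (t 1))
    (h2 : EdgeRegion G (K 2) (x 2) (x 3) (t 2) (fa 2) (fb 2)) :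
    Generic G R (x 0) (x 3) (total 2 t ω) (fa 0) (fb 2) := by
  have w1 : cost (Sweeps G R (x 0)) ≤ cost (StronglySweepsTo G (K 1) (x 2) (x 1)) :=
    (attainable_stronglySweepsTo _ _ _).cost_le_cost fun S hS =>
      h.poly.sweeps_edge_side_edge h0.1 h2.1 hS (h.adj 1 (by omega))
  have w2 : cost (Sweeps G R (x 3)) ≤ cost (StronglySweepsTo G (K 1) (x 1) (x 2)) :=
    (attainable_stronglySweepsTo _ _ _).cost_le_cost fun S hS =>
      h.poly.reverse.sweeps_edge_side_edge (h2.1.trans (Set.pair_comm _ _))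
        (h0.1.trans (Set.pair_comm _ _)) hS (h.adj 1 (by omega)).symm
  have c1 := cost_sweepsTo_le_sweeps_add_one G R (x 0) (x 3)
  have c2 := cost_sweepsTo_le_sweeps_add_one G R (x 3) (x 0)
  have o1 := h.one_le 0 (by omega)
  have o2 := h.one_le 1 (by omega)
  have f0 := h0.2.2.2.1
  have f2 := h2.2.2.2.2
  simp only [Generic, Strong, total, Finset.sum_range_succ, Finset.sum_range_zero,
    Nat.reduceAdd] at *
  omega

/-- Two sides: a hooked region and an edge. -/
theorem generic_of_hooked_edge (h : MonoFace G 1 x K R t fa fb ω)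
    (h0 : Hooked G (K 0) (x 0) (x 1) (t 0) (fa 0))
    (h1 : EdgeRegion G (K 1) (x 1) (x 2) (t 1) (fa 1) (fb 1)) :
    Generic G R (x 0) (x 2) (total 1 t ω) (fa 0) (fb 1) := by
  obtain ⟨f0, y, L, hy, e0, e2, hL0, a01, a12, ht⟩ := h0
  have w1 : cost (Sweeps G R (x 0)) ≤ cost (StronglySweepsTo G (L 1) (y 2) (y 1)) :=
    (attainable_stronglySweepsTo _ _ _).cost_le_cost fun S hS =>
      sweeps_zigzag_left h.poly hy e0 e2 h1.1 hL0 hS a12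
  have w2 : cost (Sweeps G R (x 2)) ≤ cost (StronglySweepsTo G (L 1) (y 1) (y 2)) :=
    (attainable_stronglySweepsTo _ _ _).cost_le_cost fun S hS =>
      sweeps_zigzag_right h.poly hy e0 e2 h1.1 hL0 hS a12
  have c1 := cost_sweepsTo_le_sweeps_add_one G R (x 0) (x 2)
  have c2 := cost_sweepsTo_le_sweeps_add_one G R (x 2) (x 0)
  have o1 := h.one_le 0 (by omega)
  have f2 := h1.2.2.2.2
  simp only [Generic, total, Finset.sum_range_succ, Finset.sum_range_zero, Nat.reduceAdd] at *
  omega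

/-- The spare point of the new hook is the guaranteed weight of the single corner. -/
theorem hooked_of_edge_strong (h : MonoFace G 1 x K R t fa fb ω)
    (h0 : EdgeRegion G (K 0) (x 0) (x 1) (t 0) (fa 0) (fb 0))
    (h1 : Strong G (K 1) (x 1) (x 2) (t 1)) :
    Hooked G R (x 0) (x 2) (total 1 t ω) (fa 0) := by
  refine ⟨h0.2.2.2.1, x, K, h.poly, rfl, rfl, h0.1, h.adj 0 (by omega), h.adj 1 (by omega), ?_⟩
  have o1 := h.one_le 0 (by omega)
  simp only [Strong, total, Finset.sum_range_succ, Finset.sum_range_zero, Nat.reduceAdd] at *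
  omega

theorem strong_of_strong_strong (h : MonoFace G 1 x K R t fa fb ω)
    (h0 : Strong G (K 0) (x 0) (x 1) (t 0)) (h1 : Strong G (K 1) (x 1) (x 2) (t 1)) :
    Strong G R (x 0) (x 2) (total 1 t ω) := by
  have key : ∀ {x : ℕ → V} {K : ℕ → Set V}, Polygon G 1 x K R →
      cost (StronglySweepsTo G R (x 0) (x 2)) ≤ cost (StronglySweepsTo G (K 0) (x 0) (x 1)) +
        cost (StronglySweepsTo G (K 1) (x 1) (x 2)) := by
    intro x K h
    have := cost_le_sum (m := 1) (P := fun i => StronglySweepsTo G (K i) (x i) (x (i + 1)))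
      (Q := StronglySweepsTo G R (x 0) (x 2)) (fun _ _ => attainable_stronglySweepsTo _ _ _)
      fun T hT => h.stronglySweepsTo_of_two (hT 0 (by omega)).sweepsTo (hT 1 le_rfl)
    simpa [Finset.sum_range_succ] using this
  have k1 := key h.poly
  have k2 := key h.poly.reverse
  simp only [Nat.sub_self, Nat.sub_zero, Nat.reduceAdd, Nat.reduceSub] at k2
  simp only [Strong, total, Finset.sum_range_succ, Finset.sum_range_zero, Nat.reduceAdd] at *
  omega

/-- For large faces the corners pay for everything, and the region is generic. A shortage leaves
only short patterns at the ends, each with its own forcing argument. -/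
theorem evenRegion (h : MonoFace G m x K R t fa fb ω)
    (hne : ¬ ∀ i ≤ m, EdgeRegion G (K i) (x i) (x (i + 1)) (t i) (fa i) (fb i)) :
    EvenRegion G R (x 0) (x (m + 1)) (total m t ω) (fa 0) (fb m) := by
  have hm := h.poly.one_le
  have hc := fun i (hi : i ≤ m) => exists_charges (h.side i hi) (h.fa_le i hi) (h.fb_le i hi)
  choose! n eL eR ra rb q1 q2 q3 q4 q5 q6 q7 q8 q9 q10 using hc
  by_cases hNN : 2 ≤ m ∧ ∃ j < m, n j = 1 ∧ n (j + 1) = 1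
  · obtain ⟨hm2, j, hj, n0, n1⟩ := hNN
    exact .inr (.inl (h.generic_of_consecutive hm2 hj (q4 j hj.le n0) (q4 (j + 1) hj n1)))
  -- Only one end side per direction has to emit, so only `eL 0` and `eR m` count among the
  -- excesses.
  by_cases htot : eL 0 + eR m + ∑ i ∈ Finset.range m, max (n i) (n (i + 1)) + n 0 + n m ≤ 2 * m
  · refine .inr (.inl (h.generic_of_costs (n := n) (ra := ra) (rb := rb)
      (e := fun i => (if i = 0 then eL 0 else 0) + if i = m then eR m else 0)
      h.poly.cost_sweepsTo_le h.cost_back_le (fun i hi => ?_)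
      (fun i hi => ⟨q1 i hi, q2 i hi, q3 i hi⟩) ?_))
    · have h7 := q7 i hi
      have h8 := q8 i hi
      have h9 := q9 i hi
      split_ifs with e1 e2 e2 <;> subst_vars <;> omega
    · rw [Finset.sum_add_distrib, Finset.sum_ite_eq' , Finset.sum_ite_eq',
        if_pos (by simp), if_pos (by simp)]
      exact htot
  have hsum := Finset.sum_le_card_nsmul (Finset.range m) (fun i => max (n i) (n (i + 1)))
      1 fun i hi => by
        have hi := Finset.mem_range.1 hi
        exact max_le (q1 i hi.le) (q1 (i + 1) hi)
  simp only [Finset.card_range, smul_eq_mul, mul_one] at hsum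
  have l0 := q5 0 (by omega)
  have rm := q6 m le_rfl
  have n0 := q1 0 (by omega)
  have nm := q1 m le_rfl
  have hNN' : 2 ≤ m → ∀ j < m, ¬ (n j = 1 ∧ n (j + 1) = 1) := fun h2 j hj hn =>
    hNN ⟨h2, j, hj, hn⟩
  -- Each end accounts for at most two points and the corners for at most `m`, while the sum exceeds
  -- `2 * m`.
  have hm3 : m ≤ 3 := by
    by_contra
    omega
  obtain rfl | rfl | rfl : m = 1 ∨ m = 2 ∨ m = 3 := by omega
  · simp only [Finset.sum_range_succ, Finset.sum_range_zero, zero_add] at htot hsum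
    by_cases c1 : n 0 = 1
    · by_cases c2 : n 1 = 1
      · exact .inl (h.strong_of_strong_strong (q4 0 (by omega) c1) (q4 1 le_rfl c2))
      · obtain ⟨-, -, hr⟩ : eR 1 = 2 ∧ n 1 = 0 ∧ _ := rm.resolve_left (by omega)
        have hs := (q4 0 (by omega) c1).symm
        rcases hr with hr | hr
        · have := h.reverse.hooked_of_edge_strong hr.symm hs
          rw [total_reverse] at this
          exact .inr (.inr (.inr this))
        · have := h.reverse.generic_of_hooked_strong (by omega) hr hs
          rw [total_reverse] at this
          exact .inr (.inl this.symm)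
    · obtain ⟨-, -, hl⟩ : eL 0 = 2 ∧ n 0 = 0 ∧ _ := l0.resolve_left (by omega)
      by_cases c2 : n 1 = 1
      · have hs := q4 1 le_rfl c2
        rcases hl with hl | hl
        · exact .inr (.inr (.inl (h.hooked_of_edge_strong hl hs)))
        · exact .inr (.inl (h.generic_of_hooked_strong (by omega) hl hs))
      · obtain ⟨-, -, hr⟩ : eR 1 = 2 ∧ n 1 = 0 ∧ _ := rm.resolve_left (by omega)
        rcases hl with hl | hl <;> rcases hr with hr | hr
        -- A triangle whose two lower sides are outer edges is an ear, excluded by `hne`.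
        · exact absurd (fun i hi => by interval_cases i <;> assumption) hne
        · have := h.reverse.generic_of_hooked_edge hr hl.symm
          rw [total_reverse] at this
          exact .inr (.inl this.symm)
        · exact .inr (.inl (h.generic_of_hooked_edge hl hr))
        · exact .inr (.inl (h.generic_of_hooked_hooked hl hr))
  · have n1 := q1 1 (by omega)
    have a0 := hNN' le_rfl 0 (by omega)
    have a1 := hNN' le_rfl 1 (by omega)
    simp only [Finset.sum_range_succ, Finset.sum_range_zero, zero_add, Nat.reduceAdd] at *
    -- With three sides a shortage occurs only for a strong middle side between two sides that are
    -- edges or hooked at their outer ends.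
    obtain ⟨-, -, hl⟩ : eL 0 = 2 ∧ n 0 = 0 ∧ _ := l0.resolve_left (by omega)
    obtain ⟨-, -, hr⟩ : eR 2 = 2 ∧ n 2 = 0 ∧ _ := rm.resolve_left (by omega)
    have hs := q4 1 (by omega) (by omega)
    rcases hl with hl | hl
    · rcases hr with hr | hr
      · exact .inr (.inl (h.generic_of_edge_strong_edge hl hs hr))
      · have := h.reverse.generic_of_hooked_strong le_rfl hr hs.symm
        rw [total_reverse] at this
        exact .inr (.inl this.symm)
    · exact .inr (.inl (h.generic_of_hooked_strong le_rfl hl hs))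
  -- With four sides a shortage would need two expensive ends and both middle sides strong, but
  -- consecutive strong sides were treated above.
  · exfalso
    have n1 := q1 1 (by omega)
    have n2 := q1 2 (by omega)
    have a0 := hNN' (by omega) 0 (by omega)
    have a1 := hNN' (by omega) 1 (by omega)
    have a2 := hNN' (by omega) 2 (by omega)
    simp only [Finset.sum_range_succ, Finset.sum_range_zero, zero_add, Nat.reduceAdd] at *
    omega

end MonoFace

end MonoCases

/-! ### Directions turning at the odd sides of a face -/

section Mixed

variable {V : Type*} [Fintype V] {G : SimpleGraph V} {R : Set V} {a b : V}

theorem Generic.cost_sweeps_le {K : Set V} {t fa fb : ℕ} (h : Generic G K a b t fa fb) :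
    2 * (cost (Sweeps G K a) + cost (Sweeps G K b)) ≤ t := by
  have := h.1
  omega

theorem EvenRegion.cost_sweeps_le {K : Set V} {t fa fb : ℕ} (h : EvenRegion G K a b t fa fb) :
    2 * (cost (Sweeps G K a) + cost (Sweeps G K b)) ≤ t := by
  rcases h with h | h | h | h
  · have c1 := cost_sweeps_le_strongly G K a b
    have c2 := cost_sweeps_le_strongly G K b a
    unfold Strong at h
    omega
  · exact h.cost_sweeps_le
  · have := h.costs
    have c1 := cost_sweeps_le_sweepsTo G K a b
    omega
  · have := h.costs
    have c1 := cost_sweeps_le_sweepsTo G K b a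
    omega

theorem EdgeRegion.cost_sweeps_le {K : Set V} {t fa fb : ℕ} (h : EdgeRegion G K a b t fa fb) :
    2 * (cost (Sweeps G K a) + cost (Sweeps G K b)) ≤ t := by
  have := h.costs
  omega

/-- The forcing behaviour of a side that agrees with given directions at its ends. -/
def Directed (G : SimpleGraph V) (K : Set V) (a b : V) : Bool → Bool → Finset V → Prop
  | true, true => Sweeps G K a
  | false, false => Sweeps G K b
  | false, true => Fills G K
  | true, false => Absorbs G K a b

theorem attainable_directed (K : Set V) (p q : Bool) : Attainable (Directed G K a b p q) := by
  cases p <;> cases q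
  exacts [attainable_sweeps _ _, attainable_fills _, attainable_absorbs _ _ _,
    attainable_sweeps _ _]

variable {m : ℕ} {x : ℕ → V} {K : ℕ → Set V}

theorem Polygon.labelled_of_directed {l : ℕ → Bool} {S : Finset V}
    (h : ∀ i ≤ m, Directed G (K i) (x i) (x (i + 1)) (l i) (l (i + 1)) S) :
    Labelled G m x K l S := by
  intro i hi
  have := h i hi
  refine ⟨fun h1 h2 => ?_, fun h1 h2 => ?_, fun h1 h2 => ?_, fun h1 h2 => ?_⟩ <;>
    rw [h1, h2] at this <;> exact this

/-- The invariant of a side in a face with an odd side. -/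
def ParityRegion (G : SimpleGraph V) (K : Set V) (a b : V) (l t : ℕ) : Prop :=
  (Odd l ∧ 2 * (cost (Fills G K) + cost (Absorbs G K a b)) ≤ t) ∨
    (Even l ∧ 2 * (cost (Sweeps G K a) + cost (Sweeps G K b)) ≤ t)

/-- Negating both labels exchanges filling with absorbing, and sweeping forwards with sweeping
backwards. Either pair is what the invariant bounds. -/
theorem ParityRegion.cost_directed_le {K : Set V} {l t : ℕ} (h : ParityRegion G K a b l t)
    {p q : Bool} (hpq : p = q ↔ Even l) :
    2 * (cost (Directed G K a b p q) + cost (Directed G K a b (!p) (!q))) ≤ t := by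
  rcases h with ⟨h1, h2⟩ | ⟨h1, h2⟩
  · have : p ≠ q := fun e => Nat.not_even_iff_odd.2 h1 (hpq.1 e)
    cases p <;> cases q <;> simp_all [Directed]
    omega
  · obtain rfl := hpq.2 h1
    cases p <;> simp_all [Directed]
    omega

namespace Polygon

variable {ℓ t : ℕ → ℕ}

/-- Directions at the corners, turning exactly at the odd sides. -/
def direction (ℓ : ℕ → ℕ) (i : ℕ) : Bool := decide (Even (∑ j ∈ Finset.range i, ℓ j))

theorem direction_zero : direction ℓ 0 = true := by simp [direction]

theorem direction_succ (i : ℕ) : direction ℓ i = direction ℓ (i + 1) ↔ Even (ℓ i) := by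
  simp only [direction, Finset.sum_range_succ, decide_eq_decide, Nat.even_add]
  tauto

/-- One set per orientation of the flow; on every side the two do complementary tasks, so their
sizes add up side by side. -/
theorem exists_directed (hs : ∀ i ≤ m, ParityRegion G (K i) (x i) (x (i + 1)) (ℓ i) (t i)) :
    ∃ S T : Finset V, Labelled G m x K (direction ℓ) S ∧
      Labelled G m x K (fun i => !direction ℓ i) T ∧
      2 * (S.card + T.card) ≤ ∑ i ∈ Finset.range (m + 1), t i := by
  obtain ⟨S, hS, cS⟩ := exists_attains_all (m := m)
    (P := fun i => Directed G (K i) (x i) (x (i + 1)) (direction ℓ i) (direction ℓ (i + 1)))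
    fun i _ => attainable_directed _ _ _
  obtain ⟨T, hT, cT⟩ := exists_attains_all (m := m)
    (P := fun i => Directed G (K i) (x i) (x (i + 1)) (!direction ℓ i) (!direction ℓ (i + 1)))
    fun i _ => attainable_directed _ _ _
  refine ⟨S, T, labelled_of_directed hS, labelled_of_directed hT, ?_⟩
  calc _ ≤ _ := Nat.mul_le_mul_left 2 (Nat.add_le_add cS cT)
    _ = _ := by rw [← Finset.sum_add_distrib, Finset.mul_sum]
    _ ≤ _ := Finset.sum_le_sum fun i hi => (hs i (by simpa [Nat.lt_succ_iff] using hi)).cost_directed_le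
        (direction_succ i)

/-- An odd number of turns gives the two ends opposite labels: inward flow at both ends absorbs, and
the opposite flow fills. -/
theorem odd_of_parity (h : Polygon G m x K R)
    (hs : ∀ i ≤ m, ParityRegion G (K i) (x i) (x (i + 1)) (ℓ i) (t i))
    (ho : Odd (∑ i ∈ Finset.range (m + 1), ℓ i)) :
    2 * (cost (Fills G R) + cost (Absorbs G R (x 0) (x (m + 1)))) ≤
      ∑ i ∈ Finset.range (m + 1), t i := by
  obtain ⟨S, T, hS, hT, hc⟩ := exists_directed hs
  have e : direction ℓ (m + 1) = false := by simpa [direction] using ho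
  have c1 := cost_le (h.fills_of_labelled hT (by simp [direction_zero]) (by simp [e]))
  have c2 := cost_le (h.absorbs_of_labelled hS)
  omega

/-- With an even total, the flow enters at one end and leaves at the other. The turn at an odd side
starts a flow inside the face, so the outgoing end is reached unaided in both orientations. -/
theorem strong_of_parity (h : Polygon G m x K R)
    (hs : ∀ i ≤ m, ParityRegion G (K i) (x i) (x (i + 1)) (ℓ i) (t i))
    (he : Even (∑ i ∈ Finset.range (m + 1), ℓ i)) {j : ℕ} (hj : j ≤ m) (hjo : Odd (ℓ j)) :
    Strong G R (x 0) (x (m + 1)) (∑ i ∈ Finset.range (m + 1), t i) := by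
  obtain ⟨S, T, hS, hT, hc⟩ := exists_directed hs
  have e : direction ℓ (m + 1) = true := by simpa [direction] using he
  have hne : direction ℓ j ≠ direction ℓ (j + 1) := fun h' =>
    Nat.not_even_iff_odd.2 hjo ((direction_succ j).1 h')
  -- Both extreme corners are labelled `true`, so the `false` end of the odd side is an inner
  -- corner; this serves the face and its reverse alike.
  obtain ⟨i, hi0, him, hi⟩ : ∃ i, 1 ≤ i ∧ i ≤ m ∧ direction ℓ i = false := by
    cases h0 : direction ℓ j with
    | false => exact ⟨j, Nat.one_le_iff_ne_zero.2 (by rintro rfl; simp [direction_zero] at h0), hj, h0⟩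
    | true =>
      have h1 : direction ℓ (j + 1) = false := by simpa [h0] using hne.symm
      exact ⟨j + 1, by omega, Nat.succ_le_of_lt (lt_of_le_of_ne hj (by rintro rfl; simp [e] at h1)), h1⟩
  have c1 := cost_le (h.stronglySweepsTo_of_labelled hS e him hi)
  have c2 := cost_le (h.reverse.stronglySweepsTo_of_labelled hT.reverse
    (by simp [direction_zero]) (j := m + 1 - i) (by omega)
    (by simp [show m + 1 - (m + 1 - i) = i by omega, hi]))
  simp only [Nat.sub_zero, Nat.sub_self] at c2
  unfold Strong
  omega

/-- A face with only one side that is not an edge. -/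
theorem cost_absorbs_le_of_unique (h : Polygon G m x K R) {j : ℕ} (hj : j ≤ m)
    (hs : ∀ i ≤ m, i ≠ j → K i = {x i, x (i + 1)} ∧ G.Adj (x i) (x (i + 1))) :
    cost (Absorbs G R (x 0) (x (m + 1))) ≤ cost (Absorbs G (K j) (x j) (x (j + 1))) := by
  refine (attainable_absorbs _ _ _).cost_le_cost fun S hS => ?_
  refine h.absorbs_of_labelled (l := fun i => decide (i ≤ j)) (labelled_of_directed fun i hi => ?_)
  rcases lt_trichotomy i j with h1 | rfl | h1
  · obtain ⟨e1, e2⟩ := hs i hi h1.ne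
    simp only [h1.le, Nat.succ_le_of_lt h1, decide_true, Directed]
    exact e1 ▸ sweeps_pair e2
  · simp only [le_refl, decide_true, Nat.not_succ_le_self, decide_false, Directed]
    exact hS
  · obtain ⟨e1, e2⟩ := hs i hi h1.ne'
    simp only [h1.not_ge, show ¬ i + 1 ≤ j by omega, decide_false, Directed]
    rw [e1, Set.pair_comm]
    exact sweeps_pair e2.symm

/-- Two consecutive vertices start a flow along a path of edges that closes up unaided; with both
ends served, the path is swept for free. -/
theorem leaf_costs (h : Polygon G m x K R)
    (hs : ∀ i ≤ m, K i = {x i, x (i + 1)} ∧ G.Adj (x i) (x (i + 1))) :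
    cost (Fills G R) ≤ 2 ∧ cost (Absorbs G R (x 0) (x (m + 1))) = 0 := by
  classical
  constructor
  · refine (cost_le (S := {x 0, x 1}) ?_).trans Finset.card_le_two
    refine h.fills_of_labelled (l := fun i => decide (1 ≤ i)) (labelled_of_directed fun i hi => ?_)
      (by simp) (by simp)
    obtain ⟨e1, e2⟩ := hs i hi
    rcases i with _ | i
    · simp only [zero_add, le_refl, decide_true, Directed]
      intro C _ hS
      rw [e1]
      simpa using hS
    · simp only [Nat.le_add_left, decide_true, Directed]
      exact e1 ▸ sweeps_pair e2
  · refine Nat.le_zero.1 (cost_le (S := ∅) (h.absorbs_of_labelled (labelled_true fun i hi => ?_)))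
    obtain ⟨e1, e2⟩ := hs i hi
    exact e1 ▸ sweeps_pair e2

end Polygon

end Mixed

/-! ### Outerplanar graphs drawn in a disk, the vertices numbered along the outer cycle -/

/-- A graph on the vertices `0, …, n - 1` of a cycle with edges of the cycle and noncrossing
chords. -/
structure Disk (H : SimpleGraph ℕ) (n : ℕ) : Prop where
  three_le : 3 ≤ n
  lt : ∀ i j, H.Adj i j → i < n
  step : ∀ i, i + 1 < n → H.Adj i (i + 1)
  root : H.Adj 0 (n - 1)
  noncrossing : ∀ i p j q, i < p → p < j → j < q → H.Adj i j → H.Adj p q → False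

/-- The edge `u v` has a bounded face on the side of the vertices between `u` and `v`. -/
def Inner (H : SimpleGraph ℕ) (u v : ℕ) : Prop := H.Adj u v ∧ u + 2 ≤ v

/-- The vertex `w` lies on the face with the inner edge `u v`, that is, no other edge between `u`
and `v` passes over it. -/
def OnFace (H : SimpleGraph ℕ) (u v w : ℕ) : Prop :=
  u ≤ w ∧ w ≤ v ∧ ∀ p q, H.Adj p q → u ≤ p → p < w → w < q → q ≤ v → p = u ∧ q = v

/-- The path `x 0, …, x (m + 1)` from `u` to `v` around the face with the inner edge `u v`. -/
structure FacePath (H : SimpleGraph ℕ) (u v m : ℕ) (x : ℕ → ℕ) : Prop where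
  one_le : 1 ≤ m
  first : x 0 = u
  last : x (m + 1) = v
  lt_succ : ∀ i ≤ m, x i < x (i + 1)
  adj : ∀ i ≤ m, H.Adj (x i) (x (i + 1))
  cover : ∀ p q, H.Adj p q → u ≤ p → p < q → q ≤ v → (p ≠ u ∨ q ≠ v) →
    ∃ i ≤ m, x i ≤ p ∧ q ≤ x (i + 1)

namespace Disk

variable {H : SimpleGraph ℕ} {n : ℕ}

/-- The path is built greedily from `w` on, by induction on the distance to `v`. -/
theorem exists_path (D : Disk H n) {u v : ℕ} (huv : Inner H u v) :
    ∀ k w, v - w = k → w < v → OnFace H u v w → ∃ m, ∃ x : ℕ → ℕ, x 0 = w ∧ x (m + 1) = v ∧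
      (w = u → 1 ≤ m) ∧ (∀ i ≤ m, x i < x (i + 1)) ∧ (∀ i ≤ m, H.Adj (x i) (x (i + 1))) ∧
      ∀ p q, H.Adj p q → w ≤ p → p < q → q ≤ v → (p ≠ u ∨ q ≠ v) →
        ∃ i ≤ m, x i ≤ p ∧ q ≤ x (i + 1) := by
  classical
  intro k
  induction k using Nat.strong_induction_on with
  | _ k ih =>
  intro w hk hwv hw
  have hvn : v < n := D.lt _ _ huv.1.symm
  -- The next corner is the farthest neighbor of `w` up to `v`, the top edge itself not being
  -- allowed. An edge passing over it would pass over `w`, contradict maximality, or cross this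
  -- step.
  let A := (Finset.Ioc w v).filter fun q => H.Adj w q ∧ (w ≠ u ∨ q ≠ v)
  have hA : A.Nonempty := ⟨w + 1, by
    have := huv.2
    simp only [A, Finset.mem_filter, Finset.mem_Ioc]
    exact ⟨by omega, D.step w (by omega), by omega⟩⟩
  obtain ⟨q, hq, hmax⟩ := A.exists_max_image id hA
  simp only [A, Finset.mem_filter, Finset.mem_Ioc, id] at hq hmax
  obtain ⟨⟨hwq, hqv⟩, hadj, hne⟩ := hq
  have hqf : OnFace H u v q := by
    refine ⟨hw.1.trans hwq.le, hqv, fun p r hpr hup hpq hqr hrv => ?_⟩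
    rcases lt_trichotomy p w with h | rfl | h
    · exact hw.2.2 p r hpr hup h (hwq.trans hqr) hrv
    · by_contra hc
      have := hmax r ⟨⟨by omega, hrv⟩, hpr, by omega⟩
      omega
    · exact (D.noncrossing w p q r h hpq hqr hadj hpr).elim
  rcases hqv.eq_or_lt with rfl | hqv
  · refine ⟨0, fun i => if i = 0 then w else q, rfl, rfl, by omega, ?_, ?_, ?_⟩
    · intro i hi
      obtain rfl : i = 0 := by omega
      simpa using hwq
    · intro i hi
      obtain rfl : i = 0 := by omega
      simpa using hadj
    · intro p r _ hp _ hr _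
      exact ⟨0, le_rfl, by simpa using hp, by simpa using hr⟩
  · obtain ⟨m, x, x0, xm, -, h1, h2, h3⟩ := ih (v - q) (by omega) q rfl hqv hqf
    refine ⟨m + 1, fun i => if i = 0 then w else x (i - 1), rfl, by simpa using xm, by omega,
      ?_, ?_, ?_⟩
    · intro i hi
      rcases i with _ | i
      · simpa [x0] using hwq
      · simpa using h1 i (by omega)
    · intro i hi
      rcases i with _ | i
      · simpa [x0] using hadj
      · simpa using h2 i (by omega)
    · intro p r hpr hp hlt hr hne'
      rcases Nat.lt_or_ge p q with hpq | hpq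
      · refine ⟨0, by omega, by simpa using hp, ?_⟩
        by_contra hc
        simp only [zero_add, one_ne_zero, if_false, Nat.sub_self, x0, not_le] at hc
        have := hqf.2.2 p r hpr (hw.1.trans hp) hpq hc hr
        omega
      · obtain ⟨i, hi, a1, a2⟩ := h3 p r hpr hpq hlt hr hne'
        exact ⟨i + 1, by omega, by simpa using a1, by simpa using a2⟩

theorem exists_facePath (D : Disk H n) {u v : ℕ} (huv : Inner H u v) :
    ∃ m x, FacePath H u v m x := by
  have := huv.2
  obtain ⟨m, x, h0, h1, h2, h3, h4, h5⟩ := D.exists_path huv (v - u) u rfl (by omega)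
    ⟨le_rfl, by omega, fun p q _ h1 h2 _ _ => by omega⟩
  exact ⟨m, x, h2 rfl, h0, h1, h3, h4, h5⟩

end Disk

namespace FacePath

variable {H : SimpleGraph ℕ} {n u v m : ℕ} {x : ℕ → ℕ}

theorem lt_of_lt (h : FacePath H u v m x) {i j : ℕ} (hij : i < j) (hj : j ≤ m + 1) :
    x i < x j := by
  induction j, hij using Nat.le_induction with
  | base => exact h.lt_succ i (by omega)
  | succ j hij ih => exact (ih (by omega)).trans (h.lt_succ j (by omega))

theorem le_of_le (h : FacePath H u v m x) {i j : ℕ} (hij : i ≤ j) (hj : j ≤ m + 1) :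
    x i ≤ x j := by
  rcases hij.eq_or_lt with rfl | hij
  exacts [le_rfl, (h.lt_of_lt hij hj).le]

theorem le_iff (h : FacePath H u v m x) {i j : ℕ} (hi : i ≤ m + 1) (hj : j ≤ m + 1) :
    x i ≤ x j ↔ i ≤ j := by
  refine ⟨fun hx => ?_, fun hij => h.le_of_le hij hj⟩
  by_contra hc
  have := h.lt_of_lt (not_le.1 hc) hi
  omega

theorem lt_iff (h : FacePath H u v m x) {i j : ℕ} (hi : i ≤ m + 1) (hj : j ≤ m + 1) :
    x i < x j ↔ i < j := by
  have := h.le_iff hj hi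
  omega

theorem mem_Icc (h : FacePath H u v m x) {i : ℕ} (hi : i ≤ m + 1) : u ≤ x i ∧ x i ≤ v := by
  rw [← h.first, ← h.last]
  exact ⟨h.le_of_le (Nat.zero_le _) hi, h.le_of_le hi le_rfl⟩

theorem side_ne (h : FacePath H u v m x) {i : ℕ} (hi : i ≤ m) : x i ≠ u ∨ x (i + 1) ≠ v := by
  have := h.one_le
  rcases i with _ | i
  · right
    have := h.lt_of_lt (i := 0 + 1) (j := m + 1) (by omega) le_rfl
    rw [h.last] at this
    exact this.ne
  · left
    have := h.lt_of_lt (i := 0) (j := i + 1) (by omega) (by omega)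
    rw [h.first] at this
    exact this.ne'

theorem side_lt (h : FacePath H u v m x) {i : ℕ} (hi : i ≤ m) : x (i + 1) - x i < v - u := by
  have h1 := h.mem_Icc (i := i) (by omega)
  have h2 := h.mem_Icc (i := i + 1) (by omega)
  have h3 := h.side_ne hi
  have := h.lt_succ i hi
  omega

theorem exists_side (h : FacePath H u v m x) {w : ℕ} (hu : u ≤ w) (hv : w < v) :
    ∃ i ≤ m, x i ≤ w ∧ w < x (i + 1) := by
  rw [← h.first] at hu
  rw [← h.last] at hv
  have ex : ∃ k, w < x k := ⟨m + 1, hv⟩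
  have h1 := Nat.find_spec ex
  have h2 : Nat.find ex ≤ m + 1 := Nat.find_le hv
  have h3 := fun j => Nat.find_min (m := j) ex
  generalize Nat.find ex = i at h1 h2 h3
  rcases i with _ | i
  · omega
  · exact ⟨i, by omega, by simpa using h3 i (by omega), h1⟩

/-- The corners of the path are the vertices of the face. -/
theorem onFace_iff (h : FacePath H u v m x) {w : ℕ} :
    OnFace H u v w ↔ ∃ i ≤ m + 1, x i = w := by
  constructor
  · rintro ⟨h1, h2, h3⟩
    rcases h2.eq_or_lt with rfl | h2
    · exact ⟨m + 1, le_rfl, h.last⟩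
    · obtain ⟨i, hi, a, b⟩ := h.exists_side h1 h2
      refine ⟨i, by omega, a.eq_or_lt.resolve_right fun a => ?_⟩
      have := h3 _ _ (h.adj i hi) (h.mem_Icc (by omega)).1 a b (h.mem_Icc (by omega)).2
      have := h.side_ne hi
      omega
  · rintro ⟨i, hi, rfl⟩
    refine ⟨(h.mem_Icc hi).1, (h.mem_Icc hi).2, fun p q hpq hp h1 h2 hq => ?_⟩
    by_contra hc
    obtain ⟨j, hj, a, b⟩ := h.cover p q hpq hp (by omega) hq (by omega)
    have c1 := (h.lt_iff (i := j) (j := i) (by omega) hi).1 (by omega)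
    have c2 := (h.lt_iff (i := i) (j := j + 1) hi (by omega)).1 (by omega)
    omega

/-- An edge at an inner corner cannot cross the top edge, and then `cover` places it below a side at
that corner. -/
theorem nbr_mem (h : FacePath H u v m x) (D : Disk H n) (huv : H.Adj u v) {i : ℕ} (hi : i < m)
    {w : ℕ} (hw : H.Adj (x (i + 1)) w) :
    (x i ≤ w ∧ w ≤ x (i + 1)) ∨ (x (i + 1) ≤ w ∧ w ≤ x (i + 2)) := by
  have h1 := h.lt_of_lt (i := 0) (j := i + 1) (by omega) (by omega)
  have h2 := h.lt_of_lt (i := i + 1) (j := m + 1) (by omega) le_rfl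
  rw [h.first] at h1
  rw [h.last] at h2
  have hwu : u ≤ w := by
    by_contra hc
    exact D.noncrossing w u (x (i + 1)) v (by omega) h1 h2 hw.symm huv
  have hwv : w ≤ v := by
    by_contra hc
    exact D.noncrossing u (x (i + 1)) v w h1 h2 (by omega) huv hw
  rcases lt_trichotomy w (x (i + 1)) with hlt | rfl | hlt
  · obtain ⟨j, hj, a, b⟩ := h.cover w _ hw.symm hwu hlt h2.le (by omega)
    have c1 := (h.lt_iff (i := j) (j := i + 1) (by omega) (by omega)).1 (by omega)
    have c2 := (h.le_iff (i := i + 1) (j := j + 1) (by omega) (by omega)).1 b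
    obtain rfl : j = i := by omega
    exact .inl ⟨a, hlt.le⟩
  · exact (H.loopless.irrefl _ hw).elim
  · obtain ⟨j, hj, a, b⟩ := h.cover _ w hw h1.le hlt hwv (by omega)
    have c1 := (h.lt_iff (i := i + 1) (j := j + 1) (by omega) (by omega)).1 (by omega)
    have c2 := (h.le_iff (i := j) (j := i + 1) (by omega) (by omega)).1 a
    obtain rfl : j = i + 1 := by omega
    exact .inr ⟨hlt.le, b⟩

end FacePath

/-! ### Counting in a disk -/

section Counts

variable (H : SimpleGraph ℕ)

/-- The face with the inner edge `p q` has no other inner edge. -/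
def Ear (p q : ℕ) : Prop :=
  Inner H p q ∧ ∀ r s, Inner H r s → p ≤ r → s ≤ q → r = p ∧ s = q

open Classical in
/-- The ears between `u` and `v`. -/
noncomputable def ears (u v : ℕ) : Finset (ℕ × ℕ) :=
  (Finset.Icc u v ×ˢ Finset.Icc u v).filter fun e => Ear H e.1 e.2

/-- The number of ears between `u` and `v`. -/
noncomputable def earCount (u v : ℕ) : ℕ := (ears H u v).card

variable {H}

theorem mem_ears {u v : ℕ} {e : ℕ × ℕ} : e ∈ ears H u v ↔ Ear H e.1 e.2 ∧ u ≤ e.1 ∧ e.2 ≤ v := by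
  simp only [ears, Finset.mem_filter, Finset.mem_product, Finset.mem_Icc]
  constructor
  · rintro ⟨⟨h1, h2⟩, h3⟩; exact ⟨h3, h1.1, h2.2⟩
  · rintro ⟨h1, h2, h3⟩
    have := h1.1.2
    exact ⟨⟨⟨h2, by omega⟩, by omega, h3⟩, h1⟩

theorem earCount_mono {u v p q : ℕ} (h1 : u ≤ p) (h2 : q ≤ v) : earCount H p q ≤ earCount H u v :=
  Finset.card_le_card fun e he => by
    rw [mem_ears] at he ⊢
    exact ⟨he.1, by omega, by omega⟩

theorem earCount_succ (u : ℕ) : earCount H u (u + 1) = 0 := by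
  rw [earCount, Finset.card_eq_zero, Finset.eq_empty_iff_forall_notMem]
  intro e he
  rw [mem_ears] at he
  have := he.1.1.2
  omega

/-- A shortest inner edge below `u v` is an ear. -/
theorem exists_ear {u v : ℕ} (h : Inner H u v) : ∃ p q, Ear H p q ∧ u ≤ p ∧ q ≤ v := by
  obtain ⟨k, hk⟩ : ∃ k, v - u = k := ⟨_, rfl⟩
  induction k using Nat.strong_induction_on generalizing u v with
  | _ k ih =>
  by_cases he : Ear H u v
  · exact ⟨u, v, he, le_rfl, le_rfl⟩
  · have : ∃ r s, Inner H r s ∧ u ≤ r ∧ s ≤ v ∧ ¬ (r = u ∧ s = v) := by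
      by_contra hc
      push Not at hc
      exact he ⟨h, fun r s h1 h2 h3 => hc r s h1 h2 h3⟩
    obtain ⟨r, s, h1, h2, h3, h4⟩ := this
    have := h1.2
    obtain ⟨p, q, a, b, c⟩ := ih (s - r) (by omega) h1 rfl
    exact ⟨p, q, a, by omega, by omega⟩

theorem one_le_earCount {u v : ℕ} (h : Inner H u v) : 1 ≤ earCount H u v := by
  obtain ⟨p, q, h1, h2, h3⟩ := exists_ear h
  exact Finset.card_pos.2 ⟨(p, q), mem_ears.2 ⟨h1, h2, h3⟩⟩

theorem Ear.earCount_eq {u v : ℕ} (h : Ear H u v) : earCount H u v = 1 := by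
  rw [earCount, Finset.card_eq_one]
  refine ⟨(u, v), Finset.ext fun e => ?_⟩
  rw [mem_ears, Finset.mem_singleton]
  constructor
  · rintro ⟨h1, h2, h3⟩
    obtain ⟨h4, h5⟩ := h.2 _ _ h1.1 h2 h3
    exact Prod.ext h4 h5
  · rintro rfl
    exact ⟨h, le_rfl, le_rfl⟩

variable {u v m : ℕ} {x : ℕ → ℕ}

/-- A side that is an inner edge prevents `u v` from being an ear, so every ear lies below exactly
one side. -/
theorem FacePath.earCount_eq (h : FacePath H u v m x) {j : ℕ} (hj : j ≤ m)
    (hin : Inner H (x j) (x (j + 1))) :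
    earCount H u v = ∑ i ∈ Finset.range (m + 1), earCount H (x i) (x (i + 1)) := by
  classical
  unfold earCount
  rw [← Finset.card_biUnion]
  · congr 1
    ext e
    simp only [Finset.mem_biUnion, mem_ears, Finset.mem_range]
    constructor
    · rintro ⟨h1, h2, h3⟩
      have := h1.1.2
      obtain ⟨i, hi, a, b⟩ := h.cover e.1 e.2 h1.1.1 h2 (by omega) h3 (by
        by_contra hc
        push Not at hc
        have e1 := h1.2 _ _ hin (hc.1 ▸ (h.mem_Icc (by omega)).1) (hc.2 ▸ (h.mem_Icc (by omega)).2)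
        have := h.side_ne hj
        omega)
      exact ⟨i, by omega, h1, a, b⟩
    · rintro ⟨i, hi, h1, h2, h3⟩
      have a := h.mem_Icc (i := i) (by omega)
      have b := h.mem_Icc (i := i + 1) (by omega)
      exact ⟨h1, by omega, by omega⟩
  · have key : ∀ i k, i < k → k ≤ m → Disjoint (ears H (x i) (x (i + 1))) (ears H (x k) (x (k + 1))) := by
      intro i k hik hk
      rw [Finset.disjoint_left]
      intro e he he'
      rw [mem_ears] at he he'
      have := h.le_of_le (i := i + 1) (j := k) hik (by omega)
      have := he.1.1.2
      omega
    intro i hi k hk hik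
    simp only [Finset.coe_range, Set.mem_Iio] at hi hk
    rcases lt_or_gt_of_ne hik with h' | h'
    · exact key i k h' (by omega)
    · exact (key k i h' (by omega)).symm

theorem FacePath.ear_of_sides (h : FacePath H u v m x) (huv : Inner H u v)
    (hs : ∀ i ≤ m, x (i + 1) = x i + 1) : Ear H u v := by
  refine ⟨huv, fun r s hrs h1 h2 => ?_⟩
  by_contra hc
  have := hrs.2
  obtain ⟨i, hi, a, b⟩ := h.cover r s hrs.1 h1 (by omega) h2 (by omega)
  have := hs i hi
  omega

theorem FacePath.sum_Ioo (h : FacePath H u v m x) (ω : ℕ → ℕ) :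
    ∑ w ∈ Finset.Ioo u v, ω w = ∑ i ∈ Finset.range (m + 1), ∑ w ∈ Finset.Ioo (x i) (x (i + 1)), ω w +
      ∑ i ∈ Finset.range m, ω (x (i + 1)) := by
  have key : ∀ k ≤ m, ∑ w ∈ Finset.Ioo (x 0) (x (k + 1)), ω w =
      ∑ i ∈ Finset.range (k + 1), ∑ w ∈ Finset.Ioo (x i) (x (i + 1)), ω w +
      ∑ i ∈ Finset.range k, ω (x (i + 1)) := by
    intro k
    induction k with
    | zero => simp
    | succ k ih =>
      intro hk
      have h1 := h.lt_of_lt (i := 0) (j := k + 1) (by omega) (by omega)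
      have h2 := h.lt_succ (k + 1) hk
      have e : Finset.Ioo (x 0) (x (k + 1 + 1)) = (insert (x (k + 1)) (Finset.Ioo (x 0) (x (k + 1)))) ∪
          Finset.Ioo (x (k + 1)) (x (k + 1 + 1)) := by
        ext w
        simp only [Finset.mem_Ioo, Finset.mem_union, Finset.mem_insert]
        omega
      rw [e, Finset.sum_union, Finset.sum_insert (by simp), ih (by omega), Finset.sum_range_succ _ (k + 1),
        Finset.sum_range_succ (fun i => ω (x (i + 1))) k]
      · ring
      · rw [Finset.disjoint_left]
        intro w
        simp only [Finset.mem_Ioo, Finset.mem_insert]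
        omega
  rw [← key m le_rfl, h.first, h.last]

end Counts

/-! ### The induction over the inner edges -/

section Core

variable {V : Type*} [Fintype V] {G : SimpleGraph V} {H : SimpleGraph ℕ} {n : ℕ} {e : ℕ → V}

/-- `e 0, …, e (n - 1)` lists the vertices of `G` along the outer cycle, `H` being the graph on
their numbers. -/
structure Layout (G : SimpleGraph V) (H : SimpleGraph ℕ) (n : ℕ) (e : ℕ → V) : Prop where
  disk : Disk H n
  adj_iff : ∀ i < n, ∀ j < n, (G.Adj (e i) (e j) ↔ H.Adj i j)
  inj : ∀ i < n, ∀ j < n, e i = e j → i = j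
  surj : ∀ w, ∃ i < n, e i = w

/-- The vertices with numbers between `u` and `v`. -/
def arc (e : ℕ → V) (u v : ℕ) : Set V := e '' Set.Icc u v

theorem arc_succ (u : ℕ) : arc e u (u + 1) = {e u, e (u + 1)} := by
  have : Set.Icc u (u + 1) = {u, u + 1} := by
    ext w
    simp only [Set.mem_Icc, Set.mem_insert_iff, Set.mem_singleton_iff]
    omega
  rw [arc, this, Set.image_pair]

namespace Layout

theorem exists_of_adj (h : Layout G H n e) {i : ℕ} (hi : i < n) {w : V} (hw : G.Adj (e i) w) :
    ∃ j < n, e j = w ∧ H.Adj i j := by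
  obtain ⟨j, hj, rfl⟩ := h.surj w
  exact ⟨j, hj, rfl, (h.adj_iff i hi j hj).1 hw⟩

theorem mem_arc (h : Layout G H n e) {i u v : ℕ} (hi : i < n) (hv : v < n) :
    e i ∈ arc e u v ↔ u ≤ i ∧ i ≤ v := by
  constructor
  · rintro ⟨j, hj, hij⟩
    obtain rfl := h.inj j (by have := hj.2; omega) i hi hij
    exact hj
  · exact fun hi => ⟨i, hi, rfl⟩

variable {u v m : ℕ} {x : ℕ → ℕ}

theorem polygon (h : Layout G H n e) (huv : Inner H u v) (p : FacePath H u v m x) :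
    Polygon G m (fun i => e (x i)) (fun i => arc e (x i) (x (i + 1))) (arc e u v) := by
  have hvn : v < n := h.disk.lt _ _ huv.1.symm
  have hx : ∀ i ≤ m + 1, x i < n := fun i hi => (p.mem_Icc hi).2.trans_lt hvn
  refine ⟨p.one_le, fun i hi => ?_, fun i hi => ?_, fun w => ⟨?_, ?_⟩, ?_, fun i hi w hw => ?_,
    fun w hwR hw => ?_, fun w hwR hw => ?_⟩
  · exact ⟨x i, ⟨le_rfl, (p.lt_succ i hi).le⟩, rfl⟩
  · exact ⟨x (i + 1), ⟨(p.lt_succ i hi).le, le_rfl⟩, rfl⟩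
  · rintro ⟨j, ⟨h1, h2⟩, rfl⟩
    rcases h2.eq_or_lt with rfl | h2
    · refine ⟨m, le_rfl, _, ⟨?_, p.last.ge⟩, rfl⟩
      exact p.last ▸ (p.lt_succ m le_rfl).le
    · obtain ⟨i, hi, a, b⟩ := p.exists_side h1 h2
      exact ⟨i, hi, j, ⟨a, b.le⟩, rfl⟩
  · rintro ⟨i, hi, j, ⟨h1, h2⟩, rfl⟩
    exact ⟨j, ⟨(p.mem_Icc (by omega)).1.trans h1, h2.trans (p.mem_Icc (by omega)).2⟩, rfl⟩
  · rw [h.adj_iff _ (hx _ (by omega)) _ (hx _ le_rfl), p.first, p.last]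
    exact huv.1
  · obtain ⟨j, hj, rfl, hij⟩ := h.exists_of_adj (hx _ (by omega)) hw
    exact (p.nbr_mem h.disk huv.1 hi hij).imp (fun h' => ⟨j, h', rfl⟩) fun h' => ⟨j, h', rfl⟩
  · obtain ⟨j, hj, rfl, hij⟩ := h.exists_of_adj (hx _ (by omega)) hw
    obtain ⟨h1, h2⟩ := (h.mem_arc hj hvn).1 hwR
    rw [p.first] at hij
    have hne := hij.ne
    by_cases hc : j = v
    · exact .inr (by rw [p.last, hc])
    · obtain ⟨i, hi, a, b⟩ := p.cover u j hij le_rfl (by omega) h2 (.inr hc)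
      rw [← p.first, p.le_iff (by omega) (by omega)] at a
      obtain rfl : i = 0 := by omega
      exact .inl ⟨j, ⟨by rw [p.first]; exact h1, b⟩, rfl⟩
  · obtain ⟨j, hj, rfl, hij⟩ := h.exists_of_adj (hx _ le_rfl) hw
    obtain ⟨h1, h2⟩ := (h.mem_arc hj hvn).1 hwR
    rw [p.last] at hij
    have hne := hij.ne
    by_cases hc : j = u
    · exact .inr (by rw [p.first, hc])
    · obtain ⟨i, hi, a, b⟩ := p.cover j v hij.symm h1 (by omega) le_rfl (.inl hc)
      rw [← p.last, p.le_iff (by omega) (by omega)] at b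
      obtain rfl : i = m := by omega
      exact .inl ⟨j, ⟨a, by rw [p.last]; exact h2⟩, rfl⟩

theorem adj_side (h : Layout G H n e) (huv : Inner H u v) (p : FacePath H u v m x) {i : ℕ}
    (hi : i ≤ m) : G.Adj (e (x i)) (e (x (i + 1))) := by
  have hvn : v < n := h.disk.lt _ _ huv.1.symm
  exact (h.adj_iff _ ((p.mem_Icc (by omega)).2.trans_lt hvn) _
    ((p.mem_Icc (by omega)).2.trans_lt hvn)).2 (p.adj i hi)

end Layout

theorem FacePath.inner_or_edge {u v m : ℕ} {x : ℕ → ℕ} (p : FacePath H u v m x) {i : ℕ}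
    (hi : i ≤ m) : Inner H (x i) (x (i + 1)) ∨ x (i + 1) = x i + 1 := by
  have := p.lt_succ i hi
  by_cases h : x (i + 1) = x i + 1
  · exact .inr h
  · exact .inl ⟨p.adj i hi, by omega⟩

/-- Faces of the trunk and of the foliage, and doubled vertex weights with the properties
used in the proof. -/
structure Weighted (H : SimpleGraph ℕ) (trunk fol : ℕ → ℕ → Prop) (ω : ℕ → ℕ) (L : ℕ) : Prop where
  trunk_of_even : ∀ u v m x, Inner H u v → FacePath H u v m x →
    (∀ i ≤ m, Even (earCount H (x i) (x (i + 1)))) → (∃ i ≤ m, Inner H (x i) (x (i + 1))) →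
    earCount H u v + 2 ≤ L → trunk u v
  not_fol : ∀ u v, trunk u v → ¬ fol u v
  one_le : ∀ u v w, Inner H u v → trunk u v → OnFace H u v w → 1 ≤ ω w
  two_le : ∀ u v w, Inner H u v → trunk u v → OnFace H u v w →
    (∀ p q, Inner H p q → fol p q → ¬ OnFace H p q w) → 2 ≤ ω w

open Classical in
/-- Whether `y` lies on a face of the foliage between `u` and `v`. -/
noncomputable def flag (H : SimpleGraph ℕ) (fol : ℕ → ℕ → Prop) (u v y : ℕ) : ℕ :=
  if ∃ p q, Inner H p q ∧ u ≤ p ∧ q ≤ v ∧ fol p q ∧ OnFace H p q y then 1 else 0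

/-- The doubled budget for sweeping the vertices between `u` and `v` in both directions. -/
noncomputable def budget (H : SimpleGraph ℕ) (ω : ℕ → ℕ) (u v : ℕ) : ℕ :=
  4 * earCount H u v + ∑ w ∈ Finset.Ioo u v, ω w

variable {trunk fol : ℕ → ℕ → Prop} {ω : ℕ → ℕ} {L u v m : ℕ} {x : ℕ → ℕ}

theorem flag_le_one (u v y : ℕ) : flag H fol u v y ≤ 1 := by
  unfold flag
  split_ifs <;> omega

theorem flag_edge (u y : ℕ) : flag H fol u (u + 1) y = 0 := by
  rw [flag, if_neg]
  rintro ⟨p, q, h, h1, h2, -⟩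
  have := h.2
  omega

theorem flag_congr {u v u' v' y : ℕ} (h : ∀ p q, Inner H p q → fol p q → OnFace H p q y →
    (u ≤ p ∧ q ≤ v ↔ u' ≤ p ∧ q ≤ v')) : flag H fol u v y = flag H fol u' v' y := by
  unfold flag
  congr 1
  refine propext ⟨?_, ?_⟩ <;> rintro ⟨p, q, h1, h2, h3, h4, h5⟩
  · exact ⟨p, q, h1, ((h p q h1 h4 h5).1 ⟨h2, h3⟩).1, ((h p q h1 h4 h5).1 ⟨h2, h3⟩).2, h4, h5⟩
  · exact ⟨p, q, h1, ((h p q h1 h4 h5).2 ⟨h2, h3⟩).1, ((h p q h1 h4 h5).2 ⟨h2, h3⟩).2, h4, h5⟩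

/-- As the face of `u v` is not in the foliage, a foliage face at `u` lies below a side, necessarily
the first. The new region inherits the flag. -/
theorem FacePath.flag_first (p : FacePath H u v m x) (hf : ¬ fol u v) :
    flag H fol (x 0) (x 1) u = flag H fol u v u := by
  refine flag_congr fun r s hrs hfol hon => ?_
  have a := p.mem_Icc (i := 1) (by omega)
  have := hrs.2
  have := hon.1
  constructor
  · rintro ⟨h1, h2⟩
    rw [p.first] at h1
    omega
  · rintro ⟨h1, h2⟩
    obtain ⟨i, hi, b, c⟩ := p.cover r s hrs.1 h1 (by omega) h2 (by
      by_contra hc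
      push Not at hc
      exact hf (hc.1 ▸ hc.2 ▸ hfol))
    have : x i ≤ x 0 := by rw [p.first]; omega
    rw [p.le_iff (by omega) (by omega)] at this
    obtain rfl : i = 0 := by omega
    exact ⟨b, c⟩

theorem FacePath.flag_last (p : FacePath H u v m x) (hf : ¬ fol u v) :
    flag H fol (x m) (x (m + 1)) v = flag H fol u v v := by
  refine flag_congr fun r s hrs hfol hon => ?_
  have a := p.mem_Icc (i := m) (by omega)
  have := hrs.2
  have := hon.2.1
  constructor
  · rintro ⟨h1, h2⟩
    rw [p.last] at h2
    omega
  · rintro ⟨h1, h2⟩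
    obtain ⟨i, hi, b, c⟩ := p.cover r s hrs.1 h1 (by omega) h2 (by
      by_contra hc
      push Not at hc
      exact hf (hc.1 ▸ hc.2 ▸ hfol))
    have : x (m + 1) ≤ x (i + 1) := by rw [p.last]; omega
    rw [p.le_iff (by omega) (by omega)] at this
    obtain rfl : i = m := by omega
    exact ⟨b, c⟩

theorem budget_edge (u : ℕ) : budget H ω u (u + 1) = 0 := by
  have : Finset.Ioo u (u + 1) = ∅ := by
    ext w
    simp only [Finset.mem_Ioo, Finset.notMem_empty, iff_false]
    omega
  rw [budget, earCount_succ, this, Finset.sum_empty, mul_zero, add_zero]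

/-- Ears and weights below `u v` are those below the sides, plus the weights of the inner corners.
-/
theorem FacePath.budget_eq (p : FacePath H u v m x) {j : ℕ} (hj : j ≤ m)
    (hin : Inner H (x j) (x (j + 1))) :
    budget H ω u v = MonoFace.total m (fun i => budget H ω (x i) (x (i + 1)))
      fun i => ω (x (i + 1)) := by
  simp only [budget, MonoFace.total, p.earCount_eq hj hin, p.sum_Ioo, Finset.sum_add_distrib,
    Finset.mul_sum]
  ring

theorem edgeRegion (h : Layout G H n e) {u : ℕ} (hu : H.Adj u (u + 1)) :
    EdgeRegion G (arc e u (u + 1)) (e u) (e (u + 1)) (budget H ω u (u + 1))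
      (flag H fol u (u + 1) u) (flag H fol u (u + 1) (u + 1)) :=
  ⟨arc_succ u, (h.adj_iff _ (h.disk.lt _ _ hu) _ (h.disk.lt _ _ hu.symm)).2 hu, budget_edge u,
    flag_edge _ _, flag_edge _ _⟩

/-- A vertex strictly between `u` and `v` on the face with inner edge `u v` is flagged for one of
the adjacent sides, or lies on no face of the foliage. -/
theorem FacePath.flag_corner (p : FacePath H u v m x) (D : Disk H n) (huv : H.Adj u v)
    (hf : ¬ fol u v) {i : ℕ} (hi : i < m) {r s : ℕ} (hrs : Inner H r s) (hfol : fol r s)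
    (hon : OnFace H r s (x (i + 1))) :
    1 ≤ flag H fol (x i) (x (i + 1)) (x (i + 1)) +
      flag H fol (x (i + 1)) (x (i + 1 + 1)) (x (i + 1)) := by
  have h1 := p.lt_of_lt (i := 0) (j := i + 1) (by omega) (by omega)
  have h2 := p.lt_of_lt (i := i + 1) (j := m + 1) (by omega) le_rfl
  rw [p.first] at h1
  rw [p.last] at h2
  have hne : r ≠ u ∨ s ≠ v := by
    by_contra hc
    push Not at hc
    exact hf (hc.1 ▸ hc.2 ▸ hfol)
  obtain ⟨o1, o2, o3⟩ := hon
  have hr2 := hrs.2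
  have hin : u ≤ r ∧ s ≤ v := by
    by_contra hc
    have k1 := D.noncrossing r u s v
    have k2 := D.noncrossing u r v s
    have k3 := o3 u v huv
    by_cases c1 : r ≤ u
    · by_cases c2 : v ≤ s
      · have := k3 c1 h1 h2 c2
        omega
      · by_cases c3 : r = u
        · omega
        · exact k1 (by omega) (by omega) (by omega) hrs.1 huv
    · exact k2 (by omega) (by omega) (by omega) huv hrs.1
  obtain ⟨j, hj, a, b⟩ := p.cover r s hrs.1 hin.1 (by omega) hin.2 hne
  have c1 := (p.le_iff (i := j) (j := i + 1) (by omega) (by omega)).1 (by omega)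
  have c2 := (p.le_iff (i := i + 1) (j := j + 1) (by omega) (by omega)).1 (by omega)
  obtain rfl | rfl : j = i ∨ j = i + 1 := by omega
  · have : flag H fol (x j) (x (j + 1)) (x (j + 1)) = 1 :=
      if_pos ⟨r, s, hrs, a, b, hfol, o1, o2, o3⟩
    omega
  · have : flag H fol (x (i + 1)) (x (i + 1 + 1)) (x (i + 1)) = 1 :=
      if_pos ⟨r, s, hrs, a, b, hfol, o1, o2, o3⟩
    omega

/-- The invariant of the region of an inner edge. -/
def InnerRegion (G : SimpleGraph V) (H : SimpleGraph ℕ) (fol : ℕ → ℕ → Prop) (ω : ℕ → ℕ)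
    (e : ℕ → V) (u v : ℕ) : Prop :=
  (Odd (earCount H u v) ∧ 2 * (cost (Fills G (arc e u v)) +
      cost (Absorbs G (arc e u v) (e u) (e v))) ≤ budget H ω u v) ∨
    (Even (earCount H u v) ∧ EvenRegion G (arc e u v) (e u) (e v) (budget H ω u v)
      (flag H fol u v u) (flag H fol u v v))

theorem InnerRegion.parityRegion (h : InnerRegion G H fol ω e u v) :
    ParityRegion G (arc e u v) (e u) (e v) (earCount H u v) (budget H ω u v) :=
  h.imp id fun h => ⟨h.1, h.2.cost_sweeps_le⟩

theorem parityRegion_edge (h : Layout G H n e) {u : ℕ} (hu : H.Adj u (u + 1)) :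
    ParityRegion G (arc e u (u + 1)) (e u) (e (u + 1)) (earCount H u (u + 1))
      (budget H ω u (u + 1)) :=
  .inr ⟨by rw [earCount_succ]; exact ⟨0, rfl⟩,
    (edgeRegion (fol := fun _ _ => False) h hu).cost_sweeps_le⟩

theorem FacePath.sum_budget_le (p : FacePath H u v m x) {j : ℕ} (hj : j ≤ m)
    (hin : Inner H (x j) (x (j + 1))) :
    ∑ i ∈ Finset.range (m + 1), budget H ω (x i) (x (i + 1)) ≤ budget H ω u v := by
  rw [p.budget_eq hj hin]
  exact Nat.le_add_right _ _

/-- The face step if there are no sides but edges. -/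
theorem ear_costs (h : Layout G H n e) (huv : Inner H u v) (p : FacePath H u v m x)
    (hs : ∀ i ≤ m, ¬ Inner H (x i) (x (i + 1))) :
    earCount H u v = 1 ∧ cost (Fills G (arc e u v)) ≤ 2 ∧
      cost (Absorbs G (arc e u v) (e u) (e v)) = 0 := by
  have hs' : ∀ i ≤ m, x (i + 1) = x i + 1 := fun i hi => (p.inner_or_edge hi).resolve_left (hs i hi)
  refine ⟨(p.ear_of_sides huv hs').earCount_eq, ?_⟩
  have := (h.polygon huv p).leaf_costs fun i hi => ⟨?_, h.adj_side huv p hi⟩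
  · simpa only [p.first, p.last] using this
  · rw [hs' i hi]
    exact arc_succ _

theorem odd_of_sides (h : Layout G H n e) (huv : Inner H u v) (p : FacePath H u v m x)
    (hs : ∀ i ≤ m, Inner H (x i) (x (i + 1)) →
      ParityRegion G (arc e (x i) (x (i + 1))) (e (x i)) (e (x (i + 1)))
        (earCount H (x i) (x (i + 1))) (budget H ω (x i) (x (i + 1))))
    (ho : Odd (earCount H u v)) :
    2 * (cost (Fills G (arc e u v)) + cost (Absorbs G (arc e u v) (e u) (e v))) ≤
      budget H ω u v := by
  by_cases hin : ∃ j ≤ m, Inner H (x j) (x (j + 1))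
  · obtain ⟨j, hj, hin⟩ := hin
    have := (h.polygon huv p).odd_of_parity (t := fun i => budget H ω (x i) (x (i + 1)))
      (ℓ := fun i => earCount H (x i) (x (i + 1))) (fun i hi => ?_)
      (by rwa [← p.earCount_eq hj hin])
    · simp only [p.first, p.last] at this
      exact this.trans (p.sum_budget_le hj hin)
    · rcases p.inner_or_edge hi with h1 | h1
      · exact hs i hi h1
      · have := p.adj i hi
        rw [h1] at this ⊢
        exact parityRegion_edge h this
  · push Not at hin
    obtain ⟨h1, h2, h3⟩ := ear_costs h huv p hin
    unfold budget
    omega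

theorem strong_of_sides (h : Layout G H n e) (huv : Inner H u v) (p : FacePath H u v m x)
    (hs : ∀ i ≤ m, Inner H (x i) (x (i + 1)) →
      ParityRegion G (arc e (x i) (x (i + 1))) (e (x i)) (e (x (i + 1)))
        (earCount H (x i) (x (i + 1))) (budget H ω (x i) (x (i + 1))))
    (he : Even (earCount H u v)) {j : ℕ} (hj : j ≤ m) (ho : Odd (earCount H (x j) (x (j + 1)))) :
    Strong G (arc e u v) (e u) (e v) (budget H ω u v) := by
  have hin : Inner H (x j) (x (j + 1)) := (p.inner_or_edge hj).resolve_right fun h' => by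
    rw [h', earCount_succ] at ho
    simp at ho
  have := (h.polygon huv p).strong_of_parity (t := fun i => budget H ω (x i) (x (i + 1)))
      (ℓ := fun i => earCount H (x i) (x (i + 1))) (fun i hi => ?_)
      (by rwa [← p.earCount_eq hj hin]) hj ho
  · simp only [p.first, p.last] at this
    exact le_trans this (p.sum_budget_le hj hin)
  · rcases p.inner_or_edge hi with h1 | h1
    · exact hs i hi h1
    · have := p.adj i hi
      rw [h1] at this ⊢
      exact parityRegion_edge h this

/-- Induction on the width of the inner edge. Corner weights are spent only when all sides are even,
where `trunk_of_even` applies because some ear lies outside. -/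
theorem innerRegion (h : Layout G H n e) (hW : Weighted H trunk fol ω L) (huv : Inner H u v)
    (hL : earCount H u v + 2 ≤ L) : InnerRegion G H fol ω e u v := by
  obtain ⟨k, hk⟩ : ∃ k, v - u = k := ⟨_, rfl⟩
  induction k using Nat.strong_induction_on generalizing u v with
  | _ k ih =>
  obtain ⟨m, x, p⟩ := h.disk.exists_facePath huv
  have hs : ∀ i ≤ m, Inner H (x i) (x (i + 1)) → InnerRegion G H fol ω e (x i) (x (i + 1)) := by
    intro i hi hin
    refine ih _ (hk ▸ p.side_lt hi) hin ?_ rfl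
    have := earCount_mono (H := H) (p.mem_Icc (i := i) (by omega)).1
      (p.mem_Icc (i := i + 1) (by omega)).2
    omega
  have hs' := fun i hi hin => (hs i hi hin).parityRegion
  rcases Nat.even_or_odd (earCount H u v) with he | ho
  swap
  · exact .inl ⟨ho, odd_of_sides h huv p hs' ho⟩
  refine .inr ⟨he, ?_⟩
  by_cases hex : ∃ j ≤ m, Odd (earCount H (x j) (x (j + 1)))
  · obtain ⟨j, hj, hjo⟩ := hex
    exact .inl (strong_of_sides h huv p hs' he hj hjo)
  push Not at hex
  have hex' : ∀ i ≤ m, Even (earCount H (x i) (x (i + 1))) := fun i hi =>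
    Nat.not_odd_iff_even.1 (hex i hi)
  -- Without such a side the region would be an ear, and one is odd.
  have hin : ∃ j ≤ m, Inner H (x j) (x (j + 1)) := by
    by_contra hc
    push Not at hc
    have := (ear_costs h huv p hc).1
    rw [this] at he
    simp at he
  have ht := hW.trunk_of_even u v m x huv p hex' hin hL
  have hf := hW.not_fol u v ht
  have hmono : MonoFace G m (fun i => e (x i)) (fun i => arc e (x i) (x (i + 1))) (arc e u v)
      (fun i => budget H ω (x i) (x (i + 1))) (fun i => flag H fol (x i) (x (i + 1)) (x i))
      (fun i => flag H fol (x i) (x (i + 1)) (x (i + 1))) (fun i => ω (x (i + 1))) := by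
    refine ⟨h.polygon huv p, fun i hi => ?_, fun i hi => h.adj_side huv p hi,
      fun i hi => flag_le_one _ _ _, fun i hi => flag_le_one _ _ _,
      fun i hi => hW.one_le u v _ huv ht (p.onFace_iff.2 ⟨i + 1, by omega, rfl⟩), fun i hi => ?_⟩
    · rcases p.inner_or_edge hi with h1 | h1
      · rcases hs i hi h1 with h2 | h2
        · exact absurd h2.1 (hex i hi)
        · exact .inr h2.2
      · have := p.adj i hi
        rw [h1] at this ⊢
        exact .inl (edgeRegion h this)
    · have h1 := hW.one_le u v _ huv ht (p.onFace_iff.2 ⟨i + 1, by omega, rfl⟩)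
      -- A corner that may be worth one point only lies on a foliage face; this face sits below an
      -- adjacent side and raises a flag there.
      by_cases hc : ∃ r s, Inner H r s ∧ fol r s ∧ OnFace H r s (x (i + 1))
      · obtain ⟨r, s, a, b, c⟩ := hc
        have := p.flag_corner h.disk huv.1 hf hi a b c
        rw [add_assoc]
        omega
      · have := hW.two_le u v _ huv ht (p.onFace_iff.2 ⟨i + 1, by omega, rfl⟩)
          fun r s a b c => hc ⟨r, s, a, b, c⟩
        omega
  obtain ⟨j, hj, hin⟩ := hin
  have := hmono.evenRegion fun hall => by
    have h1 := (hall j hj).2.2.1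
    have h2 := one_le_earCount hin
    simp only [budget] at h1
    omega
  simp only [← p.budget_eq hj hin, zero_add] at this
  rw [p.first, p.last, show flag H fol u (x 1) u = flag H fol u v u by
      rw [← p.flag_first hf, p.first]] at this
  rw [← p.flag_last hf, p.last]
  exact this

/-- Regions that contain all ears but one. -/
theorem root_costs (h : Layout G H n e) (hW : Weighted H trunk fol ω L) (huv : Inner H u v)
    (hL : earCount H u v + 1 ≤ L) :
    (Odd (earCount H u v) → 2 * (cost (Fills G (arc e u v)) +
      cost (Absorbs G (arc e u v) (e u) (e v))) ≤ budget H ω u v) ∧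
    (Even (earCount H u v) → 4 * cost (Absorbs G (arc e u v) (e u) (e v)) ≤ budget H ω u v) := by
  have hgood : ∀ {u v}, earCount H u v + 2 ≤ L → Inner H u v → InnerRegion G H fol ω e u v :=
    fun h1 h2 => innerRegion h hW h2 h1
  have hfour : ∀ {u v t}, 2 * (cost (Sweeps G (arc e u v) (e u)) +
      cost (Sweeps G (arc e u v) (e v))) ≤ t →
      4 * cost (Absorbs G (arc e u v) (e u) (e v)) ≤ t := by
    intro u v t h1
    have c1 := cost_absorbs_le_left G (arc e u v) (e u) (e v)
    have c2 := cost_absorbs_le_right G (arc e u v) (e u) (e v)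
    omega
  obtain ⟨k, hk⟩ : ∃ k, v - u = k := ⟨_, rfl⟩
  induction k using Nat.strong_induction_on generalizing u v with
  | _ k ih =>
  by_cases hL2 : earCount H u v + 2 ≤ L
  · rcases hgood hL2 huv with ⟨h1, h2⟩ | ⟨h1, h2⟩
    · exact ⟨fun _ => h2, fun h' => absurd h' (Nat.not_even_iff_odd.2 h1)⟩
    · exact ⟨fun h' => absurd h1 (Nat.not_even_iff_odd.2 h'), fun _ => hfour h2.cost_sweeps_le⟩
  obtain ⟨m, x, p⟩ := h.disk.exists_facePath huv
  by_cases hin : ∃ j ≤ m, Inner H (x j) (x (j + 1))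
  swap
  · push Not at hin
    obtain ⟨h1, h2, h3⟩ := ear_costs h huv p hin
    refine ⟨fun _ => ?_, fun h' => ?_⟩
    · unfold budget; omega
    · rw [h1] at h'; simp at h'
  obtain ⟨j, hj, hin⟩ := hin
  -- This face need not be in the trunk, as possibly no ear lies outside. With a single inner side,
  -- though, the costs of that side carry over without use of any weight.
  by_cases huniq : ∀ i ≤ m, i ≠ j → ¬ Inner H (x i) (x (i + 1))
  · have hle : earCount H (x j) (x (j + 1)) ≤ earCount H u v :=
      earCount_mono (p.mem_Icc (by omega)).1 (p.mem_Icc (by omega)).2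
    obtain ⟨i1, i2⟩ := ih _ (hk ▸ p.side_lt hj) hin (by omega) rfl
    have hsum : earCount H u v = earCount H (x j) (x (j + 1)) := by
      rw [p.earCount_eq hj hin, Finset.sum_eq_single j]
      · intro i hi hij
        have hi : i ≤ m := by simpa [Nat.lt_succ_iff] using hi
        rw [(p.inner_or_edge hi).resolve_left (huniq i hi hij), earCount_succ]
      · simp [hj]
    rw [hsum]
    refine ⟨fun ho => odd_of_sides h huv p (fun i hi hin' => ?_) (hsum ▸ ho), fun he => ?_⟩
    · obtain rfl : i = j := by
        by_contra hc
        exact huniq i hi hc hin'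
      exact .inl ⟨ho, i1 ho⟩
    · have := (h.polygon huv p).cost_absorbs_le_of_unique hj fun i hi hij => ⟨?_, h.adj_side huv p hi⟩
      · simp only [p.first, p.last] at this
        have h4 := i2 he
        have h5 := p.sum_budget_le (ω := ω) hj hin
        have h6 := Finset.single_le_sum (f := fun i => budget H ω (x i) (x (i + 1)))
          (fun _ _ => Nat.zero_le _) (Finset.mem_range.2 (show j < m + 1 by omega))
        omega
      · rw [(p.inner_or_edge hi).resolve_left (huniq i hi hij)]
        exact arc_succ _
  · push Not at huniq
    obtain ⟨j', hj', hne, hin'⟩ := huniq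
    -- With two inner sides, each of them misses an ear of the other, so the full invariant is
    -- available.
    have hs : ∀ i ≤ m, Inner H (x i) (x (i + 1)) → InnerRegion G H fol ω e (x i) (x (i + 1)) := by
      intro i hi hin''
      refine hgood ?_ hin''
      obtain ⟨k, hk, hki, hkin⟩ : ∃ k ≤ m, k ≠ i ∧ Inner H (x k) (x (k + 1)) := by
        by_cases hc : j = i
        · exact ⟨j', hj', hc ▸ hne, hin'⟩
        · exact ⟨j, hj, hc, hin⟩
      have h1 := one_le_earCount hkin
      have h2 := Finset.add_le_sum (f := fun i => earCount H (x i) (x (i + 1)))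
        (fun _ _ => Nat.zero_le _) (Finset.mem_range.2 (show i < m + 1 by omega))
        (Finset.mem_range.2 (show k < m + 1 by omega)) hki.symm
      rw [← p.earCount_eq hj hin] at h2
      omega
    have hs' := fun i hi hin => (hs i hi hin).parityRegion
    refine ⟨odd_of_sides h huv p hs', fun he => ?_⟩
    by_cases hex : ∃ j ≤ m, Odd (earCount H (x j) (x (j + 1)))
    · obtain ⟨j, hj, hjo⟩ := hex
      refine hfour (EvenRegion.cost_sweeps_le (fa := 0) (fb := 0)
        (.inl (strong_of_sides h huv p hs' he hj hjo)))
    · push Not at hex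
      have hsum := p.sum_budget_le (ω := ω) hj hin
      have hside : ∀ i ≤ m, 2 * (cost (Sweeps G (arc e (x i) (x (i + 1))) (e (x i))) +
          cost (Sweeps G (arc e (x i) (x (i + 1))) (e (x (i + 1))))) ≤
          budget H ω (x i) (x (i + 1)) := by
        intro i hi
        rcases p.inner_or_edge hi with h1 | h1
        · rcases hs' i hi h1 with h2 | h2
          · exact absurd h2.1 (hex i hi)
          · exact h2.2
        · have := p.adj i hi
          rw [h1] at this ⊢
          exact (edgeRegion (fol := fol) h this).cost_sweeps_le
      -- When absorbing, both ends are given and no corner has to be colored in advance. The forward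
      -- and the backward sweeps both absorb.
      have c1 := cost_le_sum (m := m)
        (P := fun i => Sweeps G (arc e (x i) (x (i + 1))) (e (x i)))
        (Q := Absorbs G (arc e u v) (e u) (e v)) (fun _ _ => attainable_sweeps _ _) fun T hT => by
          have := (h.polygon huv p).absorbs_of_labelled (Polygon.labelled_true hT)
          simpa only [p.first, p.last] using this
      have c2 := cost_le_sum (m := m)
        (P := fun i => Sweeps G (arc e (x i) (x (i + 1))) (e (x (i + 1))))
        (Q := Absorbs G (arc e u v) (e u) (e v)) (fun _ _ => attainable_sweeps _ _) fun T hT => by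
          have := (h.polygon huv p).absorbs_of_labelled (l := fun _ => false) (S := T)
            (Polygon.labelled_of_directed hT)
          simpa only [p.first, p.last] using this
      have h3 := Finset.sum_le_sum fun i (hi : i ∈ Finset.range (m + 1)) =>
        hside i (by simpa [Nat.lt_succ_iff] using hi)
      rw [← Finset.mul_sum, Finset.sum_add_distrib] at h3
      omega

end Core

/-! ### The bound at the root edge -/

section Root

variable {V : Type*} [Fintype V] {G : SimpleGraph V} {H : SimpleGraph ℕ} {n : ℕ} {e : ℕ → V}

/-- The set of forced vertices is itself closed under forcing. -/
theorem forced_of_closed {S : Finset V} (h : ∀ C, ForceClosed G C → (S : Set V) ⊆ C → C = Set.univ) :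
    IsZeroForcingSet G (S : Set V) := by
  have := h {v | Forced G S v} (fun u hu v huv hw => .force u v hu huv hw)
    fun v hv => .initial v hv
  exact fun v => this.ge (Set.mem_univ v)

theorem zeroForcingNumber_le {S : Finset V}
    (h : ∀ C, ForceClosed G C → (S : Set V) ⊆ C → C = Set.univ) : zeroForcingNumber G ≤ S.card :=
  Nat.sInf_le ⟨S, forced_of_closed h, rfl⟩

namespace Layout

theorem arc_eq_univ (h : Layout G H n e) : arc e 0 (n - 1) = Set.univ := by
  refine Set.eq_univ_of_forall fun w => ?_
  obtain ⟨i, hi, rfl⟩ := h.surj w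
  exact ⟨i, ⟨Nat.zero_le _, by omega⟩, rfl⟩

theorem zeroForcingNumber_le_fills (h : Layout G H n e) :
    zeroForcingNumber G ≤ cost (Fills G (arc e 0 (n - 1))) := by
  obtain ⟨S, hS, hc⟩ := (attainable_fills (G := G) (arc e 0 (n - 1))).exists_eq
  rw [← hc]
  refine zeroForcingNumber_le fun C hC hSC => Set.univ_subset_iff.1 ?_
  rw [← h.arc_eq_univ]
  exact hS C hC hSC

/-- Nothing lies outside the region of the root edge, so coloring its two ends serves them
completely. -/
theorem zeroForcingNumber_le_absorbs (h : Layout G H n e) :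
    zeroForcingNumber G ≤ cost (Absorbs G (arc e 0 (n - 1)) (e 0) (e (n - 1))) + 2 := by
  classical
  obtain ⟨S, hS, hc⟩ := (attainable_absorbs (G := G) (arc e 0 (n - 1)) (e 0) (e (n - 1))).exists_eq
  rw [← hc]
  refine (zeroForcingNumber_le (S := S ∪ {e 0, e (n - 1)}) fun C hC hSC => ?_).trans
    ((Finset.card_union_le _ _).trans (Nat.add_le_add_left Finset.card_le_two _))
  rw [Finset.coe_union, Set.union_subset_iff] at hSC
  refine Set.univ_subset_iff.1 ?_
  rw [← h.arc_eq_univ]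
  refine hS C hC hSC.1 (hSC.2 (by simp)) (hSC.2 (by simp)) ?_ ?_ <;>
  · intro w _ hw
    rw [h.arc_eq_univ] at hw
    exact absurd (Set.mem_univ w) hw

theorem inner_root (h : Layout G H n e) : Inner H 0 (n - 1) :=
  ⟨h.disk.root, by have := h.disk.three_le; omega⟩

/-- The bound, in units of a quarter. -/
theorem four_mul_zeroForcingNumber_le (h : Layout G H n e) {trunk fol : ℕ → ℕ → Prop} {ω : ℕ → ℕ}
    {L : ℕ} (hW : Weighted H trunk fol ω L) (hL : earCount H 0 (n - 1) + 1 ≤ L) :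
    4 * zeroForcingNumber G ≤ 8 * ((L + 1) / 2) + ∑ w ∈ Finset.range n, ω w := by
  have h1 := h.zeroForcingNumber_le_fills
  have h2 := h.zeroForcingNumber_le_absorbs
  obtain ⟨h3, h4⟩ := root_costs h hW h.inner_root hL
  have hsum : ∑ w ∈ Finset.Ioo 0 (n - 1), ω w ≤ ∑ w ∈ Finset.range n, ω w :=
    Finset.sum_le_sum_of_subset fun w hw => by
      simp only [Finset.mem_Ioo, Finset.mem_range] at *
      omega
  unfold budget at h3 h4
  rcases Nat.even_or_odd (earCount H 0 (n - 1)) with he | ho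
  · have := h4 he
    obtain ⟨k, hk⟩ := he
    omega
  · have := h3 ho
    obtain ⟨k, hk⟩ := ho
    omega

/-- The bound for a cycle. -/
theorem zeroForcingNumber_le_two (h : Layout G H n e) (hc : ∀ p q, Inner H p q → p = 0 ∧ q = n - 1) :
    zeroForcingNumber G ≤ 2 := by
  have h2 := h.zeroForcingNumber_le_absorbs
  obtain ⟨m, x, p⟩ := h.disk.exists_facePath h.inner_root
  have := (ear_costs h h.inner_root p fun i hi hin => by
    have h1 := hc _ _ hin
    have h2 := p.side_ne hi
    omega).2.2
  omega

end Layout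

end Root

/-! ### Cycles separate the faces of a planar embedding -/

section Chains

variable {V : Type*} [Fintype V] [DecidableEq V] {G : SimpleGraph V} [DecidableRel G.Adj]

theorem pi_add_self {ι : Type*} (f : ι → ZMod 2) : f + f = 0 :=
  funext fun _ => CharTwo.add_self_eq_zero _

/-- The edge of a dart. -/
def dartEdge (d : G.Dart) : G.edgeSet := ⟨d.edge, d.edge_mem⟩

theorem dartEdge_symm (d : G.Dart) : dartEdge d.symm = dartEdge d := Subtype.ext d.edge_symm

theorem dartEdge_eq_iff {d d' : G.Dart} : dartEdge d = dartEdge d' ↔ d = d' ∨ d = d'.symm := by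
  rw [dartEdge, dartEdge, Subtype.mk.injEq, SimpleGraph.dart_edge_eq_iff]

theorem exists_dartEdge (s : G.edgeSet) : ∃ d : G.Dart, dartEdge d = s := by
  obtain ⟨s, hs⟩ := s
  induction s using Sym2.ind with
  | _ a b => exact ⟨⟨(a, b), hs⟩, rfl⟩

theorem symm_ne_self (d : G.Dart) : d.symm ≠ d := SimpleGraph.Dart.symm_ne d

variable (G) in
/-- The boundary of a set of edges modulo two. -/
noncomputable def boundary : (G.edgeSet → ZMod 2) →ₗ[ZMod 2] V → ZMod 2 where
  toFun c v := ∑ d : G.Dart, if d.fst = v then c (dartEdge d) else 0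
  map_add' c c' := by
    ext v
    simp only [Pi.add_apply, ← Finset.sum_add_distrib]
    exact Finset.sum_congr rfl fun d _ => by split_ifs <;> simp
  map_smul' r c := by
    ext v
    simp only [Pi.smul_apply, smul_eq_mul, RingHom.id_apply, Finset.mul_sum]
    exact Finset.sum_congr rfl fun d _ => by split_ifs <;> simp

theorem boundary_apply (c : G.edgeSet → ZMod 2) (v : V) :
    boundary G c v = ∑ d : G.Dart, if d.fst = v then c (dartEdge d) else 0 := rfl

theorem boundary_single [DecidableEq G.edgeSet] (d : G.Dart) :
    boundary G (Pi.single (dartEdge d) 1) = Pi.single d.fst 1 + Pi.single d.snd 1 := by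
  ext v
  rw [boundary_apply]
  have : ∀ d' : G.Dart, (if d'.fst = v then
      (Pi.single (dartEdge d) 1 : G.edgeSet → ZMod 2) (dartEdge d') else 0) =
      (if d' = d then (if d.fst = v then 1 else 0) else 0) +
        (if d' = d.symm then (if d.snd = v then 1 else 0) else 0) := by
    intro d'
    rw [Pi.single_apply]
    by_cases h1 : d' = d
    · subst h1
      simp [(symm_ne_self d').symm]
    · by_cases h2 : d' = d.symm
      · subst h2
        simp [symm_ne_self d, dartEdge_symm]
      · have : ¬ dartEdge d' = dartEdge d := by rw [dartEdge_eq_iff]; tauto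
        simp [h1, h2, this]
  rw [Finset.sum_congr rfl fun d' _ => this d', Finset.sum_add_distrib]
  simp [Pi.single_apply, eq_comm]

/-- The edges of a walk, modulo two. -/
theorem exists_chain_of_walk {a b : V} (w : G.Walk a b) : ∃ c : G.edgeSet → ZMod 2,
    boundary G c = Pi.single a 1 + Pi.single b 1 ∧ ∀ s : G.edgeSet, (s : Sym2 V) ∉ w.edges → c s = 0 := by
  classical
  induction w with
  | nil => exact ⟨0, by rw [map_zero]; exact (pi_add_self _).symm, fun _ _ => rfl⟩
  | @cons a b c' h w ih =>
    obtain ⟨c, h1, h2⟩ := ih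
    refine ⟨Pi.single (dartEdge ⟨(a, b), h⟩) 1 + c, ?_, fun s hs => ?_⟩
    · rw [map_add, boundary_single, h1, ← add_assoc,
        add_assoc (Pi.single a 1) (Pi.single b 1) (Pi.single b 1), pi_add_self, add_zero]
    · rw [SimpleGraph.Walk.edges_cons, List.mem_cons, not_or] at hs
      rw [Pi.add_apply, h2 s hs.2, Pi.single_eq_of_ne (by
        rintro rfl
        exact hs.1 rfl), add_zero]

namespace RotationSystem

variable (R : RotationSystem G)

theorem faceOf_facePerm (d : G.Dart) : R.faceOf (R.facePerm d) = R.faceOf d :=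
  Quotient.sound (s := Equiv.Perm.SameCycle.setoid R.facePerm)
    ((Equiv.Perm.sameCycle_apply_left).2 (Equiv.Perm.SameCycle.refl _ _))

theorem facePerm_apply (d : G.Dart) : R.facePerm d = R.rot d.symm := rfl

theorem faceOf_rot (d : G.Dart) : R.faceOf (R.rot d) = R.faceOf d.symm := by
  have := R.faceOf_facePerm d.symm
  rwa [facePerm_apply, SimpleGraph.Dart.symm_symm] at this

theorem exists_faceOf (f : R.Face) : ∃ d, R.faceOf d = f := Quotient.exists_rep f

instance : Finite R.Face := Quotient.finite _

noncomputable instance : Fintype R.Face := Fintype.ofFinite _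

/-- The edges at which a function on the faces changes. -/
noncomputable def jump : (R.Face → ZMod 2) →ₗ[ZMod 2] G.edgeSet → ZMod 2 where
  toFun g s := g (R.faceOf (exists_dartEdge s).choose) + g (R.faceOf (exists_dartEdge s).choose.symm)
  map_add' g g' := by
    ext s
    simp only [Pi.add_apply]
    ring
  map_smul' r g := by
    ext s
    simp only [Pi.smul_apply, smul_eq_mul, RingHom.id_apply]
    ring

theorem jump_apply (g : R.Face → ZMod 2) (d : G.Dart) :
    R.jump g (dartEdge d) = g (R.faceOf d) + g (R.faceOf d.symm) := by
  have h := (exists_dartEdge (dartEdge d)).choose_spec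
  rw [dartEdge_eq_iff] at h
  change g (R.faceOf (exists_dartEdge (dartEdge d)).choose) +
    g (R.faceOf (exists_dartEdge (dartEdge d)).choose.symm) = _
  rcases h with h | h
  · rw [h]
  · rw [h, SimpleGraph.Dart.symm_symm, add_comm]

/-- Around a vertex, the second face of each dart is the first face of the next, so every value
occurs twice. -/
theorem boundary_jump (g : R.Face → ZMod 2) : boundary G (R.jump g) = 0 := by
  ext v
  rw [boundary_apply, Pi.zero_apply]
  have h1 : ∀ d : G.Dart, (if d.fst = v then R.jump g (dartEdge d) else 0) =
      (if d.fst = v then g (R.faceOf d) else 0) +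
        (if (R.rot d).fst = v then g (R.faceOf (R.rot d)) else 0) := by
    intro d
    rw [R.rot_fst, R.faceOf_rot, jump_apply]
    split_ifs <;> simp
  rw [Finset.sum_congr rfl fun d _ => h1 d, Finset.sum_add_distrib,
    Equiv.sum_comp R.rot fun d => if d.fst = v then g (R.faceOf d) else 0]
  exact CharTwo.add_self_eq_zero _

theorem eq_of_jump_eq_zero (hG : G.Connected) {g : R.Face → ZMod 2} (hg : R.jump g = 0)
    (d d' : G.Dart) : g (R.faceOf d) = g (R.faceOf d') := by
  have hs : ∀ d, g (R.faceOf d.symm) = g (R.faceOf d) := fun d => by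
    have := congrFun hg (dartEdge d)
    rw [jump_apply, Pi.zero_apply] at this
    exact (CharTwo.add_eq_zero.1 this).symm
  have hr : ∀ d, g (R.faceOf (R.rot d)) = g (R.faceOf d) := fun d => by
    rw [R.faceOf_rot, hs]
  have hz : ∀ (k : ℕ) d, g (R.faceOf ((R.rot ^ k) d)) = g (R.faceOf d) := by
    intro k
    induction k with
    | zero => intro d; rfl
    | succ k ih => intro d; rw [pow_succ, Equiv.Perm.mul_apply, ih, hr]
  have hv : ∀ d d' : G.Dart, d.fst = d'.fst → g (R.faceOf d) = g (R.faceOf d') := by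
    intro d d' h
    obtain ⟨k, hk⟩ := (R.rot_sameCycle d d' h).exists_nat_pow_eq
    rw [← hk, hz]
  have hw : ∀ {a b : V} (_ : G.Walk a b) (d d' : G.Dart), d.fst = a → d'.fst = b →
      g (R.faceOf d) = g (R.faceOf d') := by
    intro a b w
    induction w with
    | nil => exact fun d d' h h' => hv d d' (h.trans h'.symm)
    | @cons a b c h w ih =>
      intro d d' hd hd'
      rw [hv d ⟨(a, b), h⟩ hd, ← hs]
      exact ih _ _ rfl hd'
  obtain ⟨w⟩ := hG.preconnected d.fst d'.fst
  exact hw w d d' rfl rfl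

/-- A function without jumps is constant around each vertex and across each edge, hence constant by
connectedness. -/
theorem finrank_ker_jump_le (hG : G.Connected) (d : G.Dart) :
    Module.finrank (ZMod 2) (LinearMap.ker R.jump) ≤ 1 := by
  have : LinearMap.ker R.jump ≤ Submodule.span (ZMod 2) {fun _ => 1} := by
    intro g hg
    rw [Submodule.mem_span_singleton]
    refine ⟨g (R.faceOf d), ?_⟩
    ext f
    obtain ⟨d', rfl⟩ := R.exists_faceOf f
    simpa using R.eq_of_jump_eq_zero hG hg d d'
  exact (Submodule.finrank_mono this).trans
    ((finrank_span_le_card _).trans (by simp))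

/-- Boundaries of walks to a fixed vertex span everything up to that vertex. -/
theorem le_finrank_range_boundary (hG : G.Connected) :
    Fintype.card V ≤ Module.finrank (ZMod 2) (LinearMap.range (boundary G)) + 1 := by
  obtain ⟨v⟩ := hG.nonempty
  have : (⊤ : Submodule (ZMod 2) (V → ZMod 2)) ≤
      LinearMap.range (boundary G) ⊔ Submodule.span (ZMod 2) {Pi.single v 1} := by
    intro f _
    have hf : f = ∑ w, f w • (Pi.single w 1 : V → ZMod 2) := by
      ext w
      simp [Finset.sum_apply, Pi.single_apply]
    rw [hf]
    refine Submodule.sum_mem _ fun w _ => Submodule.smul_mem _ _ ?_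
    obtain ⟨p⟩ := hG.preconnected w v
    obtain ⟨c, hc, -⟩ := exists_chain_of_walk p
    have : (Pi.single w 1 : V → ZMod 2) = boundary G c + Pi.single v 1 := by
      rw [hc, add_assoc, pi_add_self, add_zero]
    rw [this]
    exact Submodule.add_mem_sup ⟨c, rfl⟩ (Submodule.mem_span_singleton_self _)
  have h1 := Submodule.finrank_mono this
  have h2 := Submodule.finrank_add_le_finrank_add_finrank (LinearMap.range (boundary G))
    (Submodule.span (ZMod 2) {(Pi.single v 1 : V → ZMod 2)})
  have h3 : Module.finrank (ZMod 2) (Submodule.span (ZMod 2) {(Pi.single v 1 : V → ZMod 2)}) ≤ 1 :=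
    (finrank_span_le_card _).trans (by simp)
  rw [finrank_top, Module.finrank_fintype_fun_eq_card] at h1
  omega

/-- Every closed chain separates the faces into two classes. -/
theorem exists_jump_eq (hG : G.Connected) (hR : R.IsPlanar) (d : G.Dart) {z : G.edgeSet → ZMod 2}
    (hz : boundary G z = 0) : ∃ g : R.Face → ZMod 2, R.jump g = z := by
  have hle : LinearMap.range R.jump ≤ LinearMap.ker (boundary G) := by
    rintro _ ⟨g, rfl⟩
    exact R.boundary_jump g
  have h1 := LinearMap.finrank_range_add_finrank_ker R.jump
  have h2 := LinearMap.finrank_range_add_finrank_ker (boundary G)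
  have h3 := R.finrank_ker_jump_le hG d
  have h4 := le_finrank_range_boundary hG
  rw [Module.finrank_fintype_fun_eq_card] at h1 h2
  unfold IsPlanar at hR
  rw [Nat.card_eq_fintype_card, Nat.card_eq_fintype_card, Nat.card_eq_fintype_card] at hR
  -- The cycle space has dimension at most `|E| - |V| + 1`, the jumps at least `|F| - 1`. Euler's
  -- formula makes these equal.
  have := Submodule.eq_of_le_of_finrank_le hle (by omega)
  have hz' : z ∈ LinearMap.range R.jump := this ▸ hz
  exact hz'

/-- Turning around a vertex from `d` to `d'`, the only edges of a chain met on the way being those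
of `d` and, at the end of the turn, `d'`. -/
theorem turn (g : R.Face → ZMod 2) {d d' : G.Dart} (hne : d ≠ d') (hfst : d.fst = d'.fst)
    (h : ∀ c : G.Dart, c.fst = d.fst → c ≠ d → c ≠ d' → R.rot c ≠ d → R.jump g (dartEdge c) = 0) :
    g (R.faceOf d') = g (R.faceOf d) + R.jump g (dartEdge d) := by
  have hstep : ∀ c : G.Dart, g (R.faceOf (R.rot c)) = g (R.faceOf c) + R.jump g (dartEdge c) := by
    intro c
    rw [R.faceOf_rot, jump_apply, ← add_assoc, CharTwo.add_self_eq_zero, zero_add]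
  -- The least number of turns from `d` to `d'`: on the way neither dart is met again, so only the
  -- edge of `d` can be crossed with a jump.
  have hex := (R.rot_sameCycle d d' hfst).exists_nat_pow_eq
  have hspec := Nat.find_spec hex
  have hmin := fun j => Nat.find_min (m := j) hex
  generalize Nat.find hex = k at hspec hmin
  have hfix : ∀ j, 1 ≤ j → j ≤ k → (R.rot ^ j) d ≠ d := by
    intro j h1 h2 h3
    refine hmin (k - j) (by omega) ?_
    rw [← hspec, show k = (k - j) + j by omega, pow_add, Equiv.Perm.mul_apply, h3,
      Nat.add_sub_cancel]
  have key : ∀ j, 1 ≤ j → j ≤ k → g (R.faceOf ((R.rot ^ j) d)) =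
      g (R.faceOf d) + R.jump g (dartEdge d) := by
    intro j hj
    induction j, hj using Nat.le_induction with
    | base => intro _; rw [pow_one, hstep]
    | succ j hj ih =>
      intro hjk
      rw [pow_succ', Equiv.Perm.mul_apply, hstep, ih (by omega), h ((R.rot ^ j) d), add_zero]
      · have : ∀ j : ℕ, ((R.rot ^ j) d).fst = d.fst := by
          intro j
          induction j with
          | zero => rfl
          | succ j ih => rw [pow_succ', Equiv.Perm.mul_apply, R.rot_fst, ih]
        exact this j
      · exact hfix j hj (by omega)
      · exact hmin j (by omega)
      · have := hfix (j + 1) (by omega) hjk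
        rwa [pow_succ', Equiv.Perm.mul_apply] at this
  have hk : 1 ≤ k := by
    by_contra hc
    obtain rfl : k = 0 := by omega
    exact hne hspec
  rw [← hspec]
  exact key k hk le_rfl

end RotationSystem

end Chains

/-! ### The outer cycle -/

section Tour

variable {V : Type*} [Fintype V] [DecidableEq V] {G : SimpleGraph V} [DecidableRel G.Adj]

theorem dart_ext {d d' : G.Dart} (h1 : d.fst = d'.fst) (h2 : d.snd = d'.snd) : d = d' :=
  SimpleGraph.Dart.ext _ _ (Prod.ext h1 h2)

theorem IsKConnected.connected {k : ℕ} (hG : IsKConnected G k) (hk : 0 < k) : G.Connected := by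
  have := hG.2 ∅ (by simpa using hk)
  rw [Set.compl_empty] at this
  exact (SimpleGraph.induceUnivIso G).connected_iff.1 this

/-- In a 2-connected graph a face has at most one dart at each vertex. -/
theorem RotationSystem.eq_of_faceOf_eq (R : RotationSystem G) (hG : IsKConnected G 2)
    (hR : R.IsPlanar) {d d' : G.Dart} (hfst : d.fst = d'.fst) (hface : R.faceOf d = R.faceOf d') :
    d = d' := by
  classical
  by_contra hne
  have hconn := hG.2 {d.fst} (by simp)
  have ha : d.snd ∈ ({d.fst}ᶜ : Set V) := fun h => d.adj.ne (Set.mem_singleton_iff.1 h).symm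
  have hb : d'.snd ∈ ({d.fst}ᶜ : Set V) := fun h =>
    d'.adj.ne ((Set.mem_singleton_iff.1 h).trans hfst).symm
  obtain ⟨w⟩ := hconn.preconnected ⟨_, ha⟩ ⟨_, hb⟩
  let w' := w.map (SimpleGraph.Embedding.induce (G := G) {d.fst}ᶜ).toHom
  have hw' : ∀ v ∈ w'.support, v ≠ d.fst := by
    rintro v h rfl
    rw [SimpleGraph.Walk.support_map] at h
    obtain ⟨x, -, hx⟩ := List.mem_map.1 h
    exact x.2 hx
  obtain ⟨c, hc, hc0⟩ := exists_chain_of_walk w'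
  -- Two-connectedness joins the far ends of both darts by a walk avoiding the common vertex. With
  -- the two edges it forms a closed chain.
  have hz : boundary G (Pi.single (dartEdge d) 1 + Pi.single (dartEdge d') 1 + c) = 0 := by
    rw [map_add, map_add, boundary_single, boundary_single, hc, ← hfst]
    change Pi.single d.fst 1 + Pi.single d.snd 1 + (Pi.single d.fst 1 + Pi.single d'.snd 1) +
      (Pi.single d.snd 1 + Pi.single d'.snd 1) = (0 : V → ZMod 2)
    have h1 := pi_add_self (Pi.single d.fst 1 : V → ZMod 2)
    have h2 := pi_add_self (Pi.single d.snd 1 : V → ZMod 2)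
    have h3 := pi_add_self (Pi.single d'.snd 1 : V → ZMod 2)
    linear_combination h1 + h2 + h3
  obtain ⟨g, hg⟩ := R.exists_jump_eq (hG.connected two_pos) hR d hz
  have hc' : ∀ k : G.Dart, k.fst = d.fst → c (dartEdge k) = 0 := fun k hk =>
    hc0 _ fun h => hw' _ (w'.fst_mem_support_of_mem_edges h) hk
  have hsymm : ∀ k k' : G.Dart, k.fst = k'.fst → k ≠ k' → dartEdge k ≠ dartEdge k' := by
    intro k k' h1 h2 h3
    rcases dartEdge_eq_iff.1 h3 with h | h
    · exact h2 h
    · rw [h] at h1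
      exact k'.adj.ne h1.symm
  -- Turning from `d` to `d'` crosses the chain once, so the two darts cannot lie on the same face.
  have key := R.turn g hne hfst fun k hk h1 h2 _ => by
    rw [hg, Pi.add_apply, Pi.add_apply, hc' k hk, Pi.single_eq_of_ne (hsymm k d hk h1),
      Pi.single_eq_of_ne (hsymm k d' (hk.trans hfst) h2)]
    simp
  rw [hg, Pi.add_apply, Pi.add_apply, hc' d rfl, Pi.single_eq_same,
    Pi.single_eq_of_ne (hsymm d d' hfst hne), hface] at key
  simp at key

/-- The darts of a face in their order, one at each vertex. -/
structure Tour (R : RotationSystem G) (out : R.Face) (n : ℕ) (o : ℕ → G.Dart) : Prop where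
  three_le : 3 ≤ n
  face : ∀ t, R.faceOf (o t) = out
  succ : ∀ t, o (t + 1) = R.facePerm (o t)
  period : ∀ t, o (t + n) = o t
  inj : ∀ i < n, ∀ j < n, (o i).fst = (o j).fst → i = j
  surj : ∀ w, ∃ i < n, (o i).fst = w
  mem : ∀ d, R.faceOf d = out → ∃ i < n, o i = d

/-- A face that is incident to all vertices gives a tour starting at any of its darts. -/
theorem RotationSystem.exists_tour (R : RotationSystem G) (hG : IsKConnected G 2)
    (hR : R.IsPlanar) {out : R.Face} (hout : R.faceVertices out = Set.univ) {d : G.Dart}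
    (hd : R.faceOf d = out) :
    Tour R out (Fintype.card V) fun t => (R.facePerm)^[t] d := by
  have hface : ∀ t, R.faceOf ((R.facePerm)^[t] d) = out := by
    intro t
    induction t with
    | zero => exact hd
    | succ t ih => rw [Function.iterate_succ_apply', R.faceOf_facePerm, ih]
  have hmem : ∀ d', R.faceOf d' = out → ∃ i < Function.minimalPeriod R.facePerm d,
      (R.facePerm)^[i] d = d' := by
    intro d' hd'
    have : R.facePerm.SameCycle d d' := Quotient.exact (s := Equiv.Perm.SameCycle.setoid R.facePerm)
      (hd.trans hd'.symm)
    obtain ⟨k, hk⟩ := this.exists_nat_pow_eq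
    rw [Equiv.Perm.coe_pow] at hk
    refine ⟨k % Function.minimalPeriod R.facePerm d, Nat.mod_lt _ ?_, ?_⟩
    · exact Function.minimalPeriod_pos_of_mem_periodicPts
        (Function.Injective.mem_periodicPts R.facePerm.injective d)
    · rw [Function.iterate_mod_minimalPeriod_eq, hk]
  have hinj : ∀ i < Function.minimalPeriod R.facePerm d, ∀ j < Function.minimalPeriod R.facePerm d,
      ((R.facePerm)^[i] d).fst = ((R.facePerm)^[j] d).fst → i = j := by
    intro i hi j hj hij
    have := R.eq_of_faceOf_eq hG hR hij ((hface i).trans (hface j).symm)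
    exact Function.iterate_injOn_Iio_minimalPeriod hi hj this
  have hsurj : ∀ w, ∃ i < Function.minimalPeriod R.facePerm d, ((R.facePerm)^[i] d).fst = w := by
    intro w
    obtain ⟨d', h1, h2⟩ : w ∈ R.faceVertices out := hout ▸ Set.mem_univ w
    obtain ⟨i, hi, h3⟩ := hmem d' h1
    exact ⟨i, hi, by rw [h3, h2]⟩
  -- One period of the face permutation meets every vertex exactly once.
  have hn : Function.minimalPeriod R.facePerm d = Fintype.card V := by
    rw [← Fintype.card_fin (Function.minimalPeriod R.facePerm d)]
    refine Fintype.card_of_bijective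
      (f := fun i : Fin (Function.minimalPeriod R.facePerm d) => ((R.facePerm)^[i] d).fst)
      ⟨fun i j hij => Fin.ext (hinj i i.2 j j.2 hij), fun w => ?_⟩
    obtain ⟨i, hi, h⟩ := hsurj w
    exact ⟨⟨i, hi⟩, h⟩
  have h3 := hG.1
  rw [Nat.card_eq_fintype_card] at h3
  rw [← hn] at h3 ⊢
  exact ⟨h3, hface, fun t => Function.iterate_succ_apply' _ _ _, fun t => by
    rw [Function.iterate_add_apply, Function.iterate_minimalPeriod], hinj, hsurj, hmem⟩

namespace Tour

variable {R : RotationSystem G} {out : R.Face} {n : ℕ} {o : ℕ → G.Dart}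

theorem snd_eq (T : Tour R out n o) (t : ℕ) : (o t).snd = (o (t + 1)).fst := by
  rw [T.succ, R.facePerm_apply, R.rot_fst]
  rfl

theorem rot_symm (T : Tour R out n o) (t : ℕ) : R.rot (o t).symm = o (t + 1) := by
  rw [T.succ, R.facePerm_apply]

theorem fst_zero (T : Tour R out n o) : (o n).fst = (o 0).fst := by
  have := T.period 0
  rw [zero_add] at this
  rw [this]

/-- The graph on the numbers of the vertices along the tour. -/
def graph (n : ℕ) (o : ℕ → G.Dart) : SimpleGraph ℕ where
  Adj i j := i < n ∧ j < n ∧ G.Adj (o i).fst (o j).fst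
  symm := ⟨fun _ _ h => ⟨h.2.1, h.1, h.2.2.symm⟩⟩
  loopless := ⟨fun _ h => G.loopless.irrefl _ h.2.2⟩

theorem graph_step (T : Tour R out n o) {i : ℕ} (hi : i + 1 < n) :
    (graph n o).Adj i (i + 1) :=
  ⟨by omega, hi, by rw [← T.snd_eq]; exact (o i).adj⟩

theorem graph_root (T : Tour R out n o) : (graph n o).Adj 0 (n - 1) := by
  have := T.three_le
  refine ⟨by omega, by omega, ?_⟩
  have h := (o (n - 1)).adj
  rw [T.snd_eq, show n - 1 + 1 = n by omega, T.fst_zero] at h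
  exact h.symm

theorem inner_root (T : Tour R out n o) : Inner (graph n o) 0 (n - 1) :=
  ⟨T.graph_root, by have := T.three_le; omega⟩

/-- A vertex number determines the number of its successor. -/
theorem succ_cases (T : Tour R out n o) {i j : ℕ} (hi : i < n) (hj : j < n)
    (h : (o (i + 1)).fst = (o j).fst) : j = i + 1 ∨ (i + 1 = n ∧ j = 0) := by
  have := T.three_le
  rcases Nat.lt_or_ge (i + 1) n with h1 | h1
  · exact .inl (T.inj _ h1 _ hj h).symm
  · have h2 : i + 1 = n := by omega
    rw [h2, T.fst_zero] at h
    exact .inr ⟨h2, (T.inj _ (by omega) _ hj h).symm⟩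

theorem ne_symm (T : Tour R out n o) {i j : ℕ} (hi : i < n) (hj : j < n) : o i ≠ (o j).symm := by
  intro h
  have h3 := T.three_le
  have h1 : (o i).fst = (o (j + 1)).fst := by rw [h, ← T.snd_eq]; rfl
  have h2 : (o (i + 1)).fst = (o j).fst := by rw [← T.snd_eq, h]; rfl
  have h4 := T.succ_cases hj hi h1.symm
  have h5 := T.succ_cases hi hj h2
  omega

theorem dartEdge_inj (T : Tour R out n o) {i j : ℕ} (hi : i < n) (hj : j < n)
    (h : dartEdge (o i) = dartEdge (o j)) : i = j := by
  rcases dartEdge_eq_iff.1 h with h | h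
  · exact T.inj i hi j hj (by rw [h])
  · exact absurd h (T.ne_symm hi hj)

section Side

variable [DecidableEq G.edgeSet]

/-- The path along the tour from `p` to `q` together with the edge of `d`. -/
noncomputable def chord (o : ℕ → G.Dart) (p q : ℕ) (d : G.Dart) : G.edgeSet → ZMod 2 :=
  ∑ i ∈ Finset.Ico p q, Pi.single (dartEdge (o i)) 1 + Pi.single (dartEdge d) 1

theorem boundary_chord (T : Tour R out n o) {p q : ℕ} (hpq : p ≤ q) {d : G.Dart}
    (h1 : d.fst = (o p).fst) (h2 : d.snd = (o q).fst) : boundary G (chord o p q d) = 0 := by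
  have key : boundary G (∑ i ∈ Finset.Ico p q, Pi.single (dartEdge (o i)) 1) =
      Pi.single (o p).fst 1 + Pi.single (o q).fst 1 := by
    clear h2
    induction q, hpq using Nat.le_induction with
    | base => rw [Finset.Ico_self, Finset.sum_empty, map_zero, pi_add_self]
    | succ q hpq ih =>
      rw [Finset.sum_Ico_succ_top hpq, map_add, ih, boundary_single, T.snd_eq]
      have := pi_add_self (Pi.single (o q).fst 1 : V → ZMod 2)
      linear_combination this
  rw [chord, map_add, key, boundary_single, h1, h2, pi_add_self]

theorem chord_apply (o : ℕ → G.Dart) (p q : ℕ) (d d' : G.Dart) : chord o p q d (dartEdge d') =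
    (∑ i ∈ Finset.Ico p q, if dartEdge d' = dartEdge (o i) then 1 else 0) +
      if dartEdge d' = dartEdge d then 1 else 0 := by
  rw [chord, Pi.add_apply, Finset.sum_apply, Pi.single_apply]
  simp only [Pi.single_apply]

theorem chord_of_forall_ne {p q : ℕ} {d d' : G.Dart}
    (h : ∀ i, p ≤ i → i < q → dartEdge d' ≠ dartEdge (o i)) :
    chord o p q d (dartEdge d') = if dartEdge d' = dartEdge d then 1 else 0 := by
  rw [chord_apply, Finset.sum_eq_zero, zero_add]
  intro i hi
  have := Finset.mem_Ico.1 hi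
  exact if_neg (h i this.1 this.2)

theorem chord_tour (T : Tour R out n o) {p q t : ℕ} {d : G.Dart} (ht : t < n) (hp : p ≤ t)
    (hq : t < q) (hqn : q ≤ n) (hd : dartEdge (o t) ≠ dartEdge d) :
    chord o p q d (dartEdge (o t)) = 1 := by
  rw [chord_apply, if_neg hd, add_zero, Finset.sum_eq_single t, if_pos rfl]
  · intro i hi hit
    have := Finset.mem_Ico.1 hi
    exact if_neg fun h => hit (T.dartEdge_inj ht (by omega) h).symm
  · intro h
    exact absurd (Finset.mem_Ico.2 ⟨hp, hq⟩) h

end Side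

/-- The sides of the closed path formed by an inner edge `p q` and the tour from `p` to `q`. -/
structure Sides (R : RotationSystem G) (out : R.Face) (n : ℕ) (o : ℕ → G.Dart) (p q : ℕ)
    (I : R.Face → ZMod 2) : Prop where
  outer : I out = 0
  inside : ∀ t d, p < t → t < q → d.fst = (o t).fst → d ≠ o t → I (R.faceOf d) = 1
  outside : ∀ t d, t < n → (t < p ∨ q < t) → d.fst = (o t).fst → I (R.faceOf d) = 0
  chord : ∀ d : G.Dart, d.fst = (o p).fst → d.snd = (o q).fst → I (R.faceOf d) = 1
  chord_symm : ∀ d : G.Dart, d.fst = (o p).fst → d.snd = (o q).fst → I (R.faceOf d.symm) = 0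
  edge : ∀ t, p ≤ t → t < q → I (R.faceOf (o t).symm) = 1
  edge_outside : ∀ t, t + 1 < n → (t < p ∨ q ≤ t) → I (R.faceOf (o t).symm) = 0
  symm : ∀ a b (d : G.Dart), a < n → b < n → a + 2 ≤ b → d.fst = (o a).fst → d.snd = (o b).fst →
    (a ≠ p ∨ b ≠ q) → I (R.faceOf d.symm) = I (R.faceOf d)

/-- The inner edge closes the tour from `p` to `q` to a cycle; its two-coloring of the faces is
computed at each vertex by turning from the outer dart. -/
theorem exists_sides (T : Tour R out n o) (hG : IsKConnected G 2) (hR : R.IsPlanar) {p q : ℕ}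
    (hpq : Inner (graph n o) p q) : ∃ I, Sides R out n o p q I := by
  classical
  obtain ⟨⟨hp, hq, hadj⟩, hlt⟩ := hpq
  have h3 := T.three_le
  let d₀ : G.Dart := ⟨((o p).fst, (o q).fst), hadj⟩
  obtain ⟨g, hg⟩ := R.exists_jump_eq (hG.connected two_pos) hR d₀
    (T.boundary_chord (d := d₀) (p := p) (q := q) (by omega) rfl rfl)
  have hd₀ : ∀ d : G.Dart, dartEdge d = dartEdge d₀ →
      (d.fst = (o p).fst ∧ d.snd = (o q).fst) ∨ (d.fst = (o q).fst ∧ d.snd = (o p).fst) := by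
    intro d h
    rcases dartEdge_eq_iff.1 h with rfl | rfl
    exacts [.inl ⟨rfl, rfl⟩, .inr ⟨rfl, rfl⟩]
  have htd₀ : ∀ t, t + 1 < n → dartEdge (o t) ≠ dartEdge d₀ := by
    intro t ht h
    rcases hd₀ _ h with ⟨h1, h2⟩ | ⟨h1, h2⟩ <;> rw [T.snd_eq] at h2
    · have := T.inj t (by omega) p hp h1
      have := T.inj (t + 1) ht q hq h2
      omega
    · have := T.inj t (by omega) q hq h1
      have := T.inj (t + 1) ht p hp h2
      omega
  -- The two excluded darts at a vertex are its outgoing tour dart and the reverse of the incoming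
  -- one; any other jump comes from the chord.
  have hvert : ∀ t, t < n → ∀ d : G.Dart, d.fst = (o t).fst → d ≠ o t → R.rot d ≠ o t →
      R.jump g (dartEdge d) = if dartEdge d = dartEdge d₀ then 1 else 0 := by
    intro t ht d hd h1 h2
    rw [hg]
    refine chord_of_forall_ne fun i hi1 hi2 h => ?_
    rcases dartEdge_eq_iff.1 h with rfl | rfl
    · exact h1 (by rw [T.inj i (by omega) t ht hd])
    · have hi : (o (i + 1)).fst = (o t).fst := by rw [← hd, ← T.snd_eq]; rfl
      rw [T.rot_symm] at h2
      have := T.inj (i + 1) (by omega) t ht hi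
      rw [this] at h2
      exact h2 rfl
  have hnot : ∀ t, t < n → t ≠ p → t ≠ q → ∀ d : G.Dart, d.fst = (o t).fst →
      dartEdge d ≠ dartEdge d₀ := by
    intro t ht h1 h2 d hd h
    rcases hd₀ _ h with ⟨h4, -⟩ | ⟨h4, -⟩
    · exact h1 (T.inj t ht p hp (hd.symm.trans h4))
    · exact h2 (T.inj t ht q hq (hd.symm.trans h4))
  have hin : ∀ t, p ≤ t → t < q → R.jump g (dartEdge (o t)) = 1 := by
    intro t h1 h2
    rw [hg]
    exact T.chord_tour (by omega) h1 h2 (by omega) (htd₀ t (by omega))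
  have hout : ∀ t, t < n → (t < p ∨ q ≤ t) → dartEdge (o t) ≠ dartEdge d₀ →
      R.jump g (dartEdge (o t)) = 0 := by
    intro t ht h1 h2
    rw [hg, chord_of_forall_ne, if_neg h2]
    intro i hi1 hi2 h
    have := T.dartEdge_inj ht (by omega) h
    omega
  have hchord : ∀ d : G.Dart, d.fst = (o p).fst → d.snd = (o q).fst →
      g (R.faceOf d) = g out + 1 := by
    intro d h1 h2
    have hd : d = d₀ := dart_ext h1 h2
    subst hd
    have := R.turn g (d := o p) (d' := d₀) (fun h => htd₀ p (by omega) (by rw [h])) rfl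
      fun c h4 h5 h6 h7 => by
        rw [hvert p hp c h4 h5 h7, if_neg]
        intro h8
        rcases dartEdge_eq_iff.1 h8 with h9 | h9
        · exact h6 h9
        · rw [h9] at h4
          have := T.inj q hq p hp h4
          omega
    rw [this, T.face, hin p le_rfl (by omega)]
  have hjump : ∀ d : G.Dart, g (R.faceOf d.symm) = g (R.faceOf d) + R.jump g (dartEdge d) := by
    intro d
    rw [R.jump_apply, ← add_assoc, CharTwo.add_self_eq_zero, zero_add]
  -- The two-coloring is normalized to vanish on the outer face.
  refine ⟨fun f => g f + g out, CharTwo.add_self_eq_zero _, fun t d h1 h2 h4 h5 => ?_,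
    fun t d h1 h2 h4 => ?_, fun d h1 h2 => ?_, fun d h1 h2 => ?_, fun t h1 h2 => ?_,
    fun t h1 h2 => ?_, fun a b d ha hb hab h1 h2 h4 => ?_⟩
  · have := R.turn g h5.symm h4.symm fun c h6 h7 h8 h9 => by
      rw [hvert t (by omega) c h6 h7 h9, if_neg (hnot t (by omega) (by omega) (by omega) c h6)]
    rw [this, T.face, hin t h1.le h2, add_assoc, add_comm 1, ← add_assoc,
      CharTwo.add_self_eq_zero, zero_add]
  · by_cases h5 : d = o t
    · rw [h5, T.face]
      exact CharTwo.add_self_eq_zero _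
    · have := R.turn g (Ne.symm h5) h4.symm fun c h6 h7 h8 h9 => by
        rw [hvert t (by omega) c h6 h7 h9, if_neg (hnot t (by omega) (by omega) (by omega) c h6)]
      rw [this, T.face, hout t h1 (by omega) (hnot t h1 (by omega) (by omega) _ rfl), add_zero]
      exact CharTwo.add_self_eq_zero _
  · rw [hchord d h1 h2, add_assoc, add_comm 1, ← add_assoc, CharTwo.add_self_eq_zero, zero_add]
  · have hd : d = d₀ := dart_ext h1 h2
    rw [hjump, hchord d h1 h2, hg, chord_of_forall_ne, if_pos (by rw [hd])]
    · rw [add_assoc (g out), CharTwo.add_self_eq_zero, add_zero]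
      exact CharTwo.add_self_eq_zero _
    · intro i h4 h5 h6
      rw [hd] at h6
      exact htd₀ i (by omega) h6.symm
  · rw [hjump, T.face, hin t h1 h2, add_assoc, add_comm 1, ← add_assoc,
      CharTwo.add_self_eq_zero, zero_add]
  · rw [hjump, T.face, hout t (by omega) h2 (htd₀ t h1), add_zero]
    exact CharTwo.add_self_eq_zero _
  · rw [hjump, hg, chord_of_forall_ne, if_neg, add_zero]
    · intro h
      rcases hd₀ _ h with ⟨h6, h7⟩ | ⟨h6, h7⟩
      · have := T.inj a ha p hp (h1.symm.trans h6)
        have := T.inj b hb q hq (h2.symm.trans h7)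
        omega
      · have := T.inj a ha q hq (h1.symm.trans h6)
        have := T.inj b hb p hp (h2.symm.trans h7)
        omega
    · intro i hi1 hi2 h
      rcases dartEdge_eq_iff.1 h with h | h
      · have h6 := T.inj a ha i (by omega) (by rw [← h1, h])
        have h7 := T.inj b hb (i + 1) (by omega) (by rw [← h2, h, T.snd_eq])
        omega
      · have h6 := T.inj a ha (i + 1) (by omega) (by rw [← h1, h, ← T.snd_eq]; rfl)
        have h7 := T.inj b hb i (by omega) (by rw [← h2, h]; rfl)
        omega

end Tour

end Tour

/-! ### The bounded faces -/

/-- The edge `a b` is a side of the face with inner edge `u v`: this is the smallest inner edge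
over `a b`. -/
def Parent (H : SimpleGraph ℕ) (u v a b : ℕ) : Prop :=
  Inner H u v ∧ u ≤ a ∧ b ≤ v ∧ (a ≠ u ∨ b ≠ v) ∧
    ∀ r s, Inner H r s → r ≤ a → b ≤ s → (a ≠ r ∨ b ≠ s) → r ≤ u ∧ v ≤ s

theorem FacePath.parent_iff {H : SimpleGraph ℕ} {n u v m : ℕ} {x : ℕ → ℕ}
    (p : FacePath H u v m x) (D : Disk H n) (huv : Inner H u v) {a b : ℕ} (hab : H.Adj a b)
    (hlt : a < b) : Parent H u v a b ↔ ∃ i ≤ m, x i = a ∧ x (i + 1) = b := by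
  constructor
  · rintro ⟨-, h1, h2, h3, h4⟩
    obtain ⟨i, hi, h5, h6⟩ := p.cover a b hab h1 hlt h2 h3
    by_contra hc
    have hne : a ≠ x i ∨ b ≠ x (i + 1) := by
      by_contra hc'
      push Not at hc'
      exact hc ⟨i, hi, hc'.1.symm, hc'.2.symm⟩
    have := h4 (x i) (x (i + 1)) ⟨p.adj i hi, by omega⟩ h5 h6 hne
    have := p.side_ne hi
    have := p.mem_Icc (i := i) (by omega)
    have := p.mem_Icc (i := i + 1) (by omega)
    omega
  · rintro ⟨i, hi, rfl, rfl⟩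
    have a1 := p.mem_Icc (i := i) (by omega)
    have a2 := p.mem_Icc (i := i + 1) (by omega)
    refine ⟨huv, a1.1, a2.2, p.side_ne hi, fun r s hrs h1 h2 h3 => ?_⟩
    have hr := hrs.2
    by_cases hin : u ≤ r ∧ s ≤ v
    · by_contra hc
      obtain ⟨j, hj, h5, h6⟩ := p.cover r s hrs.1 hin.1 (by omega) hin.2 (by omega)
      have h7 := (p.le_iff (i := j) (j := i) (by omega) (by omega)).1 (by omega)
      have h8 := (p.le_iff (i := i + 1) (j := j + 1) (by omega) (by omega)).1 (by omega)
      obtain rfl : j = i := by omega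
      omega
    · have k1 := D.noncrossing r u s v
      have k2 := D.noncrossing u r v s
      by_contra hc
      by_cases c1 : r < u
      · exact k1 c1 (by omega) (by omega) hrs.1 huv.1
      · exact k2 (by omega) (by omega) (by omega) huv.1 hrs.1

section Faces

variable {V : Type*} [Fintype V] [DecidableEq V] {G : SimpleGraph V} [DecidableRel G.Adj]

namespace Tour

variable {R : RotationSystem G} {out : R.Face} {n : ℕ} {o : ℕ → G.Dart}

theorem eq_tour (T : Tour R out n o) {a b : ℕ} {d : G.Dart} (h1 : d.fst = (o a).fst)
    (h2 : d.snd = (o b).fst) (hab : b = a + 1 ∨ (a + 1 = n ∧ b = 0)) : d = o a := by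
  refine dart_ext h1 ?_
  rw [h2, T.snd_eq]
  rcases hab with rfl | ⟨rfl, rfl⟩
  exacts [rfl, T.fst_zero.symm]

theorem ne_tour (T : Tour R out n o) {a b : ℕ} (ha : a < n) (hb : b < n) {d : G.Dart}
    (h2 : d.snd = (o b).fst) (hab : b ≠ a + 1) (hab' : a + 1 ≠ n ∨ b ≠ 0) :
    d ≠ o a := by
  rintro rfl
  rw [T.snd_eq] at h2
  have := T.succ_cases ha hb h2
  omega

theorem disk (T : Tour R out n o) (hG : IsKConnected G 2) (hR : R.IsPlanar) :
    Disk (graph n o) n where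
  three_le := T.three_le
  lt _ _ h := h.1
  step _ hi := T.graph_step hi
  root := T.graph_root
  noncrossing i p j q h1 h2 h3 hij hpq := by
    obtain ⟨I, hI⟩ := T.exists_sides hG hR (p := i) (q := j) ⟨hij, by omega⟩
    obtain ⟨hp, hq, hadj⟩ := hpq
    let d : G.Dart := ⟨((o p).fst, (o q).fst), hadj⟩
    -- A crossing edge would have its faces inside as seen from `p` and outside as seen from `q`.
    have e1 := hI.inside p d h1 h2 rfl
      (T.ne_tour (b := q) hp hq rfl (by omega) (by omega))
    have e2 := hI.outside q d.symm hq (.inr h3) rfl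
    have e3 := hI.symm p q d hp hq (by omega) rfl rfl (by omega)
    rw [e1, e2] at e3
    exact zero_ne_one e3

/-- Read off at an end of `a b` other than `p` and `q`; noncrossing decides whether it is inside. -/
theorem sides_forward (T : Tour R out n o) (hG : IsKConnected G 2) (hR : R.IsPlanar) {p q : ℕ}
    {I : R.Face → ZMod 2} (hI : Sides R out n o p q I) (hpq : Inner (graph n o) p q) {a b : ℕ}
    (hab : Inner (graph n o) a b) {d : G.Dart} (h1 : d.fst = (o a).fst) (h2 : d.snd = (o b).fst) :
    I (R.faceOf d) = if p ≤ a ∧ b ≤ q then 1 else 0 := by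
  have D := T.disk hG hR
  have hlt := hab.2
  have hlt' := hpq.2
  have ha := hab.1.1
  have hb := hab.1.2.1
  have hq := hpq.1.2.1
  by_cases heq : a = p ∧ b = q
  · obtain ⟨rfl, rfl⟩ := heq
    rw [if_pos ⟨le_rfl, le_rfl⟩]
    exact hI.chord d h1 h2
  have hs := hI.symm a b d ha hb hlt h1 h2 (by omega)
  have k1 := D.noncrossing p a q b
  have k2 := D.noncrossing a p b q
  by_cases hin : p ≤ a ∧ b ≤ q
  · rw [if_pos hin]
    by_cases hpa : p < a
    · exact hI.inside a d hpa (by omega) h1 (T.ne_tour ha hb h2 (by omega) (by omega))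
    · rw [← hs]
      exact hI.inside b d.symm (by omega) (by omega) h2
        (T.ne_tour hb ha (b := a) h1 (by omega) (by omega))
  · rw [if_neg hin]
    by_cases hout : a < p ∨ q < a
    · exact hI.outside a d ha hout h1
    · rw [← hs]
      refine hI.outside b d.symm hb ?_ h2
      omega

theorem sides_backward (T : Tour R out n o) (hG : IsKConnected G 2) (hR : R.IsPlanar) {p q : ℕ}
    {I : R.Face → ZMod 2} (hI : Sides R out n o p q I) (hpq : Inner (graph n o) p q) {a b : ℕ}
    (hab : (graph n o).Adj a b) (hlt : a < b) {d : G.Dart} (h1 : d.fst = (o a).fst)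
    (h2 : d.snd = (o b).fst) :
    I (R.faceOf d.symm) = if p ≤ a ∧ b ≤ q ∧ (a ≠ p ∨ b ≠ q) then 1 else 0 := by
  have hb := hab.2.1
  have hlt' := hpq.2
  by_cases hab' : b = a + 1
  · have hd := T.eq_tour h1 h2 (.inl hab')
    rw [hd]
    split_ifs with h
    · exact hI.edge a h.1 (by omega)
    · exact hI.edge_outside a (by omega) (by omega)
  · have hin : Inner (graph n o) a b := ⟨hab, by omega⟩
    by_cases heq : a = p ∧ b = q
    · obtain ⟨rfl, rfl⟩ := heq
      rw [if_neg (by omega)]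
      exact hI.chord_symm d h1 h2
    · rw [hI.symm a b d hab.1 hb hin.2 h1 h2 (by omega), T.sides_forward hG hR hI hpq hin h1 h2]
      congr 1
      refine propext ⟨fun h => ⟨h.1, h.2, by omega⟩, fun h => ⟨h.1, h.2.1⟩⟩

open Classical in
/-- The face on the inner side of the edge `p q`. -/
noncomputable def innerFace (R : RotationSystem G) (out : R.Face) (n : ℕ) (o : ℕ → G.Dart)
    (e : ℕ × ℕ) : R.Face :=
  if h : Inner (graph n o) e.1 e.2 then R.faceOf ⟨((o e.1).fst, (o e.2).fst), h.1.2.2⟩ else out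

theorem innerFace_eq {p q : ℕ} (hpq : Inner (graph n o) p q) {d : G.Dart}
    (h1 : d.fst = (o p).fst) (h2 : d.snd = (o q).fst) :
    R.faceOf d = innerFace R out n o (p, q) := by
  rw [innerFace, dif_pos hpq]
  congr 1
  exact dart_ext h1 h2

theorem sides_innerFace (T : Tour R out n o) (hG : IsKConnected G 2) (hR : R.IsPlanar) {p q : ℕ}
    {I : R.Face → ZMod 2} (hI : Sides R out n o p q I) (hpq : Inner (graph n o) p q) {a b : ℕ}
    (hab : Inner (graph n o) a b) :
    I (innerFace R out n o (a, b)) = if p ≤ a ∧ b ≤ q then 1 else 0 := by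
  rw [← innerFace_eq (d := ⟨((o a).fst, (o b).fst), hab.1.2.2⟩) hab rfl rfl]
  exact T.sides_forward hG hR hI hpq hab rfl rfl

theorem innerFace_ne (T : Tour R out n o) (hG : IsKConnected G 2) (hR : R.IsPlanar) {p q : ℕ}
    (hpq : Inner (graph n o) p q) : innerFace R out n o (p, q) ≠ out := by
  obtain ⟨I, hI⟩ := T.exists_sides hG hR hpq
  intro h
  have := T.sides_innerFace hG hR hI hpq hpq
  rw [h, hI.outer, if_pos ⟨le_rfl, le_rfl⟩] at this
  exact zero_ne_one this

/-- The two-colorings recover which inner edges pass over a face, so equal faces have mutually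
nested edges. -/
theorem innerFace_inj (T : Tour R out n o) (hG : IsKConnected G 2) (hR : R.IsPlanar)
    {p q a b : ℕ} (hpq : Inner (graph n o) p q) (hab : Inner (graph n o) a b)
    (h : innerFace R out n o (p, q) = innerFace R out n o (a, b)) : p = a ∧ q = b := by
  have key : ∀ {p q a b : ℕ}, Inner (graph n o) p q → Inner (graph n o) a b →
      innerFace R out n o (p, q) = innerFace R out n o (a, b) → p ≤ a ∧ b ≤ q := by
    intro p q a b hpq hab h
    obtain ⟨I, hI⟩ := T.exists_sides hG hR hpq
    have h1 := T.sides_innerFace hG hR hI hpq hpq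
    rw [h, T.sides_innerFace hG hR hI hpq hab, if_pos (⟨le_rfl, le_rfl⟩ : p ≤ p ∧ q ≤ q)] at h1
    by_contra hc
    rw [if_neg hc] at h1
    exact zero_ne_one h1
  have h1 := key hpq hab h
  have h2 := key hab hpq h.symm
  omega

open Classical in
/-- The edges of the graph on the numbers. -/
noncomputable def edgePairs (n : ℕ) (o : ℕ → G.Dart) : Finset (ℕ × ℕ) :=
  (Finset.range n ×ˢ Finset.range n).filter fun e => e.1 < e.2 ∧ (graph n o).Adj e.1 e.2

open Classical in
/-- The inner edges. -/
noncomputable def innerEdges (n : ℕ) (o : ℕ → G.Dart) : Finset (ℕ × ℕ) :=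
  (Finset.range n ×ˢ Finset.range n).filter fun e => Inner (graph n o) e.1 e.2

theorem mem_edgePairs {e : ℕ × ℕ} :
    e ∈ edgePairs n o ↔ e.1 < e.2 ∧ (graph n o).Adj e.1 e.2 := by
  simp only [edgePairs, Finset.mem_filter, Finset.mem_product, Finset.mem_range]
  exact ⟨fun h => h.2, fun h => ⟨⟨h.2.1, h.2.2.1⟩, h⟩⟩

theorem mem_innerEdges {e : ℕ × ℕ} : e ∈ innerEdges n o ↔ Inner (graph n o) e.1 e.2 := by
  simp only [innerEdges, Finset.mem_filter, Finset.mem_product, Finset.mem_range]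
  exact ⟨fun h => h.2, fun h => ⟨⟨h.1.1, h.1.2.1⟩, h⟩⟩

theorem card_edgePairs (T : Tour R out n o) : (edgePairs n o).card = Fintype.card G.edgeSet := by
  rw [← SimpleGraph.edgeFinset_card]
  refine Finset.card_nbij (fun e => s((o e.1).fst, (o e.2).fst)) (fun e he => ?_) ?_ ?_
  · have he := mem_edgePairs.1 (Finset.mem_coe.1 he)
    simpa using he.2.2.2
  · rintro ⟨a, b⟩ h1 ⟨c, d⟩ h2 h
    have h1 := mem_edgePairs.1 (Finset.mem_coe.1 h1)
    have h2 := mem_edgePairs.1 (Finset.mem_coe.1 h2)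
    dsimp only at h1 h2 h
    rcases Sym2.eq_iff.1 h with ⟨h3, h4⟩ | ⟨h3, h4⟩
    · rw [T.inj a h1.2.1 c h2.2.1 h3, T.inj b h1.2.2.1 d h2.2.2.1 h4]
    · have := T.inj a h1.2.1 d h2.2.2.1 h3
      have := T.inj b h1.2.2.1 c h2.2.1 h4
      omega
  · intro s hs
    rw [Finset.mem_coe, SimpleGraph.mem_edgeFinset] at hs
    induction s using Sym2.ind with
    | _ v w =>
    obtain ⟨a, ha, rfl⟩ := T.surj v
    obtain ⟨b, hb, rfl⟩ := T.surj w
    rcases lt_trichotomy a b with h | rfl | h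
    · exact ⟨(a, b), Finset.mem_coe.2 (mem_edgePairs.2 ⟨h, ha, hb, hs⟩), rfl⟩
    · exact absurd hs (G.loopless.irrefl _)
    · exact ⟨(b, a), Finset.mem_coe.2 (mem_edgePairs.2 ⟨h, hb, ha, G.symm.symm _ _ hs⟩), Sym2.eq_swap⟩

theorem card_innerEdges (T : Tour R out n o) :
    (innerEdges n o).card + (n - 1) = Fintype.card G.edgeSet := by
  rw [← T.card_edgePairs]
  have h1 : edgePairs n o = innerEdges n o ∪ (Finset.range (n - 1)).image fun i => (i, i + 1) := by
    ext ⟨a, b⟩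
    rw [Finset.mem_union, mem_edgePairs, mem_innerEdges, Finset.mem_image]
    constructor
    · rintro ⟨h1, h2⟩
      by_cases h : b = a + 1
      · have := h2.2.1
        dsimp only at this
        exact .inr ⟨a, Finset.mem_range.2 (by omega), by rw [h]⟩
      · exact .inl ⟨h2, by dsimp only at *; omega⟩
    · rintro (⟨h1, h2⟩ | ⟨i, hi, h⟩)
      · exact ⟨by omega, h1⟩
      · obtain ⟨rfl, rfl⟩ := Prod.mk.inj h
        have := Finset.mem_range.1 hi
        exact ⟨Nat.lt_succ_self _, T.graph_step (by omega)⟩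
  rw [h1, Finset.card_union_of_disjoint, Finset.card_image_of_injective, Finset.card_range]
  · intro i j h
    exact (Prod.mk.inj h).1
  · rw [Finset.disjoint_left]
    rintro ⟨a, b⟩ h1 h2
    have h1 := (mem_innerEdges.1 h1).2
    obtain ⟨i, -, h⟩ := Finset.mem_image.1 h2
    obtain ⟨rfl, rfl⟩ := Prod.mk.inj h
    dsimp only at h1
    omega

theorem card_eq (T : Tour R out n o) : n = Fintype.card V := by
  rw [← Fintype.card_fin n]
  refine Fintype.card_of_bijective (f := fun i : Fin n => (o i).fst)
    ⟨fun i j hij => Fin.ext (T.inj i i.2 j j.2 hij), fun w => ?_⟩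
  obtain ⟨i, hi, h⟩ := T.surj w
  exact ⟨⟨i, hi⟩, h⟩

/-- Every bounded face lies on the inner side of an edge. -/
theorem exists_innerFace (T : Tour R out n o) (hG : IsKConnected G 2) (hR : R.IsPlanar)
    {f : R.Face} (hf : f ≠ out) : ∃ p q, Inner (graph n o) p q ∧ innerFace R out n o (p, q) = f := by
  classical
  have hsub : (innerEdges n o).image (innerFace R out n o) ⊆ Finset.univ.erase out := by
    intro f hf
    obtain ⟨⟨p, q⟩, he, rfl⟩ := Finset.mem_image.1 hf
    exact Finset.mem_erase.2 ⟨T.innerFace_ne hG hR (mem_innerEdges.1 he), Finset.mem_univ _⟩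
  have hcard : ((innerEdges n o).image (innerFace R out n o)).card = (innerEdges n o).card := by
    refine Finset.card_image_of_injOn ?_
    rintro ⟨a, b⟩ h1 ⟨c, d⟩ h2 h
    have := T.innerFace_inj hG hR (mem_innerEdges.1 h1) (mem_innerEdges.1 h2) h
    exact Prod.ext this.1 this.2
  have h1 := T.card_innerEdges
  have h2 := T.card_eq
  have h3 := T.three_le
  have hR' := hR
  unfold RotationSystem.IsPlanar at hR'
  rw [Nat.card_eq_fintype_card, Nat.card_eq_fintype_card, Nat.card_eq_fintype_card] at hR'
  -- The inner edges, all edges but `n - 1` of the tour, are by Euler's formula as many as the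
  -- bounded faces.
  have heq := Finset.eq_of_subset_of_card_le hsub (by
    rw [hcard, Finset.card_erase_of_mem (Finset.mem_univ _), Finset.card_univ]
    omega)
  have hmem : f ∈ Finset.univ.erase out := Finset.mem_erase.2 ⟨hf, Finset.mem_univ _⟩
  rw [← heq] at hmem
  obtain ⟨⟨p, q⟩, he, h⟩ := Finset.mem_image.1 hmem
  exact ⟨p, q, mem_innerEdges.1 he, h⟩

/-- The face on the outer side of an edge other than the root edge. -/
theorem faceOf_symm_iff (T : Tour R out n o) (hG : IsKConnected G 2) (hR : R.IsPlanar) {a b : ℕ}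
    (hab : (graph n o).Adj a b) (hlt : a < b) (hroot : a ≠ 0 ∨ b + 1 ≠ n) {d : G.Dart}
    (h1 : d.fst = (o a).fst) (h2 : d.snd = (o b).fst) {p q : ℕ} (hpq : Inner (graph n o) p q) :
    R.faceOf d.symm = innerFace R out n o (p, q) ↔ Parent (graph n o) p q a b := by
  have key : ∀ {p q}, Inner (graph n o) p q → R.faceOf d.symm = innerFace R out n o (p, q) →
      Parent (graph n o) p q a b := by
    intro p q hpq h
    -- Compare both descriptions of the face under every two-coloring: the inner edges strictly over
    -- `a b` are those over or equal to `p q`.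
    have h3 : ∀ r s, Inner (graph n o) r s →
        ((r ≤ a ∧ b ≤ s ∧ (a ≠ r ∨ b ≠ s)) ↔ (r ≤ p ∧ q ≤ s)) := by
      intro r s hrs
      obtain ⟨I, hI⟩ := T.exists_sides hG hR hrs
      have e1 := T.sides_innerFace hG hR hI hrs hpq
      rw [← h, T.sides_backward hG hR hI hrs hab hlt h1 h2] at e1
      split_ifs at e1 with c1 c2 c2
      · exact iff_of_true c1 c2
      · exact absurd e1 one_ne_zero
      · exact absurd e1 zero_ne_one
      · exact iff_of_false c1 c2
    have h4 := (h3 p q hpq).2 ⟨le_rfl, le_rfl⟩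
    exact ⟨hpq, h4.1, h4.2.1, h4.2.2, fun r s hrs g1 g2 g3 => (h3 r s hrs).1 ⟨g1, g2, g3⟩⟩
  refine ⟨key hpq, fun h => ?_⟩
  -- For the converse, the face is bounded, hence some inner face; that one is a parent too, and
  -- parents are unique.
  have hne : R.faceOf d.symm ≠ out := by
    intro h'
    obtain ⟨i, hi, e⟩ := T.mem _ h'
    have hib : i = b := T.inj i hi b hab.2.1 (by rw [e]; exact h2)
    subst hib
    exact T.ne_tour (d := d.symm) (b := a) hi hab.1 h1 (by omega) (by omega) e.symm
  obtain ⟨p', q', hpq', e⟩ := T.exists_innerFace hG hR hne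
  have h' := key hpq' e.symm
  have g1 := h.2.2.2.2 p' q' hpq' h'.2.1 h'.2.2.1 h'.2.2.2.1
  have g2 := h'.2.2.2.2 p q hpq h.2.1 h.2.2.1 h.2.2.2.1
  obtain rfl : p = p' := by omega
  obtain rfl : q = q' := by omega
  exact e.symm

/-- The face of a dart that is not on the outer face. -/
theorem faceOf_cases (T : Tour R out n o) (hG : IsKConnected G 2) (hR : R.IsPlanar) {d : G.Dart}
    {p q : ℕ} (hpq : Inner (graph n o) p q) (hd : R.faceOf d = innerFace R out n o (p, q)) :
    (d.fst = (o p).fst ∧ d.snd = (o q).fst) ∨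
      ∃ a b, (graph n o).Adj a b ∧ a < b ∧ (a ≠ 0 ∨ b + 1 ≠ n) ∧ d.fst = (o b).fst ∧
        d.snd = (o a).fst ∧ Parent (graph n o) p q a b := by
  obtain ⟨a, ha, h1⟩ := T.surj d.fst
  obtain ⟨b, hb, h2⟩ := T.surj d.snd
  have hadj : G.Adj (o a).fst (o b).fst := by rw [h1, h2]; exact d.adj
  have hout : d ≠ o a := by
    intro h
    refine T.innerFace_ne hG hR hpq ?_
    rw [← hd, h, T.face]
  have hne : ¬ (b = a + 1 ∨ (a + 1 = n ∧ b = 0)) := fun h => hout (T.eq_tour h1.symm h2.symm h)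
  rcases lt_trichotomy a b with h | rfl | h
  · have hin : Inner (graph n o) a b := ⟨⟨ha, hb, hadj⟩, by omega⟩
    rw [innerFace_eq (out := out) hin h1.symm h2.symm] at hd
    obtain ⟨rfl, rfl⟩ := T.innerFace_inj hG hR hin hpq hd
    exact .inl ⟨h1.symm, h2.symm⟩
  · exact absurd hadj (G.loopless.irrefl _)
  · have hadj' : (graph n o).Adj b a := ⟨hb, ha, hadj.symm⟩
    refine .inr ⟨b, a, hadj', h, by omega, h1.symm, h2.symm, ?_⟩
    refine (T.faceOf_symm_iff hG hR hadj' h (by omega) (d := d.symm) h2.symm h1.symm hpq).1 ?_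
    rw [SimpleGraph.Dart.symm_symm, hd]

/-- The faces on the two sides of an edge. -/
theorem exists_dart_iff (T : Tour R out n o) (hG : IsKConnected G 2) (hR : R.IsPlanar)
    {u v p q : ℕ} (huv : Inner (graph n o) u v) (hpq : Inner (graph n o) p q) :
    (∃ d : G.Dart, R.faceOf d = innerFace R out n o (u, v) ∧
      R.faceOf d.symm = innerFace R out n o (p, q)) ↔
      Parent (graph n o) u v p q ∨ Parent (graph n o) p q u v := by
  have hroot : ∀ {u v p q}, Inner (graph n o) p q → Parent (graph n o) u v p q →
      p ≠ 0 ∨ q + 1 ≠ n := by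
    intro u v p q hpq h
    have h1 := h.1.1.2.1
    have h2 := h.2
    have := hpq.1.2.1
    omega
  constructor
  · rintro ⟨d, h1, h2⟩
    rcases T.faceOf_cases hG hR huv h1 with ⟨e1, e2⟩ | ⟨a, b, hab, hlt, hr, e1, e2, hp⟩
    · rcases T.faceOf_cases hG hR hpq h2 with ⟨f1, f2⟩ | ⟨c, d, hcd, hlt', hr', f1, f2, hp'⟩
      · have g1 := T.inj v huv.1.2.1 p hpq.1.1 (e2.symm.trans f1)
        have g2 := T.inj u huv.1.1 q hpq.1.2.1 (e1.symm.trans f2)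
        have := huv.2
        have := hpq.2
        omega
      · have g1 := T.inj v huv.1.2.1 d hcd.2.1 (e2.symm.trans f1)
        have g2 := T.inj u huv.1.1 c hcd.1 (e1.symm.trans f2)
        subst g1 g2
        exact .inr hp'
    · rcases T.faceOf_cases hG hR hpq h2 with ⟨f1, f2⟩ | ⟨c, d, hcd, hlt', hr', f1, f2, hp'⟩
      · have g1 := T.inj a hab.1 p hpq.1.1 (e2.symm.trans f1)
        have g2 := T.inj b hab.2.1 q hpq.1.2.1 (e1.symm.trans f2)
        subst g1 g2
        exact .inl hp
      · have g1 := T.inj a hab.1 d hcd.2.1 (e2.symm.trans f1)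
        have g2 := T.inj b hab.2.1 c hcd.1 (e1.symm.trans f2)
        omega
  · rintro (h | h)
    · let d : G.Dart := ⟨((o p).fst, (o q).fst), hpq.1.2.2⟩
      refine ⟨d.symm, ?_, ?_⟩
      · exact (T.faceOf_symm_iff hG hR hpq.1 (by have := hpq.2; omega) (hroot hpq h) (d := d) rfl rfl huv).2 h
      · rw [SimpleGraph.Dart.symm_symm]
        exact innerFace_eq hpq rfl rfl
    · let d : G.Dart := ⟨((o u).fst, (o v).fst), huv.1.2.2⟩
      exact ⟨d, innerFace_eq huv rfl rfl,
        (T.faceOf_symm_iff hG hR huv.1 (by have := huv.2; omega) (hroot huv h) (d := d) rfl rfl hpq).2 h⟩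

/-- The vertices of a bounded face. -/
theorem mem_faceVertices_iff (T : Tour R out n o) (hG : IsKConnected G 2) (hR : R.IsPlanar)
    {u v w : ℕ} (huv : Inner (graph n o) u v) (hw : w < n) :
    (o w).fst ∈ R.faceVertices (innerFace R out n o (u, v)) ↔ OnFace (graph n o) u v w := by
  have D := T.disk hG hR
  obtain ⟨m, x, p⟩ := D.exists_facePath huv
  rw [p.onFace_iff]
  constructor
  · rintro ⟨d, h1, h2⟩
    rcases T.faceOf_cases hG hR huv h1 with ⟨e1, e2⟩ | ⟨a, b, hab, hlt, hr, e1, e2, hp⟩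
    · exact ⟨0, by omega, p.first.trans (T.inj u huv.1.1 w hw (e1.symm.trans h2))⟩
    · obtain ⟨i, hi, -, rfl⟩ := (p.parent_iff D huv hab hlt).1 hp
      exact ⟨i + 1, by omega, T.inj _ hab.2.1 w hw (e1.symm.trans h2)⟩
  · rintro ⟨i, hi, rfl⟩
    rcases i with _ | i
    · exact ⟨⟨((o u).fst, (o v).fst), huv.1.2.2⟩, innerFace_eq huv rfl rfl, by rw [p.first]⟩
    · have hadj := p.adj i (by omega)
      let d : G.Dart := ⟨((o (x i)).fst, (o (x (i + 1))).fst), hadj.2.2⟩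
      have h1 := p.mem_Icc (i := i) (by omega)
      have h2 := p.mem_Icc (i := i + 1) hi
      have h3 := p.side_ne (i := i) (by omega)
      have h4 := huv.1.2.1
      refine ⟨d.symm, ?_, rfl⟩
      exact (T.faceOf_symm_iff hG hR hadj (p.lt_succ i (by omega)) (by omega) (d := d) rfl rfl huv).2
        ((p.parent_iff D huv hadj (p.lt_succ i (by omega))).2 ⟨i, by omega, rfl, rfl⟩)

end Tour

end Faces

/-! ### Leaves and branches of the weak dual -/

section Tree

/-- The vertices of the graph `D` are the faces with inner edges in `H`, adjacent if one is a side
of the other. -/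
structure FaceMap {W : Type*} (H : SimpleGraph ℕ) (D : SimpleGraph W) (F : ℕ → ℕ → W) : Prop where
  inj : ∀ u v p q, Inner H u v → Inner H p q → F u v = F p q → u = p ∧ v = q
  surj : ∀ f, ∃ u v, Inner H u v ∧ F u v = f
  adj_iff : ∀ u v p q, Inner H u v → Inner H p q →
    (D.Adj (F u v) (F p q) ↔ Parent H u v p q ∨ Parent H p q u v)

variable {W : Type*} [Finite W] {H : SimpleGraph ℕ} {D : SimpleGraph W} {F : ℕ → ℕ → W} {n : ℕ}

/-- Inner edges over `p q` are nested by noncrossing, so one of least width is the smallest. -/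
theorem Disk.exists_parent (hD : Disk H n) {p q : ℕ} (hpq : Inner H p q)
    (hroot : p ≠ 0 ∨ q ≠ n - 1) : ∃ u v, Parent H u v p q := by
  classical
  have hlt := hpq.2
  have hq := hD.lt _ _ hpq.1.symm
  have hex : ∃ k u v, Inner H u v ∧ u ≤ p ∧ q ≤ v ∧ (p ≠ u ∨ q ≠ v) ∧ v - u = k :=
    ⟨_, 0, n - 1, ⟨hD.root, by have := hD.three_le; omega⟩, by omega, by omega, hroot, rfl⟩
  obtain ⟨u, v, huv, h1, h2, h3, h4⟩ := Nat.find_spec hex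
  have hmin := fun j => Nat.find_min (m := j) hex
  rw [← h4] at hmin
  refine ⟨u, v, huv, h1, h2, h3, fun r s hrs g1 g2 g3 => ?_⟩
  have hm : ¬ s - r < v - u := fun h => hmin _ h ⟨r, s, hrs, g1, g2, g3, rfl⟩
  have k1 := hD.noncrossing u r v s
  have k2 := hD.noncrossing r u s v
  by_contra hc
  by_cases c1 : u < r
  · exact k1 c1 (by omega) (by omega) huv.1 hrs.1
  · exact k2 (by omega) (by omega) (by omega) hrs.1 huv.1

theorem Parent.unique {u v u' v' p q : ℕ} (h : Parent H u v p q) (h' : Parent H u' v' p q) :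
    u = u' ∧ v = v' := by
  have h1 := h.2.2.2.2 u' v' h'.1 h'.2.1 h'.2.2.1 h'.2.2.2.1
  have h2 := h'.2.2.2.2 u v h.1 h.2.1 h.2.2.1 h.2.2.2.1
  omega

theorem Parent.ne_root (hD : Disk H n) {u v p q : ℕ} (h : Parent H u v p q) :
    p ≠ 0 ∨ q ≠ n - 1 := by
  obtain ⟨h1, h2, h3, h4, -⟩ := h
  have := hD.lt _ _ h1.1.symm
  omega

/-- The face with inner edge `u v` has at most one side that is an inner edge. -/
def UniqueChild (H : SimpleGraph ℕ) (u v : ℕ) : Prop :=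
  ∀ p q p' q', Inner H p q → Inner H p' q' → Parent H u v p q → Parent H u v p' q' →
    p = p' ∧ q = q'

theorem UniqueChild.earCount_eq (hD : Disk H n) {u v p q : ℕ} (h : UniqueChild H u v)
    (hpq : Inner H p q) (hp : Parent H u v p q) : earCount H u v = earCount H p q := by
  obtain ⟨m, x, P⟩ := hD.exists_facePath hp.1
  obtain ⟨j, hj, rfl, rfl⟩ := (P.parent_iff hD hp.1 hpq.1 (by have := hpq.2; omega)).1 hp
  rw [P.earCount_eq hj hpq, Finset.sum_eq_single j]
  · intro i hi hij
    have hi : i ≤ m := by simpa [Nat.lt_succ_iff] using hi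
    rcases P.inner_or_edge hi with hin | he
    · have := h _ _ _ _ hpq hin hp
        ((P.parent_iff hD hp.1 hin.1 (P.lt_succ i hi)).2 ⟨i, hi, rfl, rfl⟩)
      have h1 := P.le_iff (i := i) (j := j) (by omega) (by omega)
      have h2 := P.le_iff (i := j) (j := i) (by omega) (by omega)
      omega
    · rw [he, earCount_succ]
  · intro h
    exact absurd (Finset.mem_range.2 (by omega)) h

theorem Disk.ear_of_no_child (hD : Disk H n) {u v : ℕ} (huv : Inner H u v)
    (h : ∀ p q, Inner H p q → ¬ Parent H u v p q) : Ear H u v := by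
  obtain ⟨m, x, P⟩ := hD.exists_facePath huv
  refine P.ear_of_sides huv fun i hi => (P.inner_or_edge hi).resolve_left fun hin => ?_
  exact h _ _ hin ((P.parent_iff hD huv hin.1 (P.lt_succ i hi)).2 ⟨i, hi, rfl, rfl⟩)

namespace FaceMap

theorem adj_of_parent (M : FaceMap H D F) {u v p q : ℕ} (hpq : Inner H p q)
    (h : Parent H u v p q) : D.Adj (F u v) (F p q) :=
  (M.adj_iff _ _ _ _ h.1 hpq).2 (.inl h)

theorem eq_or_eq_of_deg_le_two {f a b c : W} (h : deg D f ≤ 2) (ha : D.Adj f a) (hb : D.Adj f b)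
    (hc : D.Adj f c) (hab : a ≠ b) (hac : a ≠ c) : b = c := by
  by_contra hbc
  have h1 : ({a, b, c} : Set W) ⊆ D.neighborSet f := by
    rintro x (rfl | rfl | rfl) <;> assumption
  have h2 := Set.ncard_le_ncard h1 (Set.toFinite _)
  rw [Set.ncard_eq_three.2 ⟨a, b, c, hab, hac, hbc, rfl⟩] at h2
  unfold deg at h
  omega

theorem two_le_deg {f a b : W} (ha : D.Adj f a) (hb : D.Adj f b) (hab : a ≠ b) : 2 ≤ deg D f := by
  have h1 : ({a, b} : Set W) ⊆ D.neighborSet f := by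
    rintro x (rfl | rfl) <;> assumption
  have h2 := Set.ncard_le_ncard h1 (Set.toFinite _)
  rwa [Set.ncard_pair hab] at h2

theorem ne_of_parents (M : FaceMap H D F) {u v p q r s : ℕ} (hpq : Inner H p q)
    (h : Parent H u v r s) (h' : Parent H r s p q) : F u v ≠ F p q := by
  intro he
  obtain ⟨rfl, rfl⟩ := M.inj _ _ _ _ h.1 hpq he
  have := h.2.1
  have := h.2.2.1
  have := h.2.2.2.1
  have := h'.2.1
  have := h'.2.2.1
  omega

/-- One of at most two neighbors is the parent; the root face, which has none, is covered by
`hroot`. -/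
theorem uniqueChild_of_deg_le_two (M : FaceMap H D F) (hD : Disk H n)
    (hroot : UniqueChild H 0 (n - 1)) {u v : ℕ} (huv : Inner H u v) (h : deg D (F u v) ≤ 2) :
    UniqueChild H u v := by
  by_cases hr : u = 0 ∧ v = n - 1
  · rw [hr.1, hr.2]
    exact hroot
  · obtain ⟨r, s, hp⟩ := hD.exists_parent huv (by omega)
    intro p q p' q' hpq hpq' h1 h2
    have := eq_or_eq_of_deg_le_two h (M.adj_of_parent huv hp).symm (M.adj_of_parent hpq h1)
      (M.adj_of_parent hpq' h2) (M.ne_of_parents hpq hp h1) (M.ne_of_parents hpq' hp h2)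
    exact M.inj _ _ _ _ hpq hpq' this

theorem deg_le_two_of_branch {f : W} (h : IsBranch D f) : deg D f ≤ 2 := by
  cases h with
  | of_leaf _ _ h _ _ => exact h.le
  | of_branch _ _ h _ _ => exact h.le

/-- Next to a face of degree at most two, the number of ears does not change. -/
theorem earCount_eq_of_adj (M : FaceMap H D F) (hD : Disk H n) (hroot : UniqueChild H 0 (n - 1))
    {u v p q : ℕ} (huv : Inner H u v) (hpq : Inner H p q) (h1 : Parent H u v p q)
    (hd : deg D (F u v) ≤ 2) : earCount H u v = earCount H p q :=
  (M.uniqueChild_of_deg_le_two hD hroot huv hd).earCount_eq hD hpq h1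

theorem earCount_of_leaf (M : FaceMap H D F) (hD : Disk H n) {u v : ℕ} (huv : Inner H u v)
    (h : IsLeaf D (F u v)) : earCount H u v = 1 ∨ earCount H u v = earCount H 0 (n - 1) := by
  by_cases hr : u = 0 ∧ v = n - 1
  · rw [hr.1, hr.2]
    exact .inr rfl
  · obtain ⟨r, s, hp⟩ := hD.exists_parent huv (by omega)
    refine .inl (hD.ear_of_no_child huv fun p q hpq hc => ?_).earCount_eq
    have := two_le_deg (M.adj_of_parent huv hp).symm (M.adj_of_parent hpq hc)
      (M.ne_of_parents hpq hp hc)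
    unfold IsLeaf at h
    omega

/-- Ear counts are constant along a chain of faces of degree at most two. The leaf that starts the
chain is an ear or the root. -/
theorem earCount_of_branch (M : FaceMap H D F) (hD : Disk H n) (hroot : UniqueChild H 0 (n - 1))
    {f : W} (h : IsBranch D f) : ∀ u v, Inner H u v → F u v = f →
      earCount H u v = 1 ∨ earCount H u v = earCount H 0 (n - 1) := by
  have key : ∀ u v p q, Inner H u v → Inner H p q → deg D (F u v) ≤ 2 → deg D (F p q) ≤ 2 →
      D.Adj (F u v) (F p q) → earCount H u v = earCount H p q := by
    intro u v p q huv hpq h1 h2 h3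
    rcases (M.adj_iff _ _ _ _ huv hpq).1 h3 with h | h
    · exact M.earCount_eq_of_adj hD hroot huv hpq h h1
    · exact (M.earCount_eq_of_adj hD hroot hpq huv h h2).symm
  induction h with
  | of_leaf f g hf hfg hg =>
    rintro u v huv rfl
    obtain ⟨p, q, hpq, rfl⟩ := M.surj g
    rw [key u v p q huv hpq hf.le (hg.trans one_le_two) hfg]
    exact M.earCount_of_leaf hD hpq hg
  | of_branch f g hf hfg hg ih =>
    rintro u v huv rfl
    obtain ⟨p, q, hpq, rfl⟩ := M.surj g
    rw [key u v p q huv hpq hf.le (deg_le_two_of_branch hg) hfg]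
    exact ih p q hpq rfl

/-- A face all of whose sides have an even number of ears is a trunk vertex, if there are
enough ears outside. -/
theorem isTrunk_of_even (M : FaceMap H D F) (hD : Disk H n) (hroot : UniqueChild H 0 (n - 1))
    {u v m : ℕ} {x : ℕ → ℕ} (huv : Inner H u v) (P : FacePath H u v m x)
    (he : ∀ i ≤ m, Even (earCount H (x i) (x (i + 1))))
    (hin : ∃ i ≤ m, Inner H (x i) (x (i + 1)))
    (hlt : earCount H u v < earCount H 0 (n - 1)) : IsTrunk D (F u v) := by
  obtain ⟨j, hj, hin⟩ := hin
  have hne : u ≠ 0 ∨ v ≠ n - 1 := by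
    by_contra hc
    push Not at hc
    rw [hc.1, hc.2] at hlt
    exact lt_irrefl _ hlt
  obtain ⟨r, s, hp⟩ := hD.exists_parent huv hne
  have hc := (P.parent_iff hD huv hin.1 (P.lt_succ j hj)).2 ⟨j, hj, rfl, rfl⟩
  have htwo : 2 ≤ earCount H u v := by
    have h1 := one_le_earCount hin
    obtain ⟨k, hk⟩ := he j hj
    have h2 := earCount_mono (H := H) hc.2.1 hc.2.2.1
    omega
  refine ⟨two_le_deg (M.adj_of_parent huv hp).symm (M.adj_of_parent hin hc)
    (M.ne_of_parents hin hp hc), fun g hg => ?_⟩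
  obtain ⟨p, q, hpq, rfl⟩ := M.surj g
  -- A leaf or branch below would have an even ear count smaller than the total. One above would
  -- share the count of `u v`, which is at least two and below the total.
  have key : deg D (F p q) ≤ 2 → earCount H p q = 1 ∨ earCount H p q = earCount H 0 (n - 1) →
      False := by
    intro hd hcount
    rcases (M.adj_iff _ _ _ _ huv hpq).1 hg with h | h
    · obtain ⟨i, hi, rfl, rfl⟩ := (P.parent_iff hD huv hpq.1 (by have := hpq.2; omega)).1 h
      have h1 := one_le_earCount hpq
      obtain ⟨k, hk⟩ := he i hi
      have h2 := earCount_mono (H := H) h.2.1 h.2.2.1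
      omega
    · have := M.earCount_eq_of_adj hD hroot hpq huv h hd
      omega
  exact ⟨fun hl => key (hl.trans one_le_two) (M.earCount_of_leaf hD hpq hl),
    fun hb => key (deg_le_two_of_branch hb) (M.earCount_of_branch hD hroot hb p q hpq rfl)⟩

theorem not_foliage_of_trunk {f : W} (h : IsTrunk D f) :
    ¬ (IsLeaf D f ∨ IsBranch D f ∨ IsLimb D f) := by
  rintro (h1 | h1 | ⟨-, g, h2, h3⟩)
  · have := h.1
    unfold IsLeaf at h1
    omega
  · cases h1 with
    | of_leaf _ g _ hfg hg => exact (h.2 g hfg).1 hg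
    | of_branch _ g _ hfg hg => exact (h.2 g hfg).2 hg
  · rcases h3 with h3 | h3
    exacts [(h.2 g h2).1 h3, (h.2 g h2).2 h3]

theorem isLeaf_of_forall {f : W} (h : ∀ a b, D.Adj f a → D.Adj f b → a = b) : IsLeaf D f := by
  unfold IsLeaf deg
  rw [Set.ncard_le_one (Set.toFinite _)]
  exact fun a ha b hb => h a b ha hb

theorem isLeaf_of_ear (M : FaceMap H D F) {u v : ℕ} (h : Ear H u v) : IsLeaf D (F u v) := by
  have key : ∀ p q, Inner H p q → D.Adj (F u v) (F p q) → Parent H p q u v := by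
    intro p q hpq hadj
    refine ((M.adj_iff _ _ _ _ h.1 hpq).1 hadj).resolve_left fun hp => ?_
    have h1 := h.2 p q hpq hp.2.1 hp.2.2.1
    have h2 := hp.2.2.2.1
    omega
  refine isLeaf_of_forall fun a b ha hb => ?_
  obtain ⟨p, q, hpq, rfl⟩ := M.surj a
  obtain ⟨p', q', hpq', rfl⟩ := M.surj b
  obtain ⟨rfl, rfl⟩ := (key _ _ hpq ha).unique (key _ _ hpq' hb)
  rfl

theorem isLeaf_root (M : FaceMap H D F) (hD : Disk H n) (hroot : UniqueChild H 0 (n - 1)) :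
    IsLeaf D (F 0 (n - 1)) := by
  have hin : Inner H 0 (n - 1) := ⟨hD.root, by have := hD.three_le; omega⟩
  have key : ∀ p q, Inner H p q → D.Adj (F 0 (n - 1)) (F p q) → Parent H 0 (n - 1) p q := by
    intro p q hpq hadj
    refine ((M.adj_iff _ _ _ _ hin hpq).1 hadj).resolve_right fun hp => ?_
    have := hp.ne_root hD
    omega
  refine isLeaf_of_forall fun a b ha hb => ?_
  obtain ⟨p, q, hpq, rfl⟩ := M.surj a
  obtain ⟨p', q', hpq', rfl⟩ := M.surj b
  obtain ⟨rfl, rfl⟩ := hroot _ _ _ _ hpq hpq' (key _ _ hpq ha) (key _ _ hpq' hb)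
  rfl

/-- The ears and the root face are leaves. -/
theorem earCount_lt_ncard_leaves (M : FaceMap H D F) (hD : Disk H n)
    (hroot : UniqueChild H 0 (n - 1)) {p q : ℕ} (hpq : Inner H p q) (hne : p ≠ 0 ∨ q ≠ n - 1) :
    earCount H 0 (n - 1) + 1 ≤ {f | IsLeaf D f}.ncard := by
  classical
  have hin : Inner H 0 (n - 1) := ⟨hD.root, by have := hD.three_le; omega⟩
  -- The second inner edge `p q` keeps the root from being an ear, so it is one more leaf.
  have hnot : (0, n - 1) ∉ ears H 0 (n - 1) := by
    intro h
    have h1 := (mem_ears.1 h).1.2 p q hpq (Nat.zero_le _) (by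
      have := hD.lt _ _ hpq.1.symm
      dsimp only
      omega)
    dsimp only at h1
    omega
  rw [earCount, ← Finset.card_insert_of_notMem hnot, ← Set.ncard_coe_finset]
  have hmem : ∀ e ∈ insert (0, n - 1) (ears H 0 (n - 1)), Inner H e.1 e.2 ∧ IsLeaf D (F e.1 e.2) := by
    intro e he
    rcases Finset.mem_insert.1 he with rfl | he
    · exact ⟨hin, M.isLeaf_root hD hroot⟩
    · have := (mem_ears.1 he).1
      exact ⟨this.1, M.isLeaf_of_ear this⟩
  refine Set.ncard_le_ncard_of_injOn (fun e => F e.1 e.2) (fun e he => (hmem e he).2) ?_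
    (Set.toFinite _)
  intro a ha b hb hab
  have := M.inj _ _ _ _ (hmem a ha).1 (hmem b hb).1 hab
  exact Prod.ext this.1 this.2

end FaceMap

end Tree

/-! ### The layout of an outerplanar embedding -/

section Final

variable {V : Type*} [Fintype V] [DecidableEq V] {G : SimpleGraph V} [DecidableRel G.Adj]

namespace Tour

theorem layout {R : RotationSystem G} {out : R.Face} {n : ℕ} {o : ℕ → G.Dart} (T : Tour R out n o)
    (hG : IsKConnected G 2) (hR : R.IsPlanar) : Layout G (graph n o) n fun t => (o t).fst where
  disk := T.disk hG hR
  adj_iff _ hi _ hj := ⟨fun h => ⟨hi, hj, h⟩, fun h => h.2.2⟩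
  inj := T.inj
  surj := T.surj

variable {Γ : OuterplanarEmbedding G} {n : ℕ} {o : ℕ → G.Dart}

open Classical in
/-- The bounded face on the inner side of an inner edge. -/
noncomputable def boundedFace (T : Tour Γ.toRotationSystem Γ.outer n o) (hG : IsKConnected G 2)
    (p q : ℕ) : Γ.InnerFace :=
  if h : Inner (graph n o) p q then
    ⟨innerFace Γ.toRotationSystem Γ.outer n o (p, q), T.innerFace_ne hG Γ.isPlanar h⟩
  -- A dummy value: a bounded face has to be named for every pair, and the root face always exists.
  else
    ⟨innerFace Γ.toRotationSystem Γ.outer n o (0, n - 1), T.innerFace_ne hG Γ.isPlanar T.inner_root⟩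

theorem boundedFace_val (T : Tour Γ.toRotationSystem Γ.outer n o) (hG : IsKConnected G 2)
    {p q : ℕ} (h : Inner (graph n o) p q) :
    (T.boundedFace hG p q).1 = innerFace Γ.toRotationSystem Γ.outer n o (p, q) := by
  rw [boundedFace, dif_pos h]

theorem faceMap (T : Tour Γ.toRotationSystem Γ.outer n o) (hG : IsKConnected G 2) :
    FaceMap (graph n o) Γ.weakDual (T.boundedFace hG) := by
  have hinj : ∀ u v p q, Inner (graph n o) u v → Inner (graph n o) p q →
      T.boundedFace hG u v = T.boundedFace hG p q → u = p ∧ v = q := by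
    intro u v p q huv hpq h
    have := congrArg Subtype.val h
    rw [T.boundedFace_val hG huv, T.boundedFace_val hG hpq] at this
    exact T.innerFace_inj hG Γ.isPlanar huv hpq this
  refine ⟨hinj, fun f => ?_, fun u v p q huv hpq => ?_⟩
  · obtain ⟨p, q, hpq, h⟩ := T.exists_innerFace hG Γ.isPlanar f.2
    exact ⟨p, q, hpq, Subtype.ext ((T.boundedFace_val hG hpq).trans h)⟩
  · rw [← T.exists_dart_iff hG Γ.isPlanar huv hpq, ← T.boundedFace_val hG huv,
      ← T.boundedFace_val hG hpq]
    refine ⟨fun h => h.2, fun h => ⟨fun heq => ?_, h⟩⟩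
    obtain ⟨rfl, rfl⟩ := hinj _ _ _ _ huv hpq heq
    rw [T.boundedFace_val hG huv, T.exists_dart_iff hG Γ.isPlanar huv huv] at h
    rcases h with h | h <;>
    · have := h.2.2.2.1
      omega

open Classical in
/-- Twice the contribution of a vertex to the bound. -/
noncomputable def weight (Γ : OuterplanarEmbedding G) (v : V) : ℕ :=
  if v ∈ Γ.trunkVertices then if v ∈ Γ.foliageVertices then 1 else 2 else 0

/-- The last parameter counts the ears and the root leaf. A region short of it by two misses an ear,
which is the condition for being a trunk face. -/
theorem weighted (T : Tour Γ.toRotationSystem Γ.outer n o) (hG : IsKConnected G 2)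
    (hroot : UniqueChild (graph n o) 0 (n - 1)) :
    Weighted (graph n o) (fun u v => IsTrunk Γ.weakDual (T.boundedFace hG u v))
      (fun u v => IsLeaf Γ.weakDual (T.boundedFace hG u v) ∨
        IsBranch Γ.weakDual (T.boundedFace hG u v) ∨ IsLimb Γ.weakDual (T.boundedFace hG u v))
      (fun t => weight Γ (o t).fst) (earCount (graph n o) 0 (n - 1) + 1) := by
  have D := T.disk hG Γ.isPlanar
  have M := T.faceMap hG
  have hmem : ∀ u v w, Inner (graph n o) u v → OnFace (graph n o) u v w →
      (o w).fst ∈ Γ.toRotationSystem.faceVertices (T.boundedFace hG u v).1 := by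
    intro u v w huv hw
    rw [T.boundedFace_val hG huv]
    exact (T.mem_faceVertices_iff hG Γ.isPlanar huv (hw.2.1.trans_lt huv.1.2.1)).2 hw
  have htrunk : ∀ u v w, Inner (graph n o) u v → IsTrunk Γ.weakDual (T.boundedFace hG u v) →
      OnFace (graph n o) u v w → (o w).fst ∈ Γ.trunkVertices :=
    fun u v w huv ht hw => ⟨_, ht, hmem u v w huv hw⟩
  refine ⟨fun u v m x huv P he hin hlt => M.isTrunk_of_even D hroot huv P he hin (by omega),
    fun u v h => FaceMap.not_foliage_of_trunk h, fun u v w huv ht hw => ?_,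
    fun u v w huv ht hw h => ?_⟩
  · simp only [weight, if_pos (htrunk u v w huv ht hw)]
    split_ifs <;> omega
  · simp only [weight, if_pos (htrunk u v w huv ht hw)]
    rw [if_neg]
    rintro ⟨f, hf, hwf⟩
    obtain ⟨p, q, hpq, rfl⟩ := M.surj f
    rw [T.boundedFace_val hG hpq,
      T.mem_faceVertices_iff hG Γ.isPlanar hpq (hw.2.1.trans_lt huv.1.2.1)] at hwf
    exact h p q hpq hf hwf

theorem sum_weight (T : Tour Γ.toRotationSystem Γ.outer n o) :
    ∑ t ∈ Finset.range n, weight Γ (o t).fst + Γ.numBoundary = 2 * Γ.numTrunk := by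
  classical
  have h1 : ∑ t ∈ Finset.range n, weight Γ (o t).fst = ∑ v, weight Γ v := by
    refine Finset.sum_nbij (fun t => (o t).fst) (fun _ _ => Finset.mem_univ _) ?_ ?_
      fun _ _ => rfl
    · intro i hi j hj h
      exact T.inj i (by simpa using hi) j (by simpa using hj) h
    · intro v _
      obtain ⟨i, hi, h⟩ := T.surj v
      exact ⟨i, by simpa using hi, h⟩
  have hc : ∀ A : Set V, A.ncard = ∑ v, if v ∈ A then 1 else 0 := by
    intro A
    rw [Set.ncard_eq_toFinset_card', Finset.sum_boole]
    simp only [Nat.cast_id]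
    congr 1
    ext v
    simp
  rw [h1, OuterplanarEmbedding.numBoundary, OuterplanarEmbedding.numTrunk, hc, hc,
    ← Finset.sum_add_distrib, Finset.mul_sum]
  refine Finset.sum_congr rfl fun v _ => ?_
  simp only [weight, OuterplanarEmbedding.boundaryVertices, Set.mem_inter_iff]
  by_cases c1 : v ∈ Γ.trunkVertices <;> by_cases c2 : v ∈ Γ.foliageVertices <;> simp [c1, c2]

/-- If the graph is not a cycle, there is a tour for which the face of the root edge has only one
side that is a chord. -/
theorem exists_unique_root {R : RotationSystem G} {out : R.Face} (hG : IsKConnected G 2)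
    (hR : R.IsPlanar) (hout : R.faceVertices out = Set.univ) :
    (∃ n o, Tour R out n o ∧ ∀ p q, Inner (graph n o) p q → p = 0 ∧ q = n - 1) ∨
    ∃ n o, Tour R out n o ∧ UniqueChild (graph n o) 0 (n - 1) ∧
      ∃ p q, Inner (graph n o) p q ∧ (p ≠ 0 ∨ q ≠ n - 1) := by
  classical
  obtain ⟨v⟩ := (hG.connected two_pos).nonempty
  obtain ⟨d, hd, -⟩ : v ∈ R.faceVertices out := hout ▸ Set.mem_univ v
  have T := R.exists_tour hG hR hout hd
  obtain ⟨n, hn⟩ : ∃ n, n = Fintype.card V := ⟨_, rfl⟩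
  obtain ⟨o, ho⟩ : ∃ o : ℕ → G.Dart, o = fun t => (R.facePerm)^[t] d := ⟨_, rfl⟩
  rw [← hn, ← ho] at T
  by_cases hcyc : ∀ p q, Inner (graph n o) p q → p = 0 ∧ q = n - 1
  · exact .inl ⟨n, o, T, hcyc⟩
  push Not at hcyc
  obtain ⟨p, q, hpq, hne⟩ := hcyc
  -- A chord spanning the fewest steps of the cycle cuts off a face bounded otherwise by outer
  -- edges. The periodic indexing of `o` lets the span wrap around.
  have hex : ∃ r, 2 ≤ r ∧ ∃ t, G.Adj (o t).fst (o (t + r)).fst :=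
    ⟨q - p, by have := hpq.2; omega, p, by
      rw [show p + (q - p) = q by have := hpq.2; omega]
      exact hpq.1.2.2⟩
  have hspec := Nat.find_spec hex
  have hle : Nat.find hex ≤ q - p := Nat.find_le ⟨by have := hpq.2; omega, p, by
      rw [show p + (q - p) = q by have := hpq.2; omega]
      exact hpq.1.2.2⟩
  have hmin := fun j => Nat.find_min (m := j) hex
  generalize Nat.find hex = r at hspec hmin hle
  obtain ⟨hr2, t, ht⟩ := hspec
  have hqn := hpq.1.2.1
  -- Starting just after the first end of this chord turns it into the pair `r - 1, n - 1`, with the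
  -- root edge on the face it cuts off.
  have T' := R.exists_tour hG hR hout (T.face (t + 1))
  rw [← hn] at T'
  obtain ⟨o', ho'⟩ : ∃ o' : ℕ → G.Dart, o' = fun i => (R.facePerm)^[i] (o (t + 1)) := ⟨_, rfl⟩
  rw [← ho'] at T'
  have hoo : ∀ i, o' i = o (i + (t + 1)) := by
    intro i
    simp only [ho', ho, Function.iterate_add_apply]
  have D := T'.disk hG hR
  have hmin' : ∀ i j, i + 2 ≤ j → j < i + r → ¬ G.Adj (o i).fst (o j).fst := by
    intro i j h1 h2 h3
    refine hmin (j - i) (by omega) ⟨by omega, i, ?_⟩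
    rwa [show i + (j - i) = j by omega]
  have hlast : o' (n - 1) = o t := by
    rw [hoo, show n - 1 + (t + 1) = t + n by omega, T.period]
  have hm : Inner (graph n o') (r - 1) (n - 1) := by
    refine ⟨⟨by omega, by omega, ?_⟩, by omega⟩
    rw [hlast, hoo, show r - 1 + (t + 1) = t + r by omega]
    exact ht.symm
  have hmle : ∀ p q, Inner (graph n o') p q → (p ≠ 0 ∨ q ≠ n - 1) → r - 1 ≤ p := by
    intro p q h hne
    by_contra hc
    have hlt := h.2
    have hq := h.1.2.1
    by_cases hql : q = n - 1
    · subst hql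
      have hadj := h.1.2.2
      rw [hlast, hoo] at hadj
      exact hmin' t (p + (t + 1)) (by omega) (by omega) hadj.symm
    · by_cases hqr : q < p + r
      · have hadj := h.1.2.2
        rw [hoo, hoo] at hadj
        exact hmin' _ _ (by omega) (by omega) hadj
      · exact D.noncrossing p (r - 1) q (n - 1) (by omega) (by omega) (by omega) h.1 hm.1
  refine .inr ⟨n, o', T', ?_, r - 1, n - 1, hm, by omega⟩
  have key : ∀ p q, Inner (graph n o') p q → Parent (graph n o') 0 (n - 1) p q →
      p = r - 1 ∧ q = n - 1 := by
    intro p q h hp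
    have h1 := hmle p q h (hp.ne_root D)
    by_contra hc
    have := h.1.2.1
    have := hp.2.2.2.2 (r - 1) (n - 1) hm h1 (by omega) (by omega)
    omega
  intro p q p' q' h h' hp hp'
  have h1 := key p q h hp
  have h2 := key p' q' h' hp'
  omega

end Tour

end Final

end ZeroForcing

/-! ### The stated inequality -/

theorem mainTheorem2 {V : Type*} [Finite V] (G : SimpleGraph V)
    (hG : ZeroForcing.IsKConnected G 2) (Γ : ZeroForcing.OuterplanarEmbedding G) :
    (ZeroForcing.zeroForcingNumber G : ℝ) ≤
      2 * (⌈(Γ.numLeaves : ℝ) / 2⌉ : ℝ) + ((Γ.numTrunk : ℝ) - (Γ.numBoundary : ℝ) / 2) / 2 := by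
  classical
  have := Fintype.ofFinite V
  -- Four times the inequality over the integers, with `(k + 1) / 2` in place of the ceiling of half
  -- of `k`.
  suffices h : 4 * ZeroForcing.zeroForcingNumber G + Γ.numBoundary ≤
      8 * ((Γ.numLeaves + 1) / 2) + 2 * Γ.numTrunk by
    have h1 : (((Γ.numLeaves + 1) / 2 : ℕ) : ℤ) ≤ ⌈(Γ.numLeaves : ℝ) / 2⌉ := by
      have h2 := Int.le_ceil ((Γ.numLeaves : ℝ) / 2)
      rw [div_le_iff₀ (by norm_num)] at h2
      have h3 : (Γ.numLeaves : ℤ) ≤ ⌈(Γ.numLeaves : ℝ) / 2⌉ * 2 := by exact_mod_cast h2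
      omega
    have h1' : (((Γ.numLeaves + 1) / 2 : ℕ) : ℝ) ≤ (⌈(Γ.numLeaves : ℝ) / 2⌉ : ℝ) := by
      have := (Int.cast_le (R := ℝ)).2 h1
      rwa [Int.cast_natCast] at this
    have h' : 4 * (ZeroForcing.zeroForcingNumber G : ℝ) + Γ.numBoundary ≤
      8 * (((Γ.numLeaves + 1) / 2 : ℕ) : ℝ) + 2 * Γ.numTrunk := by exact_mod_cast h
    linarith
  rcases ZeroForcing.Tour.exists_unique_root hG Γ.isPlanar Γ.outer_vertices with
    ⟨n, o, T, hcyc⟩ | ⟨n, o, T, hroot, p, q, hpq, hne⟩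
  -- For a cycle two vertices suffice, and its only bounded face counts as a leaf.
  · have h1 := (T.layout hG Γ.isPlanar).zeroForcingNumber_le_two hcyc
    have hD := T.disk hG Γ.isPlanar
    have h2 := (T.faceMap hG).isLeaf_root hD fun p q p' q' h h' _ _ => by
      have := hcyc p q h
      have := hcyc p' q' h'
      omega
    have h3 : 1 ≤ Γ.numLeaves := (Set.ncard_pos (Set.toFinite _)).2 ⟨_, h2⟩
    have h4 := T.sum_weight
    omega
  · have hD := T.disk hG Γ.isPlanar
    have h1 := (T.layout hG Γ.isPlanar).four_mul_zeroForcingNumber_le (T.weighted hG hroot) le_rfl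
    have h2 : _ ≤ Γ.numLeaves := (T.faceMap hG).earCount_lt_ncard_leaves hD hroot hpq hne
    have h3 := T.sum_weight
    omega
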